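/- A \emph{mixed 1D crease pattern} consists of a line segment (the paper) with ends $x_0<x_{n+1}$ and finitely many creases $x_0<x_1<\dots<x_n<x_{n+1}$, $n\ge 0$, each of which is assigned mountain, assigned valley, or unassigned. A \emph{one-layer simple fold} of a flat folded state creases a single layer of the paper, at a not yet folded crease: one of the two parts into which this crease divides the paper, which must lie weakly on one side of the vertical fold line through the crease, is rotated by $\pm180^\circ$ about the fold line, upwards or downwards, without passing through the rest of the paper. (Thus, when it moves up, none of the remaining paper lies above it, and afterwards it lies above all the remaining paper that it overlaps; symmetrically when it moves down.) The fold makes the crease a mountain or a valley and has to agree with the assignment of the crease, if there is one. The pattern \emph{can be folded flat using one-layer simple folds} if some finite sequence of one-layer simple folds, starting from the unfolded paper, folds all creases. \textbf{Corollary.} There is a polynomial-time algorithm that decides, given a mixed 1D crease pattern, whether it can be folded flat using one-layer simple folds. Here the coordinates $x_0,\dots,x_{n+1}$ are rational numbers, given in increasing order as binary integers over a common denominator, and polynomial time means: a single program for a random access machine with addition, subtraction, comparison and indirect addressing on integers runs in logarithmic-cost time (every operation is charged the bit lengths of the integers involved) that is bounded by a polynomial in the total number of bits of the input. -/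

import Mathlib

/-! ## Mixed one-dimensional crease patterns -/

/-- The two ways in which a crease can be folded. -/
inductive FoldType
  | mountain
  | valley

/-- A mixed 1D crease pattern with `n` creases.  The paper is the segment from `vertex 0` to
`vertex (n + 1)`, and the creases are the `n` interior vertices, from left to right.  A crease is
assigned a fold type (`some _`) or is unassigned (`none`). -/
structure MixedCreasePattern (n : ℕ) where
  vertex : Fin (n + 2) → ℝ
  strictMono_vertex : StrictMono vertex
  label : Fin n → Option FoldType

/-! ## Folded states and one-layer simple folds

Crease `k : Fin n` is the vertex `k + 1`.  Segment `j : Fin (n + 1)` joins the vertices `j` and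
`j + 1`, so crease `k` lies between the segments `k` and `k + 1`. -/

/-- The vertex at which crease `k` lies. -/
def creaseVertex {n : ℕ} (k : Fin n) : Fin (n + 2) := k.castSucc.succ

/-- A state reached while folding: the horizontal position of every vertex, the creases that are
already folded (with their fold type), and the layer order (`above i j`: segment `i` lies above
segment `j`, which is only meaningful where the two segments overlap). -/
structure FoldedState (n : ℕ) where
  pos : Fin (n + 2) → ℝ
  folded : Fin n → Option FoldType
  above : Fin (n + 1) → Fin (n + 1) → Prop

/-- The unfolded paper: no crease is folded, and no two segments overlap. -/
def MixedCreasePattern.unfolded {n : ℕ} (P : MixedCreasePattern n) : FoldedState n where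
  pos := P.vertex
  folded := fun _ => none
  above := fun _ _ => False

/-- Which of the two parts of the paper, left or right of the crease in the unfolded paper,
is rotated. -/
inductive PaperPart
  | left
  | right

/-- The direction in which the moving part leaves: over the top or through below. -/
inductive FoldDirection
  | up
  | down

/-- The vertex `v` belongs to the moving part (the crease itself belongs to both parts). -/
def MovesVertex {n : ℕ} (k : Fin n) : PaperPart → Fin (n + 2) → Prop
  | .left, v => v ≤ creaseVertex k
  | .right, v => creaseVertex k ≤ v

/-- The segment `j` belongs to the moving part. -/
def MovesSegment {n : ℕ} (k : Fin n) : PaperPart → Fin (n + 1) → Prop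
  | .left, j => j ≤ k.castSucc
  | .right, j => k.castSucc < j

namespace FoldedState

variable {n : ℕ}

/-- The open horizontal interval covered by segment `j`. -/
def shadow (s : FoldedState n) (j : Fin (n + 1)) : Set ℝ :=
  Set.Ioo (min (s.pos j.castSucc) (s.pos j.succ)) (max (s.pos j.castSucc) (s.pos j.succ))

/-- Two segments overlap if they cover a common open interval. -/
def Overlap (s : FoldedState n) (i j : Fin (n + 1)) : Prop :=
  (s.shadow i ∩ s.shadow j).Nonempty

/-- The moving part lies (weakly) on one side of the vertical fold line through crease `k`. -/
def OnOneSide (s : FoldedState n) (k : Fin n) (part : PaperPart) : Prop :=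
  (∀ v, MovesVertex k part v → s.pos (creaseVertex k) ≤ s.pos v) ∨
    (∀ v, MovesVertex k part v → s.pos v ≤ s.pos (creaseVertex k))

/-- The moving part can leave in the given direction: no segment that stays lies above it (if it
moves up) or below it (if it moves down). -/
def Unobstructed (s : FoldedState n) (k : Fin n) (part : PaperPart) (dir : FoldDirection) : Prop :=
  ∀ i j, MovesSegment k part i → ¬ MovesSegment k part j → s.Overlap i j →
    match dir with
    | .up => ¬ s.above j i
    | .down => ¬ s.above i j

/-- The paper has its front side up at (still unfolded) crease `k`. -/
def FrontUp (s : FoldedState n) (k : Fin n) : Prop :=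
  s.pos (creaseVertex k) < s.pos k.succ.succ

open Classical in
/-- Folding upwards makes a valley if the front side is up and a mountain if the back side is up;
folding downwards does the opposite. -/
noncomputable def resultingType (s : FoldedState n) (k : Fin n) : FoldDirection → FoldType
  | .up => if s.FrontUp k then .valley else .mountain
  | .down => if s.FrontUp k then .mountain else .valley

open Classical in
/-- Rotate one part of the paper by 180 degrees about crease `k`: its vertices are reflected at the
fold line, its layers are reversed, and it lands above (if it moves up) or below (if it moves down)
all the paper that stays. -/
noncomputable def rotate (s : FoldedState n) (k : Fin n) (part : PaperPart) (dir : FoldDirection) :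
    FoldedState n where
  pos := fun v =>
    if MovesVertex k part v then 2 * s.pos (creaseVertex k) - s.pos v else s.pos v
  folded := Function.update s.folded k (some (s.resultingType k dir))
  above := fun i j =>
    if MovesSegment k part i then
      if MovesSegment k part j then s.above j i
      else match dir with
        | .up => True
        | .down => False
    else
      if MovesSegment k part j then
        match dir with
        | .up => False
        | .down => True
      else s.above i j

end FoldedState

/-- A fold type is permitted at a crease with the given label. -/
def Permits : Option FoldType → FoldType → Prop
  | none, _ => True
  | some a, b => a = b

/-- One-layer simple fold.  A single layer of paper is creased, at the not yet folded crease `k`;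
the part of the paper on one side of the fold line that hangs on this layer is rotated by 180
degrees about the fold line without passing through other paper.  (In particular the creased layer
is the top or bottom layer at the fold line.)  The fold type must agree with the label of `k`. -/
def OneLayerSimpleFold {n : ℕ} (P : MixedCreasePattern n) (s s' : FoldedState n) : Prop :=
  ∃ (k : Fin n) (part : PaperPart) (dir : FoldDirection),
    s.folded k = none ∧ Permits (P.label k) (s.resultingType k dir) ∧
    s.OnOneSide k part ∧ s.Unobstructed k part dir ∧ s' = s.rotate k part dir

/-- The crease pattern can be folded flat by one-layer simple folds: some finite sequence of such
folds, starting from the unfolded paper, folds all the creases. -/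
def MixedCreasePattern.OneLayerFoldable {n : ℕ} (P : MixedCreasePattern n) : Prop :=
  ∃ s : FoldedState n,
    Relation.ReflTransGen (OneLayerSimpleFold P) P.unfolded s ∧ ∀ k, s.folded k ≠ none

/-! ## Random access machines with logarithmic cost

Programs of a random access machine with integer cells, in structured form.  The arithmetic
operations are addition and subtraction, addressing may be indirect, and all operations are charged
the bit lengths of the integers involved. -/

namespace RAM

/-- The contents of the memory cells. -/
abbrev Memory : Type := ℤ → ℤ

inductive Expr
  | const (c : ℤ)
  | cell (address : Expr)
  | add (a b : Expr)
  | sub (a b : Expr)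

inductive Program
  | skip
  | assign (address value : Expr)
  | seq (p q : Program)
  | ifPos (test : Expr) (p q : Program)
  | whilePos (test : Expr) (body : Program)

/-- The bit length of an integer, with one extra bit for the sign. -/
def bitLength (z : ℤ) : ℕ := z.natAbs.size + 1

def Expr.eval (m : Memory) : Expr → ℤ
  | const c => c
  | cell a => m (a.eval m)
  | add a b => a.eval m + b.eval m
  | sub a b => a.eval m - b.eval m

/-- The cost of evaluating an expression: the bit lengths of all values that occur. -/
def Expr.cost (m : Memory) : Expr → ℕ
  | const c => bitLength c
  | cell a => a.cost m + bitLength ((cell a).eval m)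
  | add a b => a.cost m + b.cost m + bitLength ((add a b).eval m)
  | sub a b => a.cost m + b.cost m + bitLength ((sub a b).eval m)

/-- `Runs p m m' t`: started on memory `m`, the program `p` halts with memory `m'` after time `t`. -/
inductive Runs : Program → Memory → Memory → ℕ → Prop
  | skip (m : Memory) : Runs .skip m m 1
  | assign (a e : Expr) (m : Memory) :
      Runs (.assign a e) m (Function.update m (a.eval m) (e.eval m)) (a.cost m + e.cost m)
  | seq {p q : Program} {m₁ m₂ m₃ : Memory} {t₁ t₂ : ℕ} :
      Runs p m₁ m₂ t₁ → Runs q m₂ m₃ t₂ → Runs (.seq p q) m₁ m₃ (t₁ + t₂)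
  | ifPos_true {e : Expr} {p q : Program} {m m' : Memory} {t : ℕ} :
      0 < e.eval m → Runs p m m' t → Runs (.ifPos e p q) m m' (e.cost m + t)
  | ifPos_false {e : Expr} {p q : Program} {m m' : Memory} {t : ℕ} :
      ¬ 0 < e.eval m → Runs q m m' t → Runs (.ifPos e p q) m m' (e.cost m + t)
  | whilePos_stop {e : Expr} {p : Program} {m : Memory} :
      ¬ 0 < e.eval m → Runs (.whilePos e p) m m (e.cost m)
  | whilePos_step {e : Expr} {p : Program} {m₁ m₂ m₃ : Memory} {t₁ t₂ : ℕ} :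
      0 < e.eval m₁ → Runs p m₁ m₂ t₁ → Runs (.whilePos e p) m₂ m₃ t₂ →
      Runs (.whilePos e p) m₁ m₃ (e.cost m₁ + t₁ + t₂)

/-- Runs are deterministic, so the final memory and the running time are well defined. -/
theorem Runs.deterministic {p : Program} {m m₁ m₂ : Memory} {t₁ t₂ : ℕ}
    (h₁ : Runs p m m₁ t₁) (h₂ : Runs p m m₂ t₂) : m₁ = m₂ ∧ t₁ = t₂ := by
  induction h₁ generalizing m₂ t₂ with
  | skip m => cases h₂; exact ⟨rfl, rfl⟩
  | assign a e m => cases h₂; exact ⟨rfl, rfl⟩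
  | seq _ _ ih₁ ih₂ =>
    cases h₂ with
    | seq h h' =>
      obtain ⟨rfl, rfl⟩ := ih₁ h
      obtain ⟨rfl, rfl⟩ := ih₂ h'
      exact ⟨rfl, rfl⟩
  | ifPos_true hc _ ih =>
    cases h₂ with
    | ifPos_true _ h => obtain ⟨rfl, rfl⟩ := ih h; exact ⟨rfl, rfl⟩
    | ifPos_false hn _ => exact absurd hc hn
  | ifPos_false hc _ ih =>
    cases h₂ with
    | ifPos_true hn _ => exact absurd hn hc
    | ifPos_false _ h => obtain ⟨rfl, rfl⟩ := ih h; exact ⟨rfl, rfl⟩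
  | whilePos_stop hc =>
    cases h₂ with
    | whilePos_stop _ => exact ⟨rfl, rfl⟩
    | whilePos_step hn _ _ => exact absurd hn hc
  | whilePos_step hc _ _ ih₁ ih₂ =>
    cases h₂ with
    | whilePos_stop hn => exact absurd hc hn
    | whilePos_step _ h h' =>
      obtain ⟨rfl, rfl⟩ := ih₁ h
      obtain ⟨rfl, rfl⟩ := ih₂ h'
      exact ⟨rfl, rfl⟩

/-- The initial memory: the input word stands in the cells `0, 1, 2, …`, all others hold `0`. -/
def load (w : List ℤ) : Memory := fun a => if 0 ≤ a then w.getD a.toNat 0 else 0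

/-- The size of an input word: its total number of bits. -/
def inputSize (w : List ℤ) : ℕ := (w.map bitLength).sum

/-- The property `Q` of the objects of type `α`, given by their encodings, is decided by one
program in time polynomial in the bit size of the encoding; the answer (`1` for yes, `0` for no) is
returned in cell `0`. -/
def DecidableInPolynomialTime {α : Type*} (encode : α → List ℤ) (Q : α → Prop) : Prop :=
  ∃ (p : Program) (bound : Polynomial ℕ), ∀ x : α, ∃ (m : Memory) (t : ℕ),
    Runs p (load (encode x)) m t ∧ t ≤ bound.eval (inputSize (encode x)) ∧
      (Q x → m 0 = 1) ∧ (¬ Q x → m 0 = 0)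

end RAM

/-! ## Instances -/

/-- A mixed 1D crease pattern with rational vertices, presented for computation by the number of
creases, a common denominator, the numerators of the vertices from left to right, and the labels. -/
structure RationalPattern where
  n : ℕ
  den : ℕ
  den_pos : 0 < den
  num : Fin (n + 2) → ℤ
  strictMono_num : StrictMono num
  label : Fin n → Option FoldType

/-- The crease pattern that is presented. -/
noncomputable def RationalPattern.toPattern (I : RationalPattern) : MixedCreasePattern I.n where
  vertex := fun v => (I.num v : ℝ) / (I.den : ℝ)
  strictMono_vertex := fun _ _ h =>
    div_lt_div_of_pos_right (Int.cast_lt.mpr (I.strictMono_num h)) (Nat.cast_pos.mpr I.den_pos)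
  label := I.label

def labelCode : Option FoldType → ℤ
  | none => 0
  | some .mountain => 1
  | some .valley => 2

/-- The input word: number of creases, denominator, numerators, labels. -/
def RationalPattern.encode (I : RationalPattern) : List ℤ :=
  (I.n : ℤ) :: (I.den : ℤ) :: (List.ofFn I.num ++ List.ofFn (fun k => labelCode (I.label k)))

/-! Write `1` for a valley and `-1` for a mountain. Once every crease is folded, the vertex
positions are determined up to an isometry of the line by the crease pattern alone (`flatPos`).
Foldability is equivalent to the existence of a completion of the labels for which the signs
strictly between `p` and `q` add up to at most one in absolute value, whenever `p` and `q` are both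
extreme in the flat positions relative to the vertices between them
(`oneLayerFoldable_iff_assignable`).

Necessity rests on a turning number. Regard the paper as a planar curve, with each folded crease a
signed half turn. Take two of its points that can be seen from above or below past the paper between
them, and attach vertical rays there. The resulting curve does not cross itself, so its total
turning is zero if the rays point in opposite directions and a half turn of known sign if they point
in the same direction; the rays contribute quarter turns at the two points. This is `TurningLaw`. It
holds for flat paper and survives every one-layer fold (`TurningLaw.fold_right`), because at the
fold line the creased layer is visible, so the law before the fold applies to the two halves of the
path. Between two extreme vertices it gives the bound (`Valid.turningCriterion`).

Sufficiency is greedy. The paper is kept spread, with every unfolded crease separating its two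
sides. Take a closest pair of unfolded creases; the paper between them occupies a strip of the flat
folded state. If the paper on one side never leaves this strip, an end can be folded. Otherwise
consider the stretch between the nearest exits on the two sides. Its unfolded creases have equal
minimal gaps, so two consecutive ones of opposite type can be crimped. If there are none, all its
unfolded creases have one type, there are at least two of them, and the folded creases cancel; the
criterion is then violated at the two exits (`Spread.exists_fold`).

For the algorithm, the unknowns are the prefix sums of the signs. The criterion and the labels
become difference constraints, and parity forces each step to be plus or minus one. Starting from
the largest conceivable values, a violated constraint can be repaired only by lowering one specific
sum, by at least two because of parity. Every solution remains below the current values, so a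
solvable system is satisfied within `(n + 1) ^ 2` rounds (`Rounds.final`). The remaining work is a
verified random access program whose cell contents have linearly many bits and whose number of
elementary steps is of order `n ^ 4`. -/

/-! ## Folded states indexed by natural numbers -/

/-- The open interval between `a` and `b`, in either order. -/
def Between (a b t : ℝ) : Prop := (a < t ∧ t < b) ∨ (b < t ∧ t < a)

/-- A folded state with vertices and segments indexed by natural numbers.  `turn v` is `1` at a
valley, `-1` at a mountain and `0` where the paper is not folded. -/
@[ext] structure ChainState where
  x : ℕ → ℝ
  ab : ℕ → ℕ → Prop
  turn : ℕ → ℤ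

/-- `1` for up, `-1` for down. -/
def dirSign (b : Bool) : ℤ := if b = true then 1 else -1

/-- Vertex `v` belongs to the part of the paper right (`r = true`) or left of vertex `d`. -/
def VertexMoves (d : ℕ) (r : Bool) (v : ℕ) : Prop := (r = true ∧ d ≤ v) ∨ (r = false ∧ v ≤ d)

/-- Segment `i` belongs to the part of the paper right (`r = true`) or left of vertex `d`. -/
def SegmentMoves (d : ℕ) (r : Bool) (i : ℕ) : Prop := (r = true ∧ d ≤ i) ∨ (r = false ∧ i < d)

namespace ChainState

/-- The direction in which segment `k` is traversed. -/
noncomputable def heading (S : ChainState) (k : ℕ) : ℤ := if S.x k < S.x (k + 1) then 1 else -1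

/-- Segment `k` lies above (`up = true`) or below segment `i`. -/
def Blocks (S : ChainState) (up : Bool) (i k : ℕ) : Prop :=
  (up = true ∧ S.ab k i) ∨ (up = false ∧ S.ab i k)

open Classical in
/-- The part right or left of vertex `d` is rotated upwards or downwards. -/
noncomputable def fold (S : ChainState) (d : ℕ) (r up : Bool) : ChainState where
  x := fun v => if VertexMoves d r v then 2 * S.x d - S.x v else S.x v
  ab := fun i j =>
    if SegmentMoves d r i then
      if SegmentMoves d r j then S.ab j i else up = true
    else if SegmentMoves d r j then up = false else S.ab i j
  turn := Function.update S.turn d (dirSign up * S.heading d)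

/-- The fold at vertex `d` is a one-layer simple fold. -/
structure CanFold (n : ℕ) (S : ChainState) (d : ℕ) (r up : Bool) : Prop where
  one_le : 1 ≤ d
  le : d ≤ n
  turn_eq : S.turn d = 0
  oneSided : (∀ v ≤ n + 1, VertexMoves d r v → S.x d ≤ S.x v) ∨
    (∀ v ≤ n + 1, VertexMoves d r v → S.x v ≤ S.x d)
  free : ∀ i ≤ n, ∀ j ≤ n, SegmentMoves d r i → ¬ SegmentMoves d r j →
    ∀ t, Between (S.x i) (S.x (i + 1)) t → Between (S.x j) (S.x (j + 1)) t → ¬ S.Blocks up i j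

end ChainState

/-- The sign of a fold type; `0` if there is none. -/
def typeSign : Option FoldType → ℤ
  | none => 0
  | some .valley => 1
  | some .mountain => -1

theorem permits_iff (l : Option FoldType) (t : FoldType) :
    Permits l t ↔ typeSign l = 0 ∨ typeSign l = typeSign (some t) := by
  rcases l with _ | _ | _ <;> cases t <;> simp [Permits, typeSign]

theorem typeSign_eq_zero {l : Option FoldType} : typeSign l = 0 ↔ l = none := by
  rcases l with _ | _ | _ <;> simp [typeSign]

/-- A function on `Fin n` as a function of the vertex index, `0` outside of `1, …, n`. -/
def atCrease {n : ℕ} (g : Fin n → Option FoldType) (v : ℕ) : ℤ :=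
  if h : 1 ≤ v ∧ v ≤ n then typeSign (g ⟨v - 1, by omega⟩) else 0

theorem atCrease_succ {n : ℕ} (g : Fin n → Option FoldType) (k : Fin n) :
    atCrease g (k + 1) = typeSign (g k) := by
  simp [atCrease, k.2]

/-- Indices past the end are sent to the last one, so an increasing sequence on `Fin` becomes
monotone on all of `ℕ`. -/
def clampFin (m v : ℕ) : Fin (m + 1) := ⟨min v m, by omega⟩

theorem clampFin_val {m : ℕ} (v : Fin (m + 1)) : clampFin m v = v := by
  ext; simp [clampFin]; omega

/-- The indexing by natural numbers of a folded state. -/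
def FoldedState.toChain {n : ℕ} (s : FoldedState n) : ChainState where
  x := fun v => s.pos (clampFin (n + 1) v)
  ab := fun i j => s.above (clampFin n i) (clampFin n j)
  turn := atCrease s.folded

def PaperPart.isRight : PaperPart → Bool
  | .left => false
  | .right => true

def FoldDirection.isUp : FoldDirection → Bool
  | .up => true
  | .down => false

theorem mem_shadow_iff {n : ℕ} (s : FoldedState n) (j : Fin (n + 1)) (t : ℝ) :
    t ∈ s.shadow j ↔ Between (s.pos j.castSucc) (s.pos j.succ) t := by
  simp only [FoldedState.shadow, Set.mem_Ioo, min_lt_iff, lt_max_iff, Between]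
  constructor
  · rintro ⟨h1 | h1, h2 | h2⟩
    · exact absurd (h1.trans h2) (lt_irrefl _)
    · exact Or.inl ⟨h1, h2⟩
    · exact Or.inr ⟨h1, h2⟩
    · exact absurd (h1.trans h2) (lt_irrefl _)
  · rintro (⟨h1, h2⟩ | ⟨h1, h2⟩)
    · exact ⟨Or.inl h1, Or.inr h2⟩
    · exact ⟨Or.inr h1, Or.inl h2⟩

theorem movesVertex_iff {n : ℕ} (k : Fin n) (part : PaperPart) (v : ℕ) :
    MovesVertex k part (clampFin (n + 1) v) ↔ VertexMoves (k + 1) part.isRight v := by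
  cases part <;>
  simp [MovesVertex, VertexMoves, PaperPart.isRight, clampFin, creaseVertex, Fin.le_def]

theorem movesSegment_iff {n : ℕ} (k : Fin n) (part : PaperPart) (v : ℕ) :
    MovesSegment k part (clampFin n v) ↔ SegmentMoves (k + 1) part.isRight v := by
  cases part <;>
  simp [MovesSegment, SegmentMoves, PaperPart.isRight, clampFin, Fin.le_def, Fin.lt_def]

theorem clampFin_crease {n : ℕ} (k : Fin n) : clampFin (n + 1) (k + 1) = creaseVertex k := by
  ext; simp [clampFin, creaseVertex]

theorem clampFin_crease_succ {n : ℕ} (k : Fin n) :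
    clampFin (n + 1) (k + 1 + 1) = k.succ.succ := by
  ext; simp [clampFin]

theorem clampFin_segment {n : ℕ} {i : ℕ} (hi : i ≤ n) :
    clampFin (n + 1) i = (clampFin n i).castSucc ∧ clampFin (n + 1) (i + 1) = (clampFin n i).succ := by
  constructor <;> ext <;> simp [clampFin] <;> omega

/-- The front side is up exactly when the segment after the crease runs to the right. Bending
upwards while running to the right, or downwards while running to the left, is a counterclockwise
half turn, and this is what a valley is. -/
theorem typeSign_resultingType {n : ℕ} (s : FoldedState n) (k : Fin n) (dir : FoldDirection) :
    typeSign (some (s.resultingType k dir)) = dirSign dir.isUp * s.toChain.heading (k + 1) := by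
  simp only [ChainState.heading, FoldedState.toChain, clampFin_crease, clampFin_crease_succ]
  by_cases h : s.pos (creaseVertex k) < s.pos k.succ.succ <;> cases dir <;>
  simp [FoldedState.resultingType, FoldedState.FrontUp, h, typeSign, dirSign, FoldDirection.isUp]

theorem toChain_rotate {n : ℕ} (s : FoldedState n) (k : Fin n) (part : PaperPart)
    (dir : FoldDirection) :
    (s.rotate k part dir).toChain = s.toChain.fold (k + 1) part.isRight dir.isUp := by
  ext a b
  · have ha := movesVertex_iff k part a
    by_cases h : VertexMoves (k + 1) part.isRight a <;>
    simp [FoldedState.toChain, FoldedState.rotate, ChainState.fold, clampFin_crease, ha, h]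
  · have ha := movesSegment_iff k part a
    have hb := movesSegment_iff k part b
    by_cases h : SegmentMoves (k + 1) part.isRight a <;>
    by_cases h' : SegmentMoves (k + 1) part.isRight b <;> cases dir <;>
    simp [FoldedState.toChain, FoldedState.rotate, ChainState.fold, ha, h, hb, h',
      FoldDirection.isUp]
  · simp only [FoldedState.toChain, FoldedState.rotate, ChainState.fold]
    by_cases h : a = k + 1
    · subst h
      rw [atCrease_succ, Function.update_self, Function.update_self, typeSign_resultingType]
      rfl
    · rw [Function.update_of_ne h]
      simp only [atCrease]
      split_ifs with h2
      · rw [Function.update_of_ne]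
        rintro rfl
        apply h; simp; omega
      · rfl

theorem oneLayerSimpleFold_iff {n : ℕ} (P : MixedCreasePattern n) (s s' : FoldedState n) :
    OneLayerSimpleFold P s s' ↔ ∃ (k : Fin n) (part : PaperPart) (dir : FoldDirection),
      s.toChain.CanFold n (k + 1) part.isRight dir.isUp ∧
      (typeSign (P.label k) = 0 ∨
        typeSign (P.label k) = dirSign dir.isUp * s.toChain.heading (k + 1)) ∧
      s' = s.rotate k part dir := by
  unfold OneLayerSimpleFold
  refine exists_congr fun k => exists_congr fun part => exists_congr fun dir => ?_
  rw [permits_iff, typeSign_resultingType]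
  have h1 : s.folded k = none ↔ s.toChain.turn (k + 1) = 0 := by
    simp only [FoldedState.toChain, atCrease_succ, typeSign_eq_zero]
  have h2 : s.OnOneSide k part ↔
      ((∀ v ≤ n + 1, VertexMoves (k + 1) part.isRight v →
          s.toChain.x (k + 1) ≤ s.toChain.x v) ∨
        (∀ v ≤ n + 1, VertexMoves (k + 1) part.isRight v →
          s.toChain.x v ≤ s.toChain.x (k + 1))) := by
    simp only [FoldedState.OnOneSide, FoldedState.toChain, clampFin_crease, ← movesVertex_iff]
    refine or_congr ⟨fun h v _ hm => h _ hm, fun h v hm => ?_⟩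
      ⟨fun h v _ hm => h _ hm, fun h v hm => ?_⟩
    · have := h v (by omega); rw [clampFin_val] at this; exact this hm
    · have := h v (by omega); rw [clampFin_val] at this; exact this hm
  have h3 : s.Unobstructed k part dir ↔
      (∀ i ≤ n, ∀ j ≤ n, SegmentMoves (k + 1) part.isRight i → ¬ SegmentMoves (k + 1) part.isRight j →
      ∀ t, Between (s.toChain.x i) (s.toChain.x (i + 1)) t →
        Between (s.toChain.x j) (s.toChain.x (j + 1)) t → ¬ s.toChain.Blocks dir.isUp i j) := by
    have key : ∀ i ≤ n, ∀ t, t ∈ s.shadow (clampFin n i) ↔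
        Between (s.toChain.x i) (s.toChain.x (i + 1)) t := by
      intro i hi t
      rw [mem_shadow_iff]
      simp only [FoldedState.toChain, clampFin_segment hi]
    unfold FoldedState.Unobstructed
    constructor
    · intro h i hi j hj hmi hmj t ht1 ht2
      rw [← movesSegment_iff] at hmi hmj
      have := h _ _ hmi hmj ⟨t, (key i hi t).2 ht1, (key j hj t).2 ht2⟩
      cases dir <;> simpa [ChainState.Blocks, FoldDirection.isUp, FoldedState.toChain] using this
    · rintro h i j hmi hmj ⟨t, ht1, ht2⟩
      rw [← clampFin_val i] at hmi ht1 ⊢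
      rw [← clampFin_val j] at hmj ht2 ⊢
      rw [movesSegment_iff] at hmi hmj
      have := h i (by omega) j (by omega) hmi hmj t ((key i (by omega) t).1 ht1)
        ((key j (by omega) t).1 ht2)
      cases dir <;> simpa [ChainState.Blocks, FoldDirection.isUp, FoldedState.toChain] using this
  rw [h1, h2, h3]
  constructor
  · rintro ⟨a, b, c, d, e⟩
    exact ⟨⟨by omega, by omega, a, c, d⟩, b, e⟩
  · rintro ⟨⟨_, _, a, c, d⟩, b, e⟩
    exact ⟨a, b, c, d, e⟩

/-! ## The turning law -/

theorem Between.symm {a b t : ℝ} (h : Between a b t) : Between b a t := Or.symm h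

/-- The turning law speaks only of points that avoid vertex positions. This supplies such a point
next to a vertex: with `F` a finite set of relevant positions, `c` compares with each of them,
except `p` itself, as `p` does. -/
theorem exists_between_near {p q : ℝ} (hpq : p ≠ q) (F : Finset ℝ) :
    ∃ c, Between p q c ∧ ∀ t ∈ F, t ≠ p → (t < c ↔ t < p) ∧ t ≠ c ∧ ¬ Between p c t := by
  obtain ⟨ε, hε, hF⟩ : ∃ ε > 0, ∀ t ∈ F, t ≠ p → ε < |t - p| := by
    induction F using Finset.induction_on with
    | empty => exact ⟨1, one_pos, by simp⟩
    | insert a F _ ih =>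
      obtain ⟨ε, hε, h⟩ := ih
      by_cases ha : a = p
      · refine ⟨ε, hε, fun t ht htp => ?_⟩
        rcases Finset.mem_insert.1 ht with rfl | ht
        · exact absurd ha htp
        · exact h t ht htp
      · have hpos : 0 < |a - p| := abs_pos.2 (sub_ne_zero.2 ha)
        refine ⟨min ε (|a - p| / 2), lt_min hε (by linarith), fun t ht htp => ?_⟩
        rcases Finset.mem_insert.1 ht with rfl | ht
        · exact (min_le_right _ _).trans_lt (by linarith)
        · exact (min_le_left _ _).trans_lt (h t ht htp)
  rcases lt_or_gt_of_ne hpq with h | h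
  · have h1 := min_le_left ε ((q - p) / 2)
    have h2 := min_le_right ε ((q - p) / 2)
    have h3 : 0 < min ε ((q - p) / 2) := lt_min hε (by linarith)
    refine ⟨p + min ε ((q - p) / 2), Or.inl ⟨by linarith, by linarith⟩, fun t ht htp => ?_⟩
    have := hF t ht htp
    rcases lt_abs.1 this with h4 | h4
    · exact ⟨⟨fun _ => by linarith, fun _ => by linarith⟩, by linarith,
        by rintro (h | h) <;> linarith [h.1, h.2]⟩
    · exact ⟨⟨fun _ => by linarith, fun _ => by linarith⟩, by linarith,
        by rintro (h | h) <;> linarith [h.1, h.2]⟩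
  · have h1 := min_le_left ε ((p - q) / 2)
    have h2 := min_le_right ε ((p - q) / 2)
    have h3 : 0 < min ε ((p - q) / 2) := lt_min hε (by linarith)
    refine ⟨p - min ε ((p - q) / 2), Or.inr ⟨by linarith, by linarith⟩, fun t ht htp => ?_⟩
    have := hF t ht htp
    rcases lt_abs.1 this with h4 | h4
    · exact ⟨⟨fun _ => by linarith, fun _ => by linarith⟩, by linarith,
        by rintro (h | h) <;> linarith [h.1, h.2]⟩
    · exact ⟨⟨fun _ => by linarith, fun _ => by linarith⟩, by linarith,
        by rintro (h | h) <;> linarith [h.1, h.2]⟩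

/-- A path that starts at vertex `d` and ends at the point `v` of segment `j` covers all points
between its ends. -/
theorem covered_of_between_end {x : ℕ → ℝ} {d j : ℕ} (hdj : d ≤ j) {u v : ℝ}
    (hu : ∀ k, d ≤ k → k ≤ j → u ≠ x k) (h : Between (x d) v u ∨ u = v) :
    (∃ k, d ≤ k ∧ k < j ∧ Between (x k) (x (k + 1)) u) ∨ Between (x j) v u ∨ u = v := by
  induction j, hdj using Nat.le_induction with
  | base => exact Or.inr h
  | succ j hdj ih =>
    rcases ih (fun k h1 h2 => hu k h1 (by omega)) with ⟨k, h1, h2, h3⟩ | h' | h'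
    · exact Or.inl ⟨k, h1, by omega, h3⟩
    · rcases lt_or_gt_of_ne (hu (j + 1) (by omega) le_rfl) with h4 | h4 <;>
      rcases h' with h' | h'
      · exact Or.inl ⟨j, hdj, by omega, Or.inl ⟨h'.1, h4⟩⟩
      · exact Or.inr (Or.inl (Or.inr ⟨h'.1, h4⟩))
      · exact Or.inr (Or.inl (Or.inl ⟨h4, h'.2⟩))
      · exact Or.inl ⟨j, hdj, by omega, Or.inr ⟨h4, h'.2⟩⟩
    · exact Or.inr (Or.inr h')

/-- A path that starts at the point `u` of segment `i` and ends at vertex `d` covers all points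
between its ends. -/
theorem covered_of_between_start {x : ℕ → ℝ} {i d : ℕ} (hid : i < d) {u v : ℝ}
    (hv : ∀ k, i < k → k ≤ d → v ≠ x k) (h : Between u (x d) v ∨ v = u) :
    (∃ k, i < k ∧ k < d ∧ Between (x k) (x (k + 1)) v) ∨ Between u (x (i + 1)) v ∨ v = u := by
  induction d, hid using Nat.le_induction with
  | base => exact Or.inr h
  | succ d hid ih =>
    rcases h with h | h
    · by_cases h0 : Between u (x d) v
      · rcases ih (fun k h1 h2 => hv k h1 (by omega)) (Or.inl h0) with ⟨k, h1, h2, h3⟩ | h'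
        · exact Or.inl ⟨k, h1, by omega, h3⟩
        · exact Or.inr h'
      · refine Or.inl ⟨d, hid, by omega, ?_⟩
        rcases lt_or_gt_of_ne (hv d hid (by omega)) with h4 | h4 <;> rcases h with h | h
        · exact absurd (Or.inl ⟨h.1, h4⟩) h0
        · exact Or.inr ⟨h.1, h4⟩
        · exact Or.inl ⟨h4, h.2⟩
        · exact absurd (Or.inr ⟨h4, h.2⟩) h0
    · exact Or.inr (Or.inr h)

theorem dirSign_not (a : Bool) : dirSign (!a) = - dirSign a := by cases a <;> rfl

namespace ChainState

/-- The number of half turns of the paper from the point `u` of segment `i` to the point `v` of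
segment `j`, if these points can be seen from direction `a` and `b` (above or below) in the part of
the paper between them. -/
def TurningLaw (n : ℕ) (S : ChainState) : Prop :=
  ∀ (i j : ℕ) (u v : ℝ) (a b : Bool), i < j → j ≤ n →
    Between (S.x i) (S.x (i + 1)) u → Between (S.x j) (S.x (j + 1)) v →
    (∀ k, i ≤ k → k ≤ j → u ≠ S.x k) → (∀ k, i < k → k ≤ j + 1 → v ≠ S.x k) →
    (a = b → u ≠ v) →
    (∀ k, i < k → k < j → Between (S.x k) (S.x (k + 1)) u → ¬ S.Blocks a i k) →
    ((Between (S.x j) v u ∨ u = v) → ¬ S.Blocks a i j) →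
    (∀ k, i < k → k < j → Between (S.x k) (S.x (k + 1)) v → ¬ S.Blocks b j k) →
    ((Between u (S.x (i + 1)) v ∨ v = u) → ¬ S.Blocks b j i) →
    2 * ∑ k ∈ Finset.Ioc i j, S.turn k =
      (if a = b then 2 * dirSign a * (if u < v then 1 else -1) else 0)
        - dirSign a * S.heading i - dirSign b * S.heading j

/-- The whole state turned by 180 degrees about the vertical line through `c`. -/
def rot (S : ChainState) (c : ℝ) : ChainState where
  x := fun v => 2 * c - S.x v
  ab := fun i j => S.ab j i
  turn := S.turn

theorem between_rot (c a b t : ℝ) : Between (2 * c - a) (2 * c - b) t ↔ Between a b (2 * c - t) := by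
  unfold Between
  constructor <;> (rintro (h | h) <;> [right; left] <;> constructor <;> linarith [h.1, h.2])

theorem between_rot' (c a b t : ℝ) : Between (2 * c - a) b t ↔ Between a (2 * c - b) (2 * c - t) := by
  rw [← between_rot c a (2 * c - b) t, show 2 * c - (2 * c - b) = b by ring]

theorem blocks_rot (S : ChainState) (c : ℝ) (a : Bool) (i k : ℕ) :
    (S.rot c).Blocks a i k ↔ S.Blocks (!a) i k := by
  cases a <;> simp [Blocks, rot]

theorem heading_of_lt {S : ChainState} {k : ℕ} (h : S.x k < S.x (k + 1)) : S.heading k = 1 :=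
  if_pos h

theorem heading_of_gt {S : ChainState} {k : ℕ} (h : S.x (k + 1) < S.x k) : S.heading k = -1 :=
  if_neg h.not_gt

theorem heading_rot (S : ChainState) (c : ℝ) (k : ℕ) (h : S.x k ≠ S.x (k + 1)) :
    (S.rot c).heading k = - S.heading k := by
  rcases lt_or_gt_of_ne h with h | h
  · rw [heading_of_lt h, heading_of_gt (by simpa [rot] using h)]
  · rw [heading_of_gt h, heading_of_lt (by simpa [rot] using h)]; rfl

theorem Between.ne' {a b t : ℝ} (h : Between a b t) : a ≠ b := by
  rintro rfl; rcases h with h | h <;> linarith [h.1, h.2]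

/-- A half turn of the plane preserves signed turning while it exchanges left with right and above
with below. All signs on the right-hand side are changed in pairs. -/
theorem TurningLaw.rot {n : ℕ} {S : ChainState} (h : S.TurningLaw n) (c : ℝ) :
    (S.rot c).TurningLaw n := by
  intro i j u v a b hij hj hu hv hgu hgv huv h1 h2 h3 h4
  have hx : ∀ k, (S.rot c).x k = 2 * c - S.x k := fun _ => rfl
  simp only [hx, between_rot, blocks_rot] at hu hv h1 h2 h3 h4
  have := h i j (2 * c - u) (2 * c - v) (!a) (!b) hij hj hu hv
    (fun k hk hk' he => hgu k hk hk' (by rw [hx]; linarith))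
    (fun k hk hk' he => hgv k hk hk' (by rw [hx]; linarith))
    (fun hab he => huv (by simpa using hab) (by linarith)) h1
    (fun hh => h2 (hh.imp (fun h => by rwa [between_rot']) (fun h => by linarith))) h3
    (fun hh => h4 (hh.imp (fun h => by
      have h := h.symm; rw [← between_rot'] at h; exact h.symm) (fun h => by linarith)))
  rw [show (S.rot c).turn = S.turn from rfl, this, heading_rot S c i (Between.ne' hu),
    heading_rot S c j (Between.ne' hv), dirSign_not, dirSign_not]
  by_cases hab : a = b
  · have hne := huv hab
    subst hab
    simp only [if_true]
    rcases lt_or_gt_of_ne hne with h | h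
    · rw [if_neg (by linarith), if_pos h]; ring
    · rw [if_pos (by linarith), if_neg (by linarith)]; ring
  · rw [if_neg (by simpa using hab), if_neg hab]; ring

/-- The turning law from a point to a vertex near which the paper can be seen. -/
theorem TurningLaw.to_vertex {n : ℕ} {S : ChainState} (hS : S.TurningLaw n) {i d : ℕ} {u : ℝ}
    {a b : Bool} (hid : i < d) (hd : d ≤ n) (hne : S.x d ≠ S.x (d + 1))
    (hu : Between (S.x i) (S.x (i + 1)) u) (hgu : ∀ k, i ≤ k → k ≤ d → u ≠ S.x k)
    (h1 : ∀ k, i < k → k < d → Between (S.x k) (S.x (k + 1)) u → ¬ S.Blocks a i k)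
    (h2 : ∀ k, i ≤ k → k < d → ∀ t, Between (S.x d) (S.x (d + 1)) t →
      Between (S.x k) (S.x (k + 1)) t → ¬ S.Blocks b d k) :
    2 * ∑ k ∈ Finset.Ioc i d, S.turn k =
      (if a = b then 2 * dirSign a * (if u < S.x d then 1 else -1) else 0)
        - dirSign a * S.heading i - dirSign b * S.heading d := by
  -- The vertex `d` is replaced by a generic point `c` of segment `d` next to it. Putting `u` into
  -- the finite set ensures that `u < c` has the same truth value as `u < S.x d`.
  obtain ⟨c, hc, hF⟩ := exists_between_near hne (insert u ((Finset.range (n + 2)).image S.x))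
  have hcx : ∀ k, k ≤ n + 1 → c ≠ S.x k := by
    intro k hk he
    by_cases hkd : S.x k = S.x d
    · rw [he, hkd] at hc; rcases hc with h | h <;> linarith [h.1, h.2]
    · exact (hF (S.x k) (by simp; exact Or.inr ⟨k, by omega, rfl⟩) hkd).2.1 he.symm
  obtain ⟨hu1, hu2, hu3⟩ := hF u (by simp) (hgu d hid.le le_rfl)
  have := hS i d u c a b hid hd hu hc hgu (fun k _ hk => hcx k (by omega)) (fun _ => hu2) h1
    (by rintro (h | h); exacts [absurd h hu3, absurd h hu2])
    (fun k hk1 hk2 ht => h2 k hk1.le hk2 c hc ht)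
    (fun h => h2 i le_rfl hid c hc (by
      rcases h with h | h
      · rcases hu with hu | hu <;> rcases h with h | h
        · exact Or.inl ⟨hu.1.trans h.1, h.2⟩
        · exfalso; linarith [h.1, h.2]
        · exfalso; linarith [h.1, h.2]
        · exact Or.inr ⟨h.1, h.2.trans hu.2⟩
      · rwa [h]))
  rw [this]
  simp only [hu1]

/-- The turning law from a vertex near which the paper can be seen to a point. -/
theorem TurningLaw.from_vertex {n : ℕ} {S : ChainState} (hS : S.TurningLaw n) {d j : ℕ} {v : ℝ}
    {a b : Bool} (hdj : d + 1 ≤ j) (hj : j ≤ n) (hne : S.x d ≠ S.x (d + 1))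
    (hv : Between (S.x j) (S.x (j + 1)) v) (hgv : ∀ k, d < k → k ≤ j + 1 → v ≠ S.x k)
    (h1 : ∀ k, d < k → k < j → Between (S.x k) (S.x (k + 1)) v → ¬ S.Blocks b j k)
    (h2 : ∀ k, d < k → k ≤ j → ∀ t, Between (S.x d) (S.x (d + 1)) t →
      Between (S.x k) (S.x (k + 1)) t → ¬ S.Blocks a d k) :
    2 * ∑ k ∈ Finset.Ioc d j, S.turn k =
      (if a = b then 2 * dirSign a * (if S.x (d + 1) < v then 1 else -1) else 0)
        - dirSign a * S.heading d - dirSign b * S.heading j := by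
  obtain ⟨c, hc, hF⟩ := exists_between_near hne.symm (insert v ((Finset.range (n + 2)).image S.x))
  have hcx : ∀ k, k ≤ n + 1 → c ≠ S.x k := by
    intro k hk he
    by_cases hkd : S.x k = S.x (d + 1)
    · rw [he, hkd] at hc; rcases hc with h | h <;> linarith [h.1, h.2]
    · exact (hF (S.x k) (by simp; exact Or.inr ⟨k, by omega, rfl⟩) hkd).2.1 he.symm
  have hvd := hgv (d + 1) (by omega) (by omega)
  obtain ⟨hu1, hu2, hu3⟩ := hF v (by simp) hvd
  have := hS d j c v a b (by omega) hj hc.symm hv (fun k _ hk => hcx k (by omega)) hgv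
    (fun _ => hu2.symm)
    (fun k hk1 hk2 ht => h2 k hk1 hk2.le c hc.symm ht)
    (fun h => h2 j (by omega) le_rfl c hc.symm (by
      rcases h with h | h
      · rcases hv with hv | hv <;> rcases h with h | h
        · exact Or.inl ⟨h.1, h.2.trans hv.2⟩
        · exfalso; linarith [h.1, h.2]
        · exfalso; linarith [h.1, h.2]
        · exact Or.inr ⟨hv.1.trans h.1, h.2⟩
      · rwa [h])) h1
    (by rintro (h | h); exacts [absurd h.symm hu3, absurd h hu2])
  rw [this]
  have : c < v ↔ S.x (d + 1) < v := by
    rcases lt_or_gt_of_ne hu2 with h | h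
    · exact ⟨fun _ => by linarith, fun h' => by linarith [hu1.1 h]⟩
    · refine ⟨fun _ => ?_, fun h' => h⟩
      rcases lt_or_gt_of_ne hvd with h' | h'
      · linarith [hu1.2 h']
      · exact h'
  simp only [this]

/-! ### The effect of one fold on positions, layer order, headings and turning sums -/

section fold

variable {S : ChainState} {d : ℕ} {up : Bool}

theorem fold_right_x_of_le {v : ℕ} (h : v ≤ d) : (S.fold d true up).x v = S.x v := by
  by_cases h' : d ≤ v
  · obtain rfl : v = d := by omega
    simp [fold, VertexMoves]; ring
  · simp [fold, VertexMoves, h']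

theorem fold_right_x_of_ge {v : ℕ} (h : d ≤ v) :
    (S.fold d true up).x v = 2 * S.x d - S.x v := by
  simp [fold, VertexMoves, h]

theorem blocks_fold_right_stay {a : Bool} {i k : ℕ} (hi : i < d) (hk : k < d) :
    (S.fold d true up).Blocks a i k ↔ S.Blocks a i k := by
  simp [Blocks, fold, SegmentMoves, hi.not_ge, hk.not_ge]

theorem blocks_fold_right_move {a : Bool} {i k : ℕ} (hi : d ≤ i) (hk : d ≤ k) :
    (S.fold d true up).Blocks a i k ↔ S.Blocks (!a) i k := by
  cases a <;> simp [Blocks, fold, SegmentMoves, hi, hk]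

theorem blocks_fold_right_cross {a : Bool} {i k : ℕ} (hi : i < d) (hk : d ≤ k) :
    (S.fold d true up).Blocks a i k ↔ a = up := by
  cases a <;> cases up <;> simp [Blocks, fold, SegmentMoves, hi.not_ge, hk]

theorem blocks_fold_right_cross' {a : Bool} {i k : ℕ} (hi : i < d) (hk : d ≤ k) :
    (S.fold d true up).Blocks a k i ↔ a ≠ up := by
  cases a <;> cases up <;> simp [Blocks, fold, SegmentMoves, hi.not_ge, hk]

theorem heading_fold_right_of_lt {k : ℕ} (h : k < d) :
    (S.fold d true up).heading k = S.heading k := by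
  simp only [heading, fold_right_x_of_le h.le, fold_right_x_of_le (show k + 1 ≤ d from h)]

theorem heading_fold_right_of_ge {k : ℕ} (h : d ≤ k) (hne : S.x k ≠ S.x (k + 1)) :
    (S.fold d true up).heading k = - S.heading k := by
  have h1 := fold_right_x_of_ge (S := S) (up := up) h
  have h2 := fold_right_x_of_ge (S := S) (up := up) (show d ≤ k + 1 by omega)
  rcases lt_or_gt_of_ne hne with h | h
  · rw [heading_of_lt h, heading_of_gt (by rw [h1, h2]; linarith)]
  · rw [heading_of_gt h, heading_of_lt (by rw [h1, h2]; linarith)]; rfl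

/-- Up to a rotation of the whole state, it does not matter which part moves: turning the left part
over the top of the right one leaves the same relative configuration as turning the right part
upwards, which brings it above the left one. Hence the invariants need to be computed only for the
right part. -/
theorem fold_left_eq_rot : S.fold d false up = (S.fold d true up).rot (S.x d) := by
  ext v w
  · simp only [fold, rot, VertexMoves]
    rcases lt_trichotomy v d with h | h | h
    · simp [h.le, h]
    · subst h; simp; ring
    · simp [h.le, h]
  · have e1 : v < d ↔ ¬ d ≤ v := by omega
    have e2 : w < d ↔ ¬ d ≤ w := by omega
    simp only [fold, rot, SegmentMoves, e1, e2]
    by_cases h1 : d ≤ v <;> by_cases h2 : d ≤ w <;> simp [h1, h2]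
  · rfl

/-- The old path is cut at `d` into pieces that both contain the vertex `d`, to match `to_vertex` at
segment `d` and `from_vertex` at segment `d - 1`. Counting `d` twice is harmless, since its old turn
is `0`. -/
theorem sum_turn_fold {r : Bool} {i j : ℕ} (h0 : S.turn d = 0) (hi : i < d) (hj : d ≤ j) :
    ∑ k ∈ Finset.Ioc i j, (S.fold d r up).turn k =
      ∑ k ∈ Finset.Ioc i d, S.turn k + dirSign up * S.heading d
        + ∑ k ∈ Finset.Ioc (d - 1) j, S.turn k := by
  obtain ⟨m, rfl⟩ : ∃ m, d = m + 1 := ⟨d - 1, by omega⟩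
  simp only [Nat.add_sub_cancel]
  rw [← Finset.sum_Ioc_consecutive _ (show i ≤ m + 1 by omega) hj,
    Finset.sum_Ioc_succ_top (by omega), Finset.sum_Ioc_succ_top (by omega),
    ← Finset.sum_Ioc_consecutive S.turn (show m ≤ m + 1 by omega) hj,
    Finset.sum_Ioc_succ_top le_rfl, h0]
  have e1 : ∑ k ∈ Finset.Ioc i m, (S.fold (m + 1) r up).turn k = ∑ k ∈ Finset.Ioc i m, S.turn k :=
    Finset.sum_congr rfl fun k hk => by
      rw [Finset.mem_Ioc] at hk
      exact Function.update_of_ne (by omega) _ _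
  have e2 : ∑ k ∈ Finset.Ioc (m + 1) j, (S.fold (m + 1) r up).turn k =
      ∑ k ∈ Finset.Ioc (m + 1) j, S.turn k :=
    Finset.sum_congr rfl fun k hk => by
      rw [Finset.mem_Ioc] at hk
      exact Function.update_of_ne (by omega) _ _
  have e3 : (S.fold (m + 1) r up).turn (m + 1) = dirSign up * S.heading (m + 1) :=
    Function.update_self _ _ _
  rw [e1, e2, e3]
  simp

theorem sum_turn_fold_of_not {r : Bool} {i j : ℕ} (h : ¬ (i < d ∧ d ≤ j)) :
    ∑ k ∈ Finset.Ioc i j, (S.fold d r up).turn k = ∑ k ∈ Finset.Ioc i j, S.turn k :=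
  Finset.sum_congr rfl fun k hk => by
    rw [Finset.mem_Ioc] at hk
    exact Function.update_of_ne (by omega) _ _

end fold
end ChainState

/-! ### Folding preserves the turning law -/

namespace ChainState

theorem eq_heading (S : ChainState) (k : ℕ) : S.heading k = 1 ∨ S.heading k = -1 := by
  unfold heading; split_ifs <;> simp

/-- The arithmetic of gluing the two halves of a path at the fold line when the right part moves. In
the application `A`, `B`, `C` are `u < S.x d`, `u < v` and `S.x d < v`, the letter `h` is the common
heading of the paper at the crease, and `p`, `q` are the old headings at the two ends. -/
theorem turning_sum_right {A B C : Prop} [Decidable A] [Decidable B] [Decidable C] {a b up : Bool}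
    {h p q : ℤ} (hAB : a = up → (A ↔ B)) (hBC : b ≠ up → (B ↔ C))
    (hs : (h = 1 ∧ ¬ C) ∨ (h = -1 ∧ C)) :
    ((if a = up then 2 * dirSign a * (if A then 1 else -1) else 0) - dirSign a * p - dirSign up * h)
      + 2 * (dirSign up * h) + (0 - dirSign b * h - -dirSign b * q) =
    (if a = b then 2 * dirSign a * (if B then 1 else -1) else 0) - dirSign a * p
      - dirSign b * -q := by
  rcases hs with ⟨rfl, hs⟩ | ⟨rfl, hs⟩ <;> by_cases A <;> by_cases B <;> cases a <;> cases b <;>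
    cases up <;> simp_all [dirSign] <;> omega

/-- The same gluing when the left part moves; here `D` compares the fold line with the position of
`v` before the fold. -/
theorem turning_sum_left {A B C : Prop} [Decidable A] [Decidable B] [Decidable C] {D : Prop}
    [Decidable D] {a b up : Bool}
    {h p q : ℤ} (hAB : a = up → (A ↔ B)) (hBC : b ≠ up → (B ↔ C)) (hD : D ↔ ¬ C)
    (hs : (h = 1 ∧ A) ∨ (h = -1 ∧ ¬ A)) :
    (0 - dirSign a * p - -dirSign a * h) + 2 * (dirSign up * h) +
      ((if up = !b then 2 * dirSign up * (if D then 1 else -1) else 0) - dirSign up * h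
        - -dirSign b * q) =
    (if a = b then 2 * dirSign a * (if B then 1 else -1) else 0) - dirSign a * p
      - dirSign b * -q := by
  rcases hs with ⟨rfl, hs⟩ | ⟨rfl, hs⟩ <;> by_cases B <;> by_cases C <;> cases a <;> cases b <;>
    cases up <;> simp_all [dirSign] <;> omega

/-- A path inside one part is at most rotated. A path across the crease is cut there, the old law is
applied to both pieces and the new half turn is added. Although the conclusion concerns the fold of
the right part, the admissible fold may be that of either part: by `fold_left_eq_rot` the results
differ by a rotation, and `r` only decides which part is known to be unobstructed and on one side of
the fold line. -/
theorem TurningLaw.fold_right {n : ℕ} {S : ChainState} (hS : S.TurningLaw n)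
    (hx : ∀ k ≤ n, S.x k ≠ S.x (k + 1)) {d : ℕ} {r up : Bool} (hf : S.CanFold n d r up)
    (hstr : S.heading d = S.heading (d - 1)) : (S.fold d true up).TurningLaw n := by
  intro i j u v a b hij hj hu hv hgu hgv huv h1 h2 h3 h4
  by_cases hd : i < d ∧ d ≤ j
  swap
  · rcases le_or_gt d i with hdi | hdi
    · -- the whole path moves
      have hrot : ∀ k, i ≤ k → (S.fold d true up).x k = (S.rot (S.x d)).x k :=
        fun k hk => fold_right_x_of_ge (by omega)
      have hbl : ∀ c k l, i ≤ k → i ≤ l →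
          ((S.fold d true up).Blocks c k l ↔ (S.rot (S.x d)).Blocks c k l) := by
        intro c k l hk hl
        rw [blocks_fold_right_move (by omega) (by omega), blocks_rot]
      have hh : ∀ k, i ≤ k → (S.fold d true up).heading k = (S.rot (S.x d)).heading k := by
        intro k hk
        unfold heading
        rw [hrot k hk, hrot (k + 1) (by omega)]
      rw [sum_turn_fold_of_not hd, hh i le_rfl, hh j hij.le]
      rw [hrot i le_rfl, hrot (i + 1) (by omega)] at hu
      rw [hrot j (by omega), hrot (j + 1) (by omega)] at hv
      rw [hrot j (by omega), hbl _ _ _ le_rfl hij.le] at h2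
      rw [hrot (i + 1) (by omega), hbl _ _ _ hij.le le_rfl] at h4
      refine hS.rot (S.x d) i j u v a b hij hj hu hv
        (fun k hk hk' => by rw [← hrot k hk]; exact hgu k hk hk')
        (fun k hk hk' => by rw [← hrot k hk.le]; exact hgv k hk hk') huv
        (fun k hk hk' => ?_) h2 (fun k hk hk' => ?_) h4
      · have := h1 k hk hk'
        rwa [hrot k hk.le, hrot (k + 1) (by omega), hbl _ _ _ le_rfl hk.le] at this
      · have := h3 k hk hk'
        rwa [hrot k hk.le, hrot (k + 1) (by omega), hbl _ _ _ hij.le hk.le] at this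
    · have hjd : j < d := by omega
      have hrot : ∀ k, k ≤ d → (S.fold d true up).x k = S.x k :=
        fun k hk => fold_right_x_of_le hk
      have hbl : ∀ c k l, k < d → l < d →
          ((S.fold d true up).Blocks c k l ↔ S.Blocks c k l) :=
        fun c k l hk hl => blocks_fold_right_stay hk hl
      rw [sum_turn_fold_of_not hd, heading_fold_right_of_lt hdi, heading_fold_right_of_lt hjd]
      rw [hrot i (by omega), hrot (i + 1) (by omega)] at hu
      rw [hrot j (by omega), hrot (j + 1) (by omega)] at hv
      rw [hrot j (by omega), hbl _ _ _ (by omega) (by omega)] at h2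
      rw [hrot (i + 1) (by omega), hbl _ _ _ (by omega) (by omega)] at h4
      refine hS i j u v a b hij hj hu hv
        (fun k hk hk' => by rw [← hrot k (by omega)]; exact hgu k hk hk')
        (fun k hk hk' => by rw [← hrot k (by omega)]; exact hgv k hk hk') huv
        (fun k hk hk' => ?_) h2 (fun k hk hk' => ?_) h4
      · have := h1 k hk hk'
        rwa [hrot k (by omega), hrot (k + 1) (by omega), hbl _ _ _ (by omega) (by omega)] at this
      · have := h3 k hk hk'
        rwa [hrot k (by omega), hrot (k + 1) (by omega), hbl _ _ _ (by omega) (by omega)] at this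
  obtain ⟨hid, hdj⟩ := hd
  have hdn : d ≤ n := hf.le
  have hd1 : 1 ≤ d := hf.one_le
  have hxd : (S.fold d true up).x d = S.x d := fold_right_x_of_le le_rfl
  -- the two points do not lie in the shadow of the other part, if they are hidden by it
  have F1 : a = up → ¬ (Between (S.x d) v u ∨ u = v) := by
    intro hau h
    rw [← hxd] at h
    rcases covered_of_between_end hdj (fun k hk hk' => hgu k (by omega) hk') h with
      ⟨k, hk, hk', hb⟩ | hb
    · exact h1 k (by omega) hk' hb ((blocks_fold_right_cross hid hk).2 hau)
    · exact h2 hb ((blocks_fold_right_cross hid hdj).2 hau)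
  have F2 : b ≠ up → ¬ (Between u (S.x d) v ∨ v = u) := by
    intro hau h
    rw [← hxd] at h
    rcases covered_of_between_start hid (fun k hk hk' => hgv k hk (by omega)) h with
      ⟨k, hk, hk', hb⟩ | hb
    · exact h3 k hk (by omega) hb ((blocks_fold_right_cross' hk' hdj).2 hau)
    · exact h4 hb ((blocks_fold_right_cross' hid hdj).2 hau)
  have hud : u ≠ S.x d := by rw [← hxd]; exact hgu d hid.le hdj
  have hvd : v ≠ S.x d := by rw [← hxd]; exact hgv d hid (by omega)
  have F1' : a = up → ((u < S.x d ↔ u < v) ∧ u ≠ v) := by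
    intro h
    have := F1 h
    simp only [Between, not_or, not_and, not_lt] at this
    obtain ⟨⟨h1, h2⟩, h3⟩ := this
    refine ⟨⟨fun h => ?_, fun h => ?_⟩, h3⟩
    · by_contra hc
      exact h3 (le_antisymm (h2 (lt_of_le_of_ne (not_lt.1 hc) (Ne.symm h3)) |> fun h' => absurd h h'.not_gt) (not_lt.1 hc))
    · by_contra hc
      exact absurd h (h1 (lt_of_le_of_ne (not_lt.1 hc) hud.symm)).not_gt
  have F2' : b ≠ up → ((u < v ↔ S.x d < v) ∧ u ≠ v) := by
    intro h
    have := F2 h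
    simp only [Between, not_or, not_and, not_lt] at this
    obtain ⟨⟨h1, h2⟩, h3⟩ := this
    refine ⟨⟨fun h => lt_of_le_of_ne (h1 h) hvd.symm, fun h => ?_⟩, Ne.symm h3⟩
    by_contra hc
    exact absurd (h2 h) (lt_of_le_of_ne (not_lt.1 hc) h3).not_ge
  -- the point `v` before the fold
  set v' := 2 * S.x d - v with hv'
  have hu0 : Between (S.x i) (S.x (i + 1)) u := by
    rwa [fold_right_x_of_le hid.le, fold_right_x_of_le (show i + 1 ≤ d from hid)] at hu
  have hv0 : Between (S.x j) (S.x (j + 1)) v' := by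
    rwa [fold_right_x_of_ge hdj, fold_right_x_of_ge (show d ≤ j + 1 by omega), between_rot] at hv
  have hgu0 : ∀ k, i ≤ k → k ≤ d → u ≠ S.x k := fun k hk hk' => by
    rw [← fold_right_x_of_le (S := S) (up := up) hk']; exact hgu k hk (by omega)
  have hgv0 : ∀ k, d - 1 < k → k ≤ j + 1 → v' ≠ S.x k := fun k hk hk' he => by
    refine hgv k (by omega) hk' ?_
    rw [fold_right_x_of_ge (show d ≤ k by omega)]; linarith
  have h10 : ∀ k, i < k → k < d → Between (S.x k) (S.x (k + 1)) u → ¬ S.Blocks a i k := by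
    intro k hk hk' hb
    rw [← fold_right_x_of_le (S := S) (up := up) hk'.le,
      ← fold_right_x_of_le (S := S) (up := up) (show k + 1 ≤ d from hk')] at hb
    have := h1 k hk (by omega) hb
    rwa [blocks_fold_right_stay hid hk'] at this
  have h30 : ∀ k, d - 1 < k → k < j → Between (S.x k) (S.x (k + 1)) v' → ¬ S.Blocks (!b) j k := by
    intro k hk hk' hb
    have := h3 k (by omega) hk' (by
      rw [fold_right_x_of_ge (show d ≤ k by omega), fold_right_x_of_ge (show d ≤ k + 1 by omega),
        between_rot]; exact hb)
    rwa [blocks_fold_right_move hdj (by omega)] at this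
  have hd11 : d - 1 + 1 = d := by omega
  rw [sum_turn_fold hf.turn_eq hid hdj, heading_fold_right_of_lt hid,
    heading_fold_right_of_ge hdj (hx j hj), mul_add, mul_add]
  have hxd1 := hx d hdn
  have hxd0 := hx (d - 1) (by omega)
  rw [hd11] at hxd0
  -- positions at the fold
  have P1 : S.heading d = 1 → S.x d < S.x (d + 1) ∧ S.x (d - 1) < S.x d := by
    intro h
    constructor
    · by_contra hc; rw [heading_of_gt (lt_of_le_of_ne (not_lt.1 hc) hxd1.symm)] at h; omega
    · by_contra hc
      rw [hstr, heading_of_gt (by rw [hd11]; exact lt_of_le_of_ne (not_lt.1 hc) hxd0.symm)] at h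
      omega
  have P2 : S.heading d = -1 → S.x (d + 1) < S.x d ∧ S.x d < S.x (d - 1) := by
    intro h
    constructor
    · by_contra hc; rw [heading_of_lt (lt_of_le_of_ne (not_lt.1 hc) hxd1)] at h; omega
    · by_contra hc
      rw [hstr, heading_of_lt (by rw [hd11]; exact lt_of_le_of_ne (not_lt.1 hc) hxd0)] at h
      omega
  cases r with
  | true =>
    have hside : (S.heading d = 1 ∧ ∀ k, d ≤ k → k ≤ n + 1 → S.x d ≤ S.x k) ∨
        (S.heading d = -1 ∧ ∀ k, d ≤ k → k ≤ n + 1 → S.x k ≤ S.x d) := by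
      rcases hf.oneSided with h | h
      · refine Or.inl ⟨heading_of_lt ?_, fun k hk hk' => h k hk' (Or.inl ⟨rfl, hk⟩)⟩
        exact lt_of_le_of_ne (h (d + 1) (by omega) (Or.inl ⟨rfl, by omega⟩)) hxd1
      · refine Or.inr ⟨heading_of_gt ?_, fun k hk hk' => h k hk' (Or.inl ⟨rfl, hk⟩)⟩
        exact lt_of_le_of_ne (h (d + 1) (by omega) (Or.inl ⟨rfl, by omega⟩)) hxd1.symm
    -- The moving part leaves freely in direction `up`, so no staying segment hides segment `d` from
    -- there.
    have I1 := hS.to_vertex (b := up) hid hdn hxd1 hu0 hgu0 h10 (fun k hk hk' t ht ht' =>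
      hf.free d hdn k (by omega) (Or.inl ⟨rfl, le_rfl⟩) (by simp [SegmentMoves]; omega) t ht ht')
    -- Near the crease, segment `d - 1` lies opposite to the whole moving part and is visible from
    -- both directions. Viewing it from `b` makes it opposite to the direction `!b` at the other
    -- end, so that the half turn term vanishes.
    have I2 := hS.from_vertex (a := b) (b := !b) (d := d - 1) (j := j) (by omega) hj
      (by rw [hd11]; exact hxd0) hv0 hgv0 h30 (fun k hk hk' t ht ht' => by
        exfalso
        rw [hd11] at ht
        rcases hside with ⟨h0, hs⟩ | ⟨h0, hs⟩
        · have ha := (P1 h0).2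
          have hb := hs k (by omega) (by omega)
          have hc := hs (k + 1) (by omega) (by omega)
          rcases ht with ht | ht <;> rcases ht' with ht' | ht' <;>
            linarith [ht.1, ht.2, ht'.1, ht'.2]
        · have ha := (P2 h0).2
          have hb := hs k (by omega) (by omega)
          have hc := hs (k + 1) (by omega) (by omega)
          rcases ht with ht | ht <;> rcases ht' with ht' | ht' <;>
            linarith [ht.1, ht.2, ht'.1, ht'.2])
    rw [I1, I2, if_neg (show ¬ b = !b by cases b <;> simp), ← hstr, dirSign_not]
    have hside' : (S.heading d = 1 ∧ v < S.x d) ∨ (S.heading d = -1 ∧ S.x d < v) := by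
      rcases hside with ⟨h0, hs⟩ | ⟨h0, hs⟩
      · left
        have hb := hs j (by omega) (by omega)
        have hc := hs (j + 1) (by omega) (by omega)
        exact ⟨h0, by rcases hv0 with ht | ht <;> linarith [ht.1, ht.2]⟩
      · right
        have hb := hs j (by omega) (by omega)
        have hc := hs (j + 1) (by omega) (by omega)
        exact ⟨h0, by rcases hv0 with ht | ht <;> linarith [ht.1, ht.2]⟩
    exact turning_sum_right (fun h => (F1' h).1) (fun h => (F2' h).1)
      (hside'.imp (fun h => ⟨h.1, h.2.not_gt⟩) id)
  | false =>
    have hside : (S.heading d = 1 ∧ ∀ k, k ≤ d → S.x k ≤ S.x d) ∨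
        (S.heading d = -1 ∧ ∀ k, k ≤ d → S.x d ≤ S.x k) := by
      rcases hf.oneSided with h | h
      · refine Or.inr ⟨?_, fun k hk => h k (by omega) (Or.inr ⟨rfl, hk⟩)⟩
        rw [hstr]
        refine heading_of_gt ?_
        rw [hd11]
        exact lt_of_le_of_ne (h (d - 1) (by omega) (Or.inr ⟨rfl, by omega⟩)) hxd0.symm
      · refine Or.inl ⟨?_, fun k hk => h k (by omega) (Or.inr ⟨rfl, hk⟩)⟩
        rw [hstr]
        refine heading_of_lt ?_
        rw [hd11]
        exact lt_of_le_of_ne (h (d - 1) (by omega) (Or.inr ⟨rfl, by omega⟩)) hxd0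
    -- With the left part moving, the roles are exchanged: segment `d` is free of the moving part,
    -- so its direction may be chosen as `!a`, and the fold condition is needed at segment `d - 1`.
    have I1 := hS.to_vertex (b := !a) hid hdn hxd1 hu0 hgu0 h10 (fun k hk hk' t ht ht' => by
      exfalso
      rcases hside with ⟨h0, hs⟩ | ⟨h0, hs⟩
      · have ha := (P1 h0).1
        have hb := hs k (by omega)
        have hc := hs (k + 1) (by omega)
        rcases ht with ht | ht <;> rcases ht' with ht' | ht' <;>
          linarith [ht.1, ht.2, ht'.1, ht'.2]
      · have ha := (P2 h0).1
        have hb := hs k (by omega)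
        have hc := hs (k + 1) (by omega)
        rcases ht with ht | ht <;> rcases ht' with ht' | ht' <;>
          linarith [ht.1, ht.2, ht'.1, ht'.2])
    have I2 := hS.from_vertex (a := up) (b := !b) (d := d - 1) (j := j) (by omega) hj
      (by rw [hd11]; exact hxd0) hv0 hgv0 h30 (fun k hk hk' t ht ht' =>
        hf.free (d - 1) (by omega) k (by omega) (Or.inr ⟨rfl, by omega⟩)
          (by simp [SegmentMoves]; omega) t ht ht')
    rw [I1, I2, if_neg (show ¬ a = !a by cases a <;> simp), ← hstr, dirSign_not, dirSign_not, hd11]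
    have hside' : (S.heading d = 1 ∧ u < S.x d) ∨ (S.heading d = -1 ∧ S.x d < u) := by
      rcases hside with ⟨h0, hs⟩ | ⟨h0, hs⟩
      · left
        have hb := hs i (by omega)
        have hc := hs (i + 1) (by omega)
        exact ⟨h0, by rcases hu0 with ht | ht <;> linarith [ht.1, ht.2]⟩
      · right
        have hb := hs i (by omega)
        have hc := hs (i + 1) (by omega)
        exact ⟨h0, by rcases hu0 with ht | ht <;> linarith [ht.1, ht.2]⟩
    have hv'' : S.x d < v' ↔ ¬ S.x d < v := by
      constructor
      · intro h; linarith
      · intro h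
        have := lt_of_le_of_ne (not_lt.1 h) hvd
        linarith
    exact turning_sum_left (fun h => (F1' h).1) (fun h => (F2' h).1) hv''
      (hside'.imp id (fun h => ⟨h.1, h.2.not_gt⟩))

end ChainState

/-! ## The turning criterion -/

/-- Vertex `r` is strictly to the left, or strictly to the right, of all the vertices strictly
between `p` and `q`. -/
def VertexExtreme {α : Type*} [LT α] (f : ℕ → α) (p q r : ℕ) : Prop :=
  (∀ v, p < v → v < q → f r < f v) ∨ (∀ v, p < v → v < q → f v < f r)

/-- Between any two vertices that are extreme relative to the vertices between them, the numbers
of mountains and valleys differ by at most one. -/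
def TurningCriterion {α : Type*} [LT α] (n : ℕ) (f : ℕ → α) (τ : ℕ → ℤ) : Prop :=
  ∀ p q, p < q → q ≤ n + 1 → VertexExtreme f p q p → VertexExtreme f p q q →
    |∑ v ∈ Finset.Ioo p q, τ v| ≤ 1

/-- The position of vertex `v` when all creases are folded. -/
def flatPos {R : Type*} [CommRing R] (x : ℕ → R) : ℕ → R
  | 0 => 0
  | v + 1 => flatPos x v + (-1) ^ v * (x (v + 1) - x v)

/-! ### The invariants of folded states and the necessity of the turning criterion -/

namespace ChainState

/-- The properties of a state that are preserved by folding. -/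
structure Valid (n : ℕ) (ℓ : ℕ → ℝ) (S : ChainState) : Prop where
  law : S.TurningLaw n
  asymm : ∀ i j, ¬ (S.ab i j ∧ S.ab j i)
  dist : ∀ k ≤ n, S.x (k + 1) - S.x k = S.heading k * ℓ k
  straight : ∀ k < n, S.turn (k + 1) = 0 → S.heading (k + 1) = S.heading k
  flip : ∀ k < n, S.turn (k + 1) ≠ 0 → S.heading (k + 1) = - S.heading k

theorem Valid.ne {n : ℕ} {ℓ : ℕ → ℝ} {S : ChainState} (h : S.Valid n ℓ) (hℓ : ∀ k ≤ n, 0 < ℓ k) :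
    ∀ k ≤ n, S.x k ≠ S.x (k + 1) := by
  intro k hk he
  have h1 := h.dist k hk
  have h2 := hℓ k hk
  rcases S.eq_heading k with h3 | h3 <;> rw [h3] at h1 <;> push_cast at h1 <;> linarith

theorem Valid.rot {n : ℕ} {ℓ : ℕ → ℝ} {S : ChainState} (h : S.Valid n ℓ) (hℓ : ∀ k ≤ n, 0 < ℓ k)
    (c : ℝ) : (S.rot c).Valid n ℓ := by
  have hh : ∀ k ≤ n, (S.rot c).heading k = - S.heading k :=
    fun k hk => heading_rot S c k (h.ne hℓ k hk)
  refine ⟨h.law.rot c, fun i j hij => h.asymm j i hij, fun k hk => ?_, fun k hk h0 => ?_,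
    fun k hk h0 => ?_⟩
  · rw [hh k hk]
    have := h.dist k hk
    simp only [ChainState.rot]; push_cast; linarith
  · rw [hh _ hk, hh _ hk.le, h.straight k hk h0]
  · rw [hh _ hk, hh _ hk.le, h.flip k hk h0]

theorem dirSign_mul_heading_ne (S : ChainState) (up : Bool) (d : ℕ) :
    dirSign up * S.heading d ≠ 0 := by
  rcases S.eq_heading d with h | h <;> cases up <;> simp [h, dirSign]

theorem Valid.fold {n : ℕ} {ℓ : ℕ → ℝ} {S : ChainState} (h : S.Valid n ℓ)
    (hℓ : ∀ k ≤ n, 0 < ℓ k) {d : ℕ} {r up : Bool} (hf : S.CanFold n d r up) :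
    (S.fold d r up).Valid n ℓ := by
  have hd1 := hf.one_le
  have hdn := hf.le
  have hstr : S.heading d = S.heading (d - 1) := by
    have := h.straight (d - 1) (by omega)
    rw [show d - 1 + 1 = d by omega] at this
    exact this hf.turn_eq
  have key : (S.fold d true up).Valid n ℓ := by
    have hne := h.ne hℓ
    refine ⟨h.law.fold_right hne hf hstr, ?_, ?_, ?_, ?_⟩
    · intro i j
      have := h.asymm i j
      have := h.asymm j i
      rcases lt_or_ge i d with hi | hi <;> rcases lt_or_ge j d with hj | hj <;> cases up <;>
        simp_all [ChainState.fold, SegmentMoves, Nat.not_le.2]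
    · intro k hk
      rcases lt_or_ge k d with hkd | hkd
      · rw [heading_fold_right_of_lt hkd, fold_right_x_of_le hkd.le, fold_right_x_of_le hkd,
          h.dist k hk]
      · rw [heading_fold_right_of_ge hkd (hne k hk), fold_right_x_of_ge hkd,
          fold_right_x_of_ge (show d ≤ k + 1 by omega)]
        have := h.dist k hk
        push_cast; linarith
    · intro k hk h0
      have hkd : k + 1 ≠ d := by
        rintro rfl
        exact dirSign_mul_heading_ne S up (k + 1)
          (by simpa [ChainState.fold] using h0)
      have h0' : S.turn (k + 1) = 0 := by
        simpa [ChainState.fold, Function.update_of_ne hkd] using h0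
      rcases lt_or_ge k d with hkd' | hkd'
      · rw [heading_fold_right_of_lt hkd', heading_fold_right_of_lt (by omega),
          h.straight k hk h0']
      · rw [heading_fold_right_of_ge hkd' (hne k hk.le),
          heading_fold_right_of_ge (by omega) (hne (k + 1) hk), h.straight k hk h0']
    · intro k hk h0
      by_cases hkd : k + 1 = d
      · subst hkd
        rw [heading_fold_right_of_lt (Nat.lt_succ_self k),
          heading_fold_right_of_ge le_rfl (hne (k + 1) hk), hstr]
        rfl
      · have h0' : S.turn (k + 1) ≠ 0 := by
          simpa [ChainState.fold, Function.update_of_ne hkd] using h0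
        rcases lt_or_ge k d with hkd' | hkd'
        · rw [heading_fold_right_of_lt hkd', heading_fold_right_of_lt (by omega),
            h.flip k hk h0']
        · rw [heading_fold_right_of_ge hkd' (hne k hk.le),
            heading_fold_right_of_ge (by omega) (hne (k + 1) hk), h.flip k hk h0']
  cases r with
  | true => exact key
  | false => rw [fold_left_eq_rot]; exact key.rot hℓ _

theorem valid_of_strictMono {n : ℕ} {S : ChainState} (hx : ∀ k ≤ n, S.x k < S.x (k + 1))
    (hab : ∀ i j, ¬ S.ab i j) (ht : ∀ k, S.turn k = 0) :
    S.Valid n (fun k => S.x (k + 1) - S.x k) := by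
  have hh : ∀ k ≤ n, S.heading k = 1 := fun k hk => heading_of_lt (hx k hk)
  have hmono : ∀ i j, i ≤ j → j ≤ n + 1 → S.x i ≤ S.x j := by
    intro i j hij
    induction j, hij using Nat.le_induction with
    | base => exact fun _ => le_rfl
    | succ j hij ih => exact fun hj => (ih (by omega)).trans (hx j (by omega)).le
  refine ⟨?_, fun i j h => hab i j h.1, fun k hk => by rw [hh k hk]; simp,
    fun k hk _ => by rw [hh k hk.le, hh (k + 1) hk], fun k _ h => absurd (ht _) h⟩
  intro i j u v a b hij hj hu hv _ _ huv _ _ _ _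
  have h1 := hmono (i + 1) j hij (by omega)
  have h2 := hx i (by omega)
  have h3 := hx j hj
  have huv : u < v := by
    rcases hu with hu | hu <;> rcases hv with hv | hv <;> linarith [hu.1, hu.2, hv.1, hv.2]
  simp only [ht, hh i (by omega), hh j hj, huv]
  cases a <;> cases b <;> simp [dirSign]

theorem Ioo_eq_Ioc {p q : ℕ} (h : p < q) : Finset.Ioo p q = Finset.Ioc p (q - 1) := by
  ext v; simp only [Finset.mem_Ioo, Finset.mem_Ioc]; omega

/-- Points of the end segments close to the two extreme vertices have no other paper between `p` and
`q` above or below them. Viewing one from above and the other from below gives zero total turning,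
and the quarter turns at the ends cancel. -/
theorem TurningLaw.sum_eq_zero {n : ℕ} {S : ChainState} (hS : S.TurningLaw n) {p q : ℕ}
    (hpq : p + 1 < q) (hq : q ≤ n + 1) (hp : ∀ v, p < v → v < q → S.x p < S.x v)
    (hq' : ∀ v, p < v → v < q → S.x v < S.x q) : ∑ v ∈ Finset.Ioo p q, S.turn v = 0 := by
  have hq1 : q - 1 + 1 = q := by omega
  have hp1 := hp (p + 1) (by omega) (by omega)
  have hq2 := hq' (q - 1) (by omega) (by omega)
  obtain ⟨u, hu, hF⟩ := exists_between_near hp1.ne ((Finset.range (n + 2)).image S.x)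
  obtain ⟨v, hv, hG⟩ := exists_between_near hq2.ne' ((Finset.range (n + 2)).image S.x)
  have hu1 : S.x p < u := by rcases hu with h | h <;> linarith [h.1, h.2]
  have hv1 : v < S.x q := by rcases hv with h | h <;> linarith [h.1, h.2]
  have hu2 : ∀ k, p < k → k < q → u < S.x k := by
    intro k hk hk'
    have h1 := hp k hk hk'
    have h2 := hF (S.x k) (by simp; exact ⟨k, by omega, rfl⟩) h1.ne'
    exact lt_of_le_of_ne (not_lt.1 fun h => absurd (h2.1.1 h) h1.not_gt) h2.2.1.symm
  have hv2 : ∀ k, p < k → k < q → S.x k < v := by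
    intro k hk hk'
    have h1 := hq' k hk hk'
    have h2 := hG (S.x k) (by simp; exact ⟨k, by omega, rfl⟩) h1.ne
    exact h2.1.2 h1
  have h3 := hu2 (p + 1) (by omega) (by omega)
  have h4 := hv2 (p + 1) (by omega) (by omega)
  have h5 := hu2 (q - 1) (by omega) (by omega)
  have := hS p (q - 1) u v true false (by omega) (by omega) hu (by rw [hq1]; exact hv.symm)
    (fun k hk hk' => by
      rcases hk.eq_or_lt with rfl | hk
      · exact hu1.ne'
      · exact (hu2 k hk (by omega)).ne)
    (fun k hk hk' => by
      rcases (show k < q ∨ k = q by omega) with h | rfl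
      · exact (hv2 k hk h).ne'
      · exact hv1.ne)
    (by simp)
    (fun k hk hk' h => by
      have h1 := hu2 k hk (by omega)
      have h2 := hu2 (k + 1) (by omega) (by omega)
      rcases h with h | h <;> linarith [h.1, h.2])
    (fun h => by
      rcases h with (h | h) | h
      · linarith [h.1, h.2]
      · linarith [h.1, h.2]
      · linarith)
    (fun k hk hk' h => by
      have h1 := hv2 k hk (by omega)
      have h2 := hv2 (k + 1) (by omega) (by omega)
      rcases h with h | h <;> linarith [h.1, h.2])
    (fun h => by
      rcases h with (h | h) | h
      · linarith [h.1, h.2]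
      · linarith [h.1, h.2]
      · linarith)
  rw [heading_of_lt hp1, heading_of_lt (by rw [hq1]; exact hq2)] at this
  rw [Ioo_eq_Ioc (by omega)]
  simp [dirSign] at this
  exact this

/-- Just to the right of the further right of the vertices `p` and `q`, the two end segments overlap
and no segment between them covers that spot. One end segment can be viewed from one side and the
other from the opposite side, so the total turning is determined up to sign. -/
theorem TurningLaw.abs_sum_le {n : ℕ} {S : ChainState} (hS : S.TurningLaw n)
    (hasymm : ∀ i j, ¬ (S.ab i j ∧ S.ab j i)) {p q : ℕ}
    (hpq : p + 1 < q) (hq : q ≤ n + 1) (hp : ∀ v, p < v → v < q → S.x p < S.x v)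
    (hq' : ∀ v, p < v → v < q → S.x q < S.x v) : |∑ v ∈ Finset.Ioo p q, S.turn v| ≤ 1 := by
  have hq1 : q - 1 + 1 = q := by omega
  have hp1 := hp (p + 1) (by omega) (by omega)
  have hq2 := hq' (q - 1) (by omega) (by omega)
  have hm : ∀ v, p < v → v < q → max (S.x p) (S.x q) < S.x v :=
    fun v h h' => max_lt (hp v h h') (hq' v h h')
  have hm1 := hm (p + 1) (by omega) (by omega)
  obtain ⟨u, hu, hF⟩ := exists_between_near hm1.ne ((Finset.range (n + 2)).image S.x)
  have hu0 : max (S.x p) (S.x q) < u := by rcases hu with h | h <;> linarith [h.1, h.2]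
  have hup := (le_max_left _ _).trans_lt hu0
  have huq := (le_max_right _ _).trans_lt hu0
  have hu2 : ∀ k, p < k → k < q → u < S.x k := by
    intro k hk hk'
    have h1 := hm k hk hk'
    have h2 := hF (S.x k) (by simp; exact ⟨k, by omega, rfl⟩) h1.ne'
    exact lt_of_le_of_ne (not_lt.1 fun h => absurd (h2.1.1 h) h1.not_gt) h2.2.1.symm
  have hmid : ∀ k, p < k → k < q - 1 → ¬ Between (S.x k) (S.x (k + 1)) u := by
    intro k hk hk' h
    have h1 := hu2 k hk (by omega)
    have h2 := hu2 (k + 1) (by omega) (by omega)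
    rcases h with h | h <;> linarith [h.1, h.2]
  -- Antisymmetry of the layer order allows each of the two overlapping segments to be viewed from
  -- the side away from the other.
  obtain ⟨a, h1, h2⟩ : ∃ a, ¬ S.Blocks a p (q - 1) ∧ ¬ S.Blocks (!a) (q - 1) p := by
    by_cases h : S.ab p (q - 1)
    · exact ⟨true, by simpa [Blocks] using fun h' => hasymm _ _ ⟨h, h'⟩,
        by simpa [Blocks] using fun h' => hasymm _ _ ⟨h, h'⟩⟩
    · exact ⟨false, by simpa [Blocks] using h, by simpa [Blocks] using h⟩
  have := hS p (q - 1) u u a (!a) (by omega) (by omega)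
    (Or.inl ⟨hup, hu2 _ (by omega) (by omega)⟩)
    (by rw [hq1]; exact Or.inr ⟨huq, hu2 _ (by omega) (by omega)⟩)
    (fun k hk hk' => by
      rcases hk.eq_or_lt with rfl | hk
      · exact hup.ne'
      · exact (hu2 k hk (by omega)).ne)
    (fun k hk hk' => by
      rcases (show k < q ∨ k = q by omega) with h | rfl
      · exact (hu2 k hk h).ne
      · exact huq.ne')
    (by simp) (fun k hk hk' h => absurd h (hmid k hk hk')) (fun _ => h1)
    (fun k hk hk' h => absurd h (hmid k hk hk')) (fun _ => h2)
  rw [heading_of_lt hp1, heading_of_gt (by rw [hq1]; exact hq2)] at this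
  rw [Ioo_eq_Ioc (by omega)]
  rw [abs_le]
  cases a <;> simp [dirSign] at this <;> omega

theorem Valid.turningCriterion {n : ℕ} {ℓ : ℕ → ℝ} {S : ChainState} (h : S.Valid n ℓ)
    (hℓ : ∀ k ≤ n, 0 < ℓ k) : TurningCriterion n S.x S.turn := by
  intro p q hpq hq hep heq
  rcases (show p + 1 = q ∨ p + 1 < q by omega) with rfl | hpq'
  · rw [show Finset.Ioo p (p + 1) = ∅ by ext v; simp]; simp
  have hr := h.rot hℓ 0
  rcases hep with hp | hp <;> rcases heq with hq' | hq'
  · exact h.law.abs_sum_le h.asymm hpq' hq hp hq'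
  · rw [h.law.sum_eq_zero hpq' hq hp hq']; simp
  · have := hr.law.sum_eq_zero hpq' hq (fun v h1 h2 => by simpa [ChainState.rot] using hp v h1 h2)
      (fun v h1 h2 => by simpa [ChainState.rot] using hq' v h1 h2)
    rw [show S.turn = (S.rot 0).turn from rfl, this]; simp
  · exact hr.law.abs_sum_le hr.asymm hpq' hq
      (fun v h1 h2 => by simpa [ChainState.rot] using hp v h1 h2)
      (fun v h1 h2 => by simpa [ChainState.rot] using hq' v h1 h2)

end ChainState

theorem VertexExtreme.of_affine {f g : ℕ → ℝ} {c κ : ℝ} (hκ : κ ≠ 0) {N : ℕ}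
    (hfg : ∀ v ≤ N, g v = c + κ * f v) {p q r : ℕ} (hq : q ≤ N) (hr : r ≤ N)
    (h : VertexExtreme f p q r) : VertexExtreme g p q r := by
  rcases lt_or_gt_of_ne hκ with hκ | hκ <;> rcases h with h | h
  · exact Or.inr fun v h1 h2 => by
      rw [hfg v (by omega), hfg r hr]; linarith [mul_lt_mul_of_neg_left (h v h1 h2) hκ]
  · exact Or.inl fun v h1 h2 => by
      rw [hfg v (by omega), hfg r hr]; linarith [mul_lt_mul_of_neg_left (h v h1 h2) hκ]
  · exact Or.inl fun v h1 h2 => by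
      rw [hfg v (by omega), hfg r hr]; linarith [mul_lt_mul_of_pos_left (h v h1 h2) hκ]
  · exact Or.inr fun v h1 h2 => by
      rw [hfg v (by omega), hfg r hr]; linarith [mul_lt_mul_of_pos_left (h v h1 h2) hκ]

theorem TurningCriterion.of_affine {f g : ℕ → ℝ} {c κ : ℝ} (hκ : κ ≠ 0) {n : ℕ} {τ : ℕ → ℤ}
    (hfg : ∀ v ≤ n + 1, g v = c + κ * f v) (h : TurningCriterion n g τ) :
    TurningCriterion n f τ := fun p q hpq hq hep heq =>
  h p q hpq hq (hep.of_affine hκ hfg hq (by omega)) (heq.of_affine hκ hfg hq hq)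

/-- When all creases are folded the headings alternate, so the geometry no longer depends on the
order or types of the folds. This transfers the criterion from the final state to `flatPos`. -/
theorem ChainState.Valid.x_eq_flatPos {n : ℕ} {y : ℕ → ℝ} {S : ChainState}
    (h : S.Valid n (fun k => y (k + 1) - y k)) (ht : ∀ k < n, S.turn (k + 1) ≠ 0) :
    ∀ v ≤ n + 1, S.x v = S.x 0 + S.heading 0 * flatPos y v := by
  have hh : ∀ v ≤ n, S.heading v = S.heading 0 * (-1) ^ v := by
    intro v
    induction v with
    | zero => simp
    | succ v ih =>
      intro hv
      rw [h.flip v hv (ht v hv), ih (by omega), pow_succ]; ring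
  intro v
  induction v with
  | zero => simp [flatPos]
  | succ v ih =>
    intro hv
    have h1 := h.dist v (by omega)
    rw [hh v (by omega)] at h1
    have h2 := ih (by omega)
    simp only [flatPos]
    push_cast at h1
    linear_combination h1 + h2

/-! ## Crimps and end folds -/

/-- The assignment restricted to the creases that are not in `A`. -/
def offSet (A : Finset ℕ) (τ : ℕ → ℤ) (v : ℕ) : ℤ := if v ∈ A then 0 else τ v

/-- A partially folded paper with unfolded creases `A` that is spread out: every unfolded crease
separates the two parts of the paper.  The position of vertex `v` is `z v`, its position in the
completely folded paper is `f v`. -/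
structure Spread (n : ℕ) (τ : ℕ → ℤ) (f : ℕ → ℝ) (A : Finset ℕ) (z : ℕ → ℝ) : Prop where
  mem : ∀ c ∈ A, 1 ≤ c ∧ c ≤ n
  left : ∀ c ∈ A, ∀ v ≤ c, z v ≤ z c
  right : ∀ c ∈ A, ∀ v, c ≤ v → v ≤ n + 1 → z c ≤ z v
  local_isometry : ∃ ε : ℕ → ℝ, (∀ v ≤ n, (ε v = 1 ∨ ε v = -1) ∧
    f (v + 1) - f v = ε v * (z (v + 1) - z v)) ∧
    ∀ v < n, ε (v + 1) = if v + 1 ∈ A then - ε v else ε v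
  full : ∀ c ∈ A, ∀ c' ∈ A, c < c' → ∑ v ∈ Finset.Ioo c c', offSet A τ v = 0
  before : ∀ c ∈ A, ∀ p < c, (∀ v, p < v → v ≤ c → z p < z v) →
    ∑ v ∈ Finset.Ioo p c, offSet A τ v = 0
  after : ∀ c ∈ A, ∀ q, c < q → q ≤ n + 1 → (∀ v, c ≤ v → v < q → z v < z q) →
    ∑ v ∈ Finset.Ioo c q, offSet A τ v = 0

theorem sum_Ioo_split {p c q : ℕ} (h1 : p < c) (h2 : c < q) (g : ℕ → ℤ) :
    ∑ v ∈ Finset.Ioo p q, g v = ∑ v ∈ Finset.Ioo p c, g v + g c + ∑ v ∈ Finset.Ioo c q, g v := by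
  have : Finset.Ioo p q = insert c (Finset.Ioo p c ∪ Finset.Ioo c q) := by
    ext v; simp only [Finset.mem_Ioo, Finset.mem_insert, Finset.mem_union]; omega
  rw [this, Finset.sum_insert (by simp), Finset.sum_union]
  · ring
  · rw [Finset.disjoint_left]; intro v; simp only [Finset.mem_Ioo]; omega

theorem sum_offSet_erase {A : Finset ℕ} {τ : ℕ → ℤ} {a p q : ℕ} (h : ¬ (p < a ∧ a < q)) :
    ∑ v ∈ Finset.Ioo p q, offSet (A.erase a) τ v = ∑ v ∈ Finset.Ioo p q, offSet A τ v := by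
  refine Finset.sum_congr rfl fun v hv => ?_
  rw [Finset.mem_Ioo] at hv
  have : v ≠ a := by rintro rfl; exact h hv
  simp [offSet, this]

/-- The positions after folding up the end of the paper left of crease `a`. -/
noncomputable def foldEndLeft (z : ℕ → ℝ) (a v : ℕ) : ℝ := if v ≤ a then 2 * z a - z v else z v

/-- The positions after folding up the end of the paper right of crease `a`. -/
noncomputable def foldEndRight (z : ℕ → ℝ) (a v : ℕ) : ℝ := if a ≤ v then 2 * z a - z v else z v

/-- The positions after a crimp at the creases `a < b`. -/
noncomputable def crimp (z : ℕ → ℝ) (a b v : ℕ) : ℝ :=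
  if v ≤ a then z v else if v ≤ b then 2 * z a - z v else z v - 2 * (z b - z a)

theorem foldEndLeft_le {z : ℕ → ℝ} {a v : ℕ} (h : v ≤ a) : foldEndLeft z a v = 2 * z a - z v :=
  if_pos h

theorem foldEndLeft_ge {z : ℕ → ℝ} {a v : ℕ} (h : a ≤ v) : foldEndLeft z a v = z v := by
  unfold foldEndLeft
  split_ifs with h'
  · rw [le_antisymm h' h]; ring
  · rfl

theorem foldEndRight_ge {z : ℕ → ℝ} {a v : ℕ} (h : a ≤ v) : foldEndRight z a v = 2 * z a - z v :=
  if_pos h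

theorem foldEndRight_le {z : ℕ → ℝ} {a v : ℕ} (h : v ≤ a) : foldEndRight z a v = z v := by
  unfold foldEndRight
  split_ifs with h'
  · rw [le_antisymm h' h]; ring
  · rfl

theorem crimp_le {z : ℕ → ℝ} {a b v : ℕ} (h : v ≤ a) : crimp z a b v = z v := if_pos h

theorem crimp_mid {z : ℕ → ℝ} {a b v : ℕ} (h : a ≤ v) (h' : v ≤ b) :
    crimp z a b v = 2 * z a - z v := by
  unfold crimp
  split_ifs with h1
  · rw [le_antisymm h1 h]; ring
  · rfl

theorem crimp_ge {z : ℕ → ℝ} {a b v : ℕ} (hab : a < b) (h' : b ≤ v) :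
    crimp z a b v = z v - 2 * (z b - z a) := by
  unfold crimp
  split_ifs with h1 h2
  · omega
  · rw [le_antisymm h2 h']; ring
  · rfl

namespace Spread

variable {n : ℕ} {τ : ℕ → ℤ} {f z : ℕ → ℝ} {A : Finset ℕ}

/-- The length condition keeps the reflected end to the left of the remaining unfolded creases. The
turning sums required of the new state concern ranges that do not contain `a`, so they are
inherited. -/
theorem foldEndLeft (h : Spread n τ f A z) {a : ℕ} (ha : a ∈ A) (hmin : ∀ c ∈ A, a ≤ c)
    (hlen : ∀ v ≤ a, ∀ c ∈ A, c ≠ a → 2 * z a - z v ≤ z c) :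
    Spread n τ f (A.erase a) (foldEndLeft z a) := by
  have hgt : ∀ c ∈ A.erase a, a < c ∧ c ∈ A := fun c hc => by
    rw [Finset.mem_erase] at hc
    exact ⟨lt_of_le_of_ne (hmin c hc.2) hc.1.symm, hc.2⟩
  refine ⟨fun c hc => h.mem c (hgt c hc).2, fun c hc v hv => ?_, fun c hc v hv hv' => ?_, ?_,
    fun c hc c' hc' hcc' => ?_, fun c hc p hp hz => ?_, fun c hc q hq hqn hz => ?_⟩
  · obtain ⟨hac, hcA⟩ := hgt c hc
    rw [foldEndLeft_ge hac.le]
    rcases le_total v a with hva | hva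
    · rw [foldEndLeft_le hva]; exact hlen v hva c hcA hac.ne'
    · rw [foldEndLeft_ge hva]; exact h.left c hcA v hv
  · obtain ⟨hac, hcA⟩ := hgt c hc
    rw [foldEndLeft_ge hac.le, foldEndLeft_ge (by omega)]; exact h.right c hcA v hv hv'
  · obtain ⟨ε, h1, h2⟩ := h.local_isometry
    refine ⟨fun v => if v < a then - ε v else ε v, fun v hv => ?_, fun v hv => ?_⟩
    · obtain ⟨h3, h4⟩ := h1 v hv
      by_cases hva : v < a
      · simp only [hva, if_true]
        rw [foldEndLeft_le hva.le, foldEndLeft_le (show v + 1 ≤ a from hva), h4]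
        exact ⟨by rcases h3 with h3 | h3 <;> simp [h3], by ring⟩
      · simp only [hva, if_false]
        rw [foldEndLeft_ge (by omega), foldEndLeft_ge (by omega)]
        exact ⟨h3, h4⟩
    · have h3 := h2 v hv
      rcases lt_trichotomy (v + 1) a with hva | hva | hva
      · have : v + 1 ∉ A := fun hm => by have := hmin _ hm; omega
        simp only [this, if_false] at h3
        simp [hva, show v < a by omega, this, h3]
      · simp only [hva, ha, if_true] at h3
        simp [hva, show v < a by omega, h3]
      · have e : (v + 1 ∈ A.erase a) ↔ v + 1 ∈ A := by simp; omega
        simp only [e, show ¬ v + 1 < a by omega, show ¬ v < a by omega, if_false, h3]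
  · rw [sum_offSet_erase (by have := (hgt c hc).1; omega)]
    exact h.full c (hgt c hc).2 c' (hgt c' hc').2 hcc'
  · obtain ⟨hac, hcA⟩ := hgt c hc
    -- A vertex of the reflected end lies weakly to the right of `a`, so it cannot be strictly left
    -- of everything up to `c`.
    rcases lt_or_ge p a with hpa | hpa
    · have h1 := hz a hpa hac.le
      rw [foldEndLeft_le hpa.le, foldEndLeft_le le_rfl] at h1
      have := h.left a ha p hpa.le
      linarith
    · rw [sum_offSet_erase (by omega)]
      refine h.before c hcA p hp fun v hv hv' => ?_
      have := hz v hv hv'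
      rwa [foldEndLeft_ge hpa, foldEndLeft_ge (by omega)] at this
  · obtain ⟨hac, hcA⟩ := hgt c hc
    rw [sum_offSet_erase (by omega)]
    refine h.after c hcA q hq hqn fun v hv hv' => ?_
    have := hz v hv hv'
    rwa [foldEndLeft_ge (by omega), foldEndLeft_ge (by omega)] at this

theorem foldEndRight (h : Spread n τ f A z) {a : ℕ} (ha : a ∈ A) (hmax : ∀ c ∈ A, c ≤ a)
    (hlen : ∀ v, a ≤ v → v ≤ n + 1 → ∀ c ∈ A, c ≠ a → z c ≤ 2 * z a - z v) :
    Spread n τ f (A.erase a) (foldEndRight z a) := by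
  have hgt : ∀ c ∈ A.erase a, c < a ∧ c ∈ A := fun c hc => by
    rw [Finset.mem_erase] at hc
    exact ⟨lt_of_le_of_ne (hmax c hc.2) hc.1, hc.2⟩
  refine ⟨fun c hc => h.mem c (hgt c hc).2, fun c hc v hv => ?_, fun c hc v hv hv' => ?_, ?_,
    fun c hc c' hc' hcc' => ?_, fun c hc p hp hz => ?_, fun c hc q hq hqn hz => ?_⟩
  · obtain ⟨hac, hcA⟩ := hgt c hc
    rw [foldEndRight_le hac.le, foldEndRight_le (by omega)]; exact h.left c hcA v hv
  · obtain ⟨hac, hcA⟩ := hgt c hc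
    rw [foldEndRight_le hac.le]
    rcases le_total a v with hva | hva
    · rw [foldEndRight_ge hva]; exact hlen v hva hv' c hcA hac.ne
    · rw [foldEndRight_le hva]; exact h.right c hcA v hv hv'
  · obtain ⟨ε, h1, h2⟩ := h.local_isometry
    refine ⟨fun v => if v < a then ε v else - ε v, fun v hv => ?_, fun v hv => ?_⟩
    · obtain ⟨h3, h4⟩ := h1 v hv
      by_cases hva : v < a
      · simp only [hva, if_true]
        rw [foldEndRight_le hva.le, foldEndRight_le (show v + 1 ≤ a from hva)]
        exact ⟨h3, h4⟩
      · simp only [hva, if_false]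
        rw [foldEndRight_ge (by omega), foldEndRight_ge (by omega), h4]
        exact ⟨by rcases h3 with h3 | h3 <;> simp [h3], by ring⟩
    · have h3 := h2 v hv
      rcases lt_trichotomy (v + 1) a with hva | hva | hva
      · have e : (v + 1 ∈ A.erase a) ↔ v + 1 ∈ A := by simp; omega
        simp only [e, hva, show v < a by omega, if_true, h3]
      · simp only [hva, ha, if_true] at h3
        simp [hva, show v < a by omega, h3]
      · have : v + 1 ∉ A := fun hm => by have := hmax _ hm; omega
        simp only [this, if_false] at h3
        simp [show ¬ v + 1 < a by omega, show ¬ v < a by omega, this, h3]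
  · rw [sum_offSet_erase (by have := (hgt c' hc').1; omega)]
    exact h.full c (hgt c hc).2 c' (hgt c' hc').2 hcc'
  · obtain ⟨hac, hcA⟩ := hgt c hc
    rw [sum_offSet_erase (by omega)]
    refine h.before c hcA p hp fun v hv hv' => ?_
    have := hz v hv hv'
    rwa [foldEndRight_le (by omega), foldEndRight_le (by omega)] at this
  · obtain ⟨hac, hcA⟩ := hgt c hc
    rcases lt_or_ge a q with hpa | hpa
    · have h1 := hz a hac.le hpa
      rw [foldEndRight_ge hpa.le, foldEndRight_ge le_rfl] at h1
      have := h.right a ha q hpa.le hqn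
      linarith
    · rw [sum_offSet_erase (by omega)]
      refine h.after c hcA q hq hqn fun v hv hv' => ?_
      have := hz v hv hv'
      rwa [foldEndRight_le hpa, foldEndRight_le (by omega)] at this

/-- Moving the right part back by twice the gap leaves the remaining creases separating, because
neither adjacent gap is shorter than the crimped one. The turning sums are unaffected, because the
two new turns are opposite and the creases between them already cancel. -/
theorem crimp (h : Spread n τ f A z) {a b : ℕ} (ha : a ∈ A) (hb : b ∈ A) (hab : a < b)
    (hcons : ∀ c ∈ A, c ≤ a ∨ b ≤ c) (hτ : τ a + τ b = 0)
    (hleft : ∀ c ∈ A, c < a → z b - z a ≤ z a - z c)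
    (hright : ∀ c ∈ A, b < c → z b - z a ≤ z c - z b) :
    Spread n τ f ((A.erase a).erase b) (crimp z a b) := by
  have hgt : ∀ c ∈ (A.erase a).erase b, c ∈ A ∧ (c < a ∨ b < c) := fun c hc => by
    simp only [Finset.mem_erase] at hc
    have := hcons c hc.2.2
    exact ⟨hc.2.2, by omega⟩
  have hoff : ∀ p q, ¬ (p < a ∧ a < q) → ¬ (p < b ∧ b < q) →
      ∑ v ∈ Finset.Ioo p q, offSet ((A.erase a).erase b) τ v =
        ∑ v ∈ Finset.Ioo p q, offSet A τ v := fun p q h1 h2 => by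
    rw [sum_offSet_erase h2, sum_offSet_erase h1]
  -- A range across the crimp splits at `a` and `b`: the middle sum vanishes by `full`, and the two
  -- crimped creases cancel by `hτ`.
  have hcross : ∀ p q, p < a → b < q →
      ∑ v ∈ Finset.Ioo p q, offSet ((A.erase a).erase b) τ v =
        ∑ v ∈ Finset.Ioo p a, offSet A τ v + ∑ v ∈ Finset.Ioo b q, offSet A τ v := by
    intro p q hpa hbq
    rw [sum_Ioo_split hpa (hab.trans hbq), sum_Ioo_split hab hbq, hoff p a (by omega) (by omega),
      hoff a b (by omega) (by omega), hoff b q (by omega) (by omega), h.full a ha b hb hab]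
    have e1 : offSet ((A.erase a).erase b) τ a = τ a := by simp [offSet]
    have e2 : offSet ((A.erase a).erase b) τ b = τ b := by simp [offSet]
    rw [e1, e2]; linarith
  have hab' := h.left b hb a hab.le
  have hbn := (h.mem b hb).2
  refine ⟨fun c hc => h.mem c (hgt c hc).1, fun c hc v hv => ?_, fun c hc v hv hv' => ?_, ?_,
    fun c hc c' hc' hcc' => ?_, fun c hc p hp hz => ?_, fun c hc q hq hqn hz => ?_⟩
  · obtain ⟨hcA, hc | hc⟩ := hgt c hc
    · rw [crimp_le hc.le, crimp_le (by omega)]; exact h.left c hcA v hv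
    · have h1 := hright c hcA hc
      rw [crimp_ge hab hc.le]
      rcases le_total v a with hva | hva
      · rw [crimp_le hva]
        have := h.left a ha v hva
        linarith
      · rcases le_total v b with hvb | hvb
        · rw [crimp_mid hva hvb]
          have := h.right a ha v hva (by omega)
          linarith
        · rw [crimp_ge hab hvb]
          have := h.left c hcA v hv
          linarith
  · obtain ⟨hcA, hc | hc⟩ := hgt c hc
    · have h1 := hleft c hcA hc
      rw [crimp_le hc.le]
      rcases le_total v a with hva | hva
      · rw [crimp_le hva]; exact h.right c hcA v hv hv'
      · rcases le_total v b with hvb | hvb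
        · rw [crimp_mid hva hvb]
          have := h.left b hb v hvb
          linarith
        · rw [crimp_ge hab hvb]
          have := h.right b hb v hvb hv'
          linarith
    · rw [crimp_ge hab hc.le, crimp_ge hab (by omega)]
      have := h.right c hcA v hv hv'
      linarith
  · obtain ⟨ε, h1, h2⟩ := h.local_isometry
    refine ⟨fun v => if v < a then ε v else if v < b then - ε v else ε v, fun v hv => ?_,
      fun v hv => ?_⟩
    · obtain ⟨h3, h4⟩ := h1 v hv
      by_cases hva : v < a
      · simp only [hva, if_true]
        rw [crimp_le hva.le, crimp_le (show v + 1 ≤ a from hva)]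
        exact ⟨h3, h4⟩
      · by_cases hvb : v < b
        · simp only [hva, hvb, if_false, if_true]
          rw [crimp_mid (by omega) hvb.le, crimp_mid (by omega) (show v + 1 ≤ b from hvb), h4]
          exact ⟨by rcases h3 with h3 | h3 <;> simp [h3], by ring⟩
        · simp only [hva, hvb, if_false]
          rw [crimp_ge hab (by omega), crimp_ge hab (by omega), h4]
          exact ⟨h3, by ring⟩
    · have h3 := h2 v hv
      by_cases hva : v + 1 = a
      · simp only [hva, ha, if_true] at h3
        simp [hva, show v < a by omega, h3, hab]
      · by_cases hvb : v + 1 = b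
        · simp only [hvb, hb, if_true] at h3
          simp [hvb, show ¬ v < a by omega, show ¬ b < a by omega, show v < b by omega, h3]
        · have e : (v + 1 ∈ (A.erase a).erase b) ↔ v + 1 ∈ A := by simp [hva, hvb]
          have e1 : v + 1 < a ↔ v < a := by omega
          have e2 : v + 1 < b ↔ v < b := by omega
          simp only [e, e1, e2, h3]
          split_ifs <;> simp
  · obtain ⟨hcA, hc⟩ := hgt c hc
    obtain ⟨hcA', hc'⟩ := hgt c' hc'
    by_cases hx : c < a ∧ b < c'
    · rw [hcross c c' hx.1 hx.2, h.full c hcA a ha hx.1, h.full b hb c' hcA' hx.2]; rfl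
    · rw [hoff c c' (by omega) (by omega)]; exact h.full c hcA c' hcA' hcc'
  · obtain ⟨hcA, hc⟩ := hgt c hc
    rcases hc with hc | hc
    · rw [hoff p c (by omega) (by omega)]
      refine h.before c hcA p hp fun v hv hv' => ?_
      have := hz v hv hv'
      rwa [crimp_le (by omega), crimp_le (by omega)] at this
    · rcases lt_or_ge p a with hpa | hpa
      · rw [hcross p c hpa hc, h.full b hb c hcA hc]
        rw [h.before a ha p hpa fun v hv hv' => ?_]
        · rfl
        · have := hz v hv (by omega)
          rwa [crimp_le (by omega), crimp_le (by omega)] at this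
      · rcases lt_or_ge p b with hpb | hpb
        -- Inside the reversed strip, vertex `b` has become leftmost, so `p` cannot lie strictly to
        -- its left.
        · have h1 := hz b hpb hc.le
          rw [crimp_mid hpa hpb.le, crimp_mid hab.le le_rfl] at h1
          have := h.left b hb p hpb.le
          linarith
        · rw [hoff p c (by omega) (by omega)]
          refine h.before c hcA p hp fun v hv hv' => ?_
          have := hz v hv hv'
          rw [crimp_ge hab hpb, crimp_ge hab (by omega)] at this
          linarith
  · obtain ⟨hcA, hc⟩ := hgt c hc
    rcases hc with hc | hc
    · rcases lt_or_ge b q with hpb | hpb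
      · rw [hcross c q hc hpb, h.full c hcA a ha hc]
        rw [h.after b hb q hpb hqn fun v hv hv' => ?_]
        · rfl
        · have := hz v (by omega) hv'
          rw [crimp_ge hab hpb.le, crimp_ge hab (by omega)] at this
          linarith
      · rcases lt_or_ge a q with hpa | hpa
        · have h1 := hz a hc.le hpa
          rw [crimp_mid hpa.le hpb, crimp_mid le_rfl hab.le] at h1
          have := h.right a ha q hpa.le hqn
          linarith
        · rw [hoff c q (by omega) (by omega)]
          refine h.after c hcA q hq hqn fun v hv hv' => ?_
          have := hz v hv hv'
          rwa [crimp_le (by omega), crimp_le (by omega)] at this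
    · rw [hoff c q (by omega) (by omega)]
      refine h.after c hcA q hq hqn fun v hv hv' => ?_
      have := hz v hv hv'
      rw [crimp_ge hab (by omega), crimp_ge hab (by omega)] at this
      linarith

end Spread

/-! ### Existence of an end fold or a crimp under the turning criterion -/

namespace Spread

variable {n : ℕ} {τ : ℕ → ℤ} {f z : ℕ → ℝ} {A : Finset ℕ}

/-- Between two consecutive unfolded creases, `f` and `z` agree up to an isometry of the line. -/
theorem isometry (h : Spread n τ f A z) {p q : ℕ} (hpq : p < q) (hq : q ≤ n + 1)
    (hA : ∀ c ∈ A, ¬ (p < c ∧ c < q)) :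
    ∃ κ : ℝ, (κ = 1 ∨ κ = -1) ∧ ∀ v, p ≤ v → v ≤ q → f v - f p = κ * (z v - z p) := by
  obtain ⟨ε, h1, h2⟩ := h.local_isometry
  have hε : ∀ v, p ≤ v → v < q → ε v = ε p := by
    intro v hv
    induction v, hv using Nat.le_induction with
    | base => exact fun _ => rfl
    | succ v hv ih =>
      intro hvq
      rw [h2 v (by omega), if_neg (fun hm => hA _ hm ⟨by omega, hvq⟩), ih (by omega)]
  refine ⟨ε p, (h1 p (by omega)).1, fun v hv => ?_⟩
  induction v, hv using Nat.le_induction with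
  | base => intro _; simp
  | succ v hv ih =>
    intro hvq
    have h3 := (h1 v (by omega)).2
    rw [hε v hv hvq] at h3
    have h4 := ih (by omega)
    linear_combination h3 + h4

theorem lt_of_lt (h : Spread n τ f A z) (hf : ∀ v ≤ n, f v ≠ f (v + 1)) {c c' : ℕ} (hc : c ∈ A)
    (hc' : c' ∈ A) (hcc : c < c') : z c < z c' := by
  have h1 := h.right c hc (c + 1) (by omega) (by have := h.mem c' hc'; omega)
  have h2 := h.left c' hc' (c + 1) hcc
  refine lt_of_le_of_ne (h1.trans h2) fun he => ?_
  obtain ⟨ε, h3, -⟩ := h.local_isometry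
  have hcn : c ≤ n := (h.mem c hc).2
  have h4 := (h3 c hcn).2
  rw [show z (c + 1) = z c by linarith] at h4
  exact hf c hcn (by linarith)

/-- A spread paper that satisfies the turning criterion has an end fold or a crimp. -/
theorem exists_fold (h : Spread n τ f A z) (hA : A.Nonempty) (hf : ∀ v ≤ n, f v ≠ f (v + 1))
    (hτ : ∀ c ∈ A, τ c = 1 ∨ τ c = -1) (hcrit : TurningCriterion n f τ) :
    (∃ a ∈ A, (∀ c ∈ A, a ≤ c) ∧ ∀ v ≤ a, ∀ c ∈ A, c ≠ a → 2 * z a - z v ≤ z c) ∨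
    (∃ a ∈ A, (∀ c ∈ A, c ≤ a) ∧
      ∀ v, a ≤ v → v ≤ n + 1 → ∀ c ∈ A, c ≠ a → z c ≤ 2 * z a - z v) ∨
    (∃ a ∈ A, ∃ b ∈ A, a < b ∧ (∀ c ∈ A, c ≤ a ∨ b ≤ c) ∧ τ a + τ b = 0 ∧
      (∀ c ∈ A, c < a → z b - z a ≤ z a - z c) ∧ (∀ c ∈ A, b < c → z b - z a ≤ z c - z b)) := by
  -- the unfolded creases with the smallest distance
  by_cases hpairs : ((A ×ˢ A).filter fun p => p.1 < p.2).Nonempty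
  swap
  -- With a single unfolded crease, either side is a foldable end and the length condition is empty.
  · obtain ⟨a, ha⟩ := hA
    have hall : ∀ c ∈ A, c = a := by
      intro c hc
      by_contra hne
      rcases lt_or_gt_of_ne hne with hlt | hlt
      · exact hpairs ⟨(c, a), by simp [hc, ha, hlt]⟩
      · exact hpairs ⟨(a, c), by simp [hc, ha, hlt]⟩
    exact Or.inl ⟨a, ha, fun c hc => (hall c hc).ge, fun v _ c hc hca => absurd (hall c hc) hca⟩
  obtain ⟨⟨a, b⟩, hab0, hmin0⟩ := Finset.exists_min_image _ (fun p : ℕ × ℕ => z p.2 - z p.1) hpairs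
  simp only [Finset.mem_filter, Finset.mem_product] at hab0
  obtain ⟨⟨ha, hb⟩, hab⟩ := hab0
  have hmin : ∀ c ∈ A, ∀ c' ∈ A, c < c' → z b - z a ≤ z c' - z c := fun c hc c' hc' hcc =>
    hmin0 (c, c') (by simp [hc, hc', hcc])
  have hcons : ∀ c ∈ A, ¬ (a < c ∧ c < b) := by
    rintro c hc ⟨h1, h2⟩
    have := hmin a ha c hc h1
    have := h.lt_of_lt hf hc hb h2
    linarith
  have hbn := (h.mem b hb).2
  -- the strip covered by the paper between them
  obtain ⟨κ, hκ, hiso⟩ := h.isometry hab (by omega) hcons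
  obtain ⟨lo, hi, hlohi, hstrip⟩ : ∃ lo hi : ℝ, hi - lo = z b - z a ∧
      ∀ v, a ≤ v → v ≤ b → lo ≤ f v ∧ f v ≤ hi := by
    rcases hκ with rfl | rfl
    · refine ⟨f a, f b, by linarith [hiso b hab.le le_rfl], fun v h1 h2 => ?_⟩
      have := hiso v h1 h2
      have := hiso b hab.le le_rfl
      have := h.right a ha v h1 (by omega)
      have := h.left b hb v h2
      constructor <;> linarith
    · refine ⟨f b, f a, by linarith [hiso b hab.le le_rfl], fun v h1 h2 => ?_⟩
      have := hiso v h1 h2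
      have := hiso b hab.le le_rfl
      have := h.right a ha v h1 (by omega)
      have := h.left b hb v h2
      constructor <;> linarith
  have habs : ∀ v w, (lo ≤ f v ∧ f v ≤ hi) → (lo ≤ f w ∧ f w ≤ hi) → |f v - f w| ≤ z b - z a := by
    intro v w h1 h2
    rw [abs_le]; constructor <;> linarith
  have hdist : ∀ κ : ℝ, (κ = 1 ∨ κ = -1) → ∀ t s : ℝ, t = κ * s → s ≤ |t| := by
    rintro κ (rfl | rfl) t s rfl
    · simpa using le_abs_self s
    · simpa using le_abs_self s
  -- the last vertex before the strip
  by_cases hp : ∃ v < a, ¬ (lo ≤ f v ∧ f v ≤ hi)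
  swap
  -- All paper to the left of `a` stays in the strip. The end beyond the leftmost unfolded crease
  -- therefore reaches no further than the smallest gap, and it can be folded.
  · push Not at hp
    left
    have ha1 := A.min'_mem hA
    have ha1a : A.min' hA ≤ a := A.min'_le a ha
    have hin : ∀ v ≤ a, lo ≤ f v ∧ f v ≤ hi := fun v hv => by
      rcases hv.eq_or_lt with rfl | hv
      · exact hstrip _ le_rfl hab.le
      · exact hp v hv
    refine ⟨A.min' hA, ha1, fun c hc => A.min'_le c hc, fun v hv c hc hne => ?_⟩
    have h1 := hmin _ ha1 c hc (lt_of_le_of_ne (A.min'_le c hc) hne.symm)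
    rcases hv.eq_or_lt with rfl | hv
    · have := h.right _ ha1 c (A.min'_le c hc) (by have := h.mem c hc; omega)
      linarith
    · obtain ⟨κ', hκ', hi'⟩ := h.isometry hv (by omega)
        (fun c hc hh => by have := A.min'_le c hc; omega)
      have h2 := hdist κ' hκ' _ _ (hi' _ hv.le le_rfl)
      have h3 := habs _ _ (hin (A.min' hA) ha1a) (hin v (by omega))
      linarith
  by_cases hq : ∃ v, b < v ∧ v ≤ n + 1 ∧ ¬ (lo ≤ f v ∧ f v ≤ hi)
  swap
  · push Not at hq
    right; left
    have ha1 := A.max'_mem hA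
    have ha1a : b ≤ A.max' hA := A.le_max' b hb
    have hmn := (h.mem _ ha1).2
    have hin : ∀ v, b ≤ v → v ≤ n + 1 → lo ≤ f v ∧ f v ≤ hi := fun v hv hvn => by
      rcases hv.eq_or_lt with rfl | hv
      · exact hstrip _ hab.le le_rfl
      · exact hq v hv hvn
    refine ⟨A.max' hA, ha1, fun c hc => A.le_max' c hc, fun v hv hvn c hc hne => ?_⟩
    have h1 := hmin c hc _ ha1 (lt_of_le_of_ne (A.le_max' c hc) hne)
    rcases hv.eq_or_lt with rfl | hv
    · have := h.left _ ha1 c (A.le_max' c hc)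
      linarith
    · obtain ⟨κ', hκ', hi'⟩ := h.isometry hv hvn
        (fun c hc hh => by have := A.le_max' c hc; omega)
      have h2 := hdist κ' hκ' _ _ (hi' _ hv.le le_rfl)
      have h3 := habs _ _ (hin v (by omega) hvn) (hin (A.max' hA) ha1a (by omega))
      linarith
  right; right
  obtain ⟨p, hpa, hpout, hpin⟩ : ∃ p < a, ¬ (lo ≤ f p ∧ f p ≤ hi) ∧
      ∀ v, p < v → v < a → lo ≤ f v ∧ f v ≤ hi := by
    obtain ⟨v, hv, hvo⟩ := hp
    have := Nat.findGreatest_spec (P := fun v => v < a ∧ ¬ (lo ≤ f v ∧ f v ≤ hi)) hv.le ⟨hv, hvo⟩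
    refine ⟨_, this.1, this.2, fun w hw hwa => ?_⟩
    by_contra hc
    exact Nat.findGreatest_is_greatest hw hwa.le ⟨hwa, hc⟩
  obtain ⟨q, hbq, hqn, hqout, hqin⟩ : ∃ q, b < q ∧ q ≤ n + 1 ∧ ¬ (lo ≤ f q ∧ f q ≤ hi) ∧
      ∀ v, b < v → v < q → lo ≤ f v ∧ f v ≤ hi := by
    classical
    have := Nat.find_spec hq
    refine ⟨_, this.1, this.2.1, this.2.2, fun w hw hwq => ?_⟩
    by_contra hc
    exact Nat.find_min hq hwq ⟨hw, by omega, hc⟩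
  have hin : ∀ v, p < v → v < q → lo ≤ f v ∧ f v ≤ hi := by
    intro v h1 h2
    rcases lt_or_ge v a with h3 | h3
    · exact hpin v h1 h3
    · rcases le_or_gt v b with h4 | h4
      · exact hstrip v h3 h4
      · exact hqin v h4 h2
  -- consecutive unfolded creases in this range have the smallest distance
  have hgap : ∀ c ∈ A, ∀ c' ∈ A, p < c → c < c' → c' < q → (∀ e ∈ A, ¬ (c < e ∧ e < c')) →
      z c' - z c = z b - z a := by
    intro c hc c' hc' hpc hcc hcq he
    obtain ⟨κ', hκ', hi'⟩ := h.isometry hcc (by omega) he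
    have h2 := hdist κ' hκ' _ _ (hi' _ hcc.le le_rfl)
    have h3 := habs _ _ (hin c' (by omega) hcq) (hin c hpc (by omega))
    exact le_antisymm (h2.trans h3) (hmin c hc c' hc' hcc)
  -- Two consecutive unfolded creases of opposite type in this range would form a crimp, since their
  -- gap is the smallest one.
  by_contra hno
  have hsame : ∀ c ∈ A, ∀ c' ∈ A, p < c → c < c' → c' < q → (∀ e ∈ A, ¬ (c < e ∧ e < c')) →
      τ c' = τ c := by
    intro c hc c' hc' hpc hcc hcq he
    by_contra hne
    have hg := hgap c hc c' hc' hpc hcc hcq he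
    refine hno ⟨c, hc, c', hc', hcc, fun e heA => ?_, ?_, fun e heA hec => ?_, fun e heA hec => ?_⟩
    · have := he e heA; omega
    · rcases hτ c hc with h1 | h1 <;> rcases hτ c' hc' with h2 | h2 <;> omega
    · rw [hg]; exact hmin e heA c hc hec
    · rw [hg]; exact hmin c' hc' e heA hec
  -- so all unfolded creases in this range have the same type
  set B := A.filter fun c => p < c ∧ c < q with hB
  have hmemB : ∀ c, c ∈ B ↔ c ∈ A ∧ p < c ∧ c < q := fun c => by simp [hB]
  have haB : a ∈ B := (hmemB a).2 ⟨ha, hpa, by omega⟩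
  have hbB : b ∈ B := (hmemB b).2 ⟨hb, by omega, hbq⟩
  have hBne : B.Nonempty := ⟨a, haB⟩
  obtain ⟨hc0, hpc0, hc0q⟩ := (hmemB _).1 (B.min'_mem hBne)
  obtain ⟨hc1, hpc1, hc1q⟩ := (hmemB _).1 (B.max'_mem hBne)
  set c0 := B.min' hBne with hc0def
  set c1 := B.max' hBne with hc1def
  have hc01 : c0 < c1 := (B.min'_le a haB).trans_lt (hab.trans_le (B.le_max' b hbB))
  have hall : ∀ c ∈ B, τ c = τ c0 := by
    intro c
    induction c using Nat.strong_induction_on with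
    | _ c ih =>
      intro hc
      rcases (B.min'_le c hc).eq_or_lt with he | hlt
      · rw [← he]
      · have hne : (B.filter (· < c)).Nonempty := ⟨c0, by
          rw [Finset.mem_filter]; exact ⟨B.min'_mem hBne, hlt⟩⟩
        have hm := (B.filter (· < c)).max'_mem hne
        rw [Finset.mem_filter] at hm
        rw [← ih _ hm.2 hm.1]
        obtain ⟨hcA, hpc, hcq⟩ := (hmemB c).1 hc
        obtain ⟨hmA, hpm, hmq⟩ := (hmemB _).1 hm.1
        refine hsame _ hmA c hcA hpm hm.2 hcq fun e he hlt' => ?_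
        have := (B.filter (· < c)).le_max' e (by
          rw [Finset.mem_filter]; exact ⟨(hmemB e).2 ⟨he, by omega, by omega⟩, hlt'.2⟩)
        omega
  -- the folded creases in this range contribute nothing
  have hsuff : ∀ v, p < v → v ≤ c0 → z p < z v := by
    obtain ⟨κ', hκ', hi'⟩ := h.isometry hpc0 (by omega) (fun e he hh => by
      have := B.min'_le e ((hmemB e).2 ⟨he, by omega, by omega⟩); omega)
    intro v hv hvc
    have h1 := hi' v hv.le hvc
    have h2 := hi' c0 hpc0.le le_rfl
    have h3 := hin v hv (by omega)
    have h4 := hin c0 hpc0 hc0q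
    have h5 := h.left c0 hc0 p hpc0.le
    by_contra hc
    rcases hκ' with rfl | rfl
    · exact hpout ⟨by linarith, by linarith⟩
    · exact hpout ⟨by linarith, by linarith⟩
  have hpref : ∀ v, c1 ≤ v → v < q → z v < z q := by
    obtain ⟨κ', hκ', hi'⟩ := h.isometry hc1q hqn (fun e he hh => by
      have := B.le_max' e ((hmemB e).2 ⟨he, by omega, by omega⟩); omega)
    intro v hv hvc
    have h1 := hi' v hv hvc.le
    have h2 := hi' q hc1q.le le_rfl
    have h3 := hin v (by omega) hvc
    have h4 := hin c1 hpc1 hc1q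
    have h5 := h.right c1 hc1 q hc1q.le hqn
    by_contra hc
    rcases hκ' with rfl | rfl
    · exact hqout ⟨by linarith, by linarith⟩
    · exact hqout ⟨by linarith, by linarith⟩
  have hoff : ∀ c ∈ A, offSet A τ c = 0 := fun c hc => if_pos hc
  have hzero : ∑ v ∈ Finset.Ioo p q, offSet A τ v = 0 := by
    rw [sum_Ioo_split hpc0 hc0q, sum_Ioo_split hc01 hc1q, h.before c0 hc0 p hpc0 hsuff,
      h.full c0 hc0 c1 hc1 hc01, h.after c1 hc1 q hc1q hqn hpref, hoff c0 hc0, hoff c1 hc1]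
    rfl
  have hsum : ∑ v ∈ Finset.Ioo p q, τ v = B.card * τ c0 := by
    have e1 : ∑ v ∈ Finset.Ioo p q, τ v = ∑ v ∈ Finset.Ioo p q, offSet A τ v +
        ∑ v ∈ Finset.Ioo p q, if v ∈ A then τ v else 0 := by
      rw [← Finset.sum_add_distrib]
      refine Finset.sum_congr rfl fun v _ => ?_
      unfold offSet; split_ifs <;> simp
    have e2 : (Finset.Ioo p q).filter (· ∈ A) = B := by
      ext v; rw [hmemB, Finset.mem_filter, Finset.mem_Ioo]; tauto
    rw [e1, hzero, zero_add, ← Finset.sum_filter, e2, Finset.sum_congr rfl hall]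
    simp
  have hcard : 2 ≤ B.card := by
    have : ({a, b} : Finset ℕ) ⊆ B := by
      intro v hv
      simp only [Finset.mem_insert, Finset.mem_singleton] at hv
      rcases hv with rfl | rfl <;> assumption
    have h2 := Finset.card_le_card this
    rwa [Finset.card_pair hab.ne] at h2
  -- All vertices strictly between `p` and `q` lie in the strip, so leaving the strip is the same as
  -- being beyond all of them.
  have hext : ∀ r, ¬ (lo ≤ f r ∧ f r ≤ hi) → VertexExtreme f p q r := by
    intro r hr
    rcases lt_or_ge (f r) lo with h1 | h1
    · exact Or.inl fun v hv hv' => h1.trans_le (hin v hv hv').1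
    · refine Or.inr fun v hv hv' => (hin v hv hv').2.trans_lt ?_
      by_contra hc
      exact hr ⟨h1, not_lt.1 hc⟩
  have := hcrit p q (by omega) hqn (hext p hpout) (hext q hqout)
  rw [hsum, abs_le] at this
  have hcard' : (2 : ℤ) ≤ B.card := by exact_mod_cast hcard
  rcases hτ c0 hc0 with h1 | h1 <;> rw [h1] at this <;> omega

end Spread

/-! ## The characterization of foldability -/

namespace ChainState

/-- One-layer simple folds, for labels `lab` with values `1` (valley), `-1` (mountain) and `0`. -/
def Step (n : ℕ) (lab : ℕ → ℤ) (S S' : ChainState) : Prop :=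
  ∃ (d : ℕ) (r up : Bool), S.CanFold n d r up ∧
    (lab d = 0 ∨ lab d = dirSign up * S.heading d) ∧ S' = S.fold d r up

/-- The two parts lie on opposite sides of the fold line and overlap nowhere, so either part may
move in either direction. -/
theorem canFold_of_separate {n : ℕ} {S : ChainState} {d : ℕ} (r up : Bool) (h1 : 1 ≤ d)
    (hn : d ≤ n) (ht : S.turn d = 0)
    (h : ((∀ v ≤ d, S.x v ≤ S.x d) ∧ ∀ v, d ≤ v → v ≤ n + 1 → S.x d ≤ S.x v) ∨
      ((∀ v ≤ d, S.x d ≤ S.x v) ∧ ∀ v, d ≤ v → v ≤ n + 1 → S.x v ≤ S.x d)) :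
    S.CanFold n d r up := by
  have hfree : ∀ i < d, ∀ j, d ≤ j → j ≤ n → ∀ t, Between (S.x i) (S.x (i + 1)) t →
      Between (S.x j) (S.x (j + 1)) t → False := by
    intro i hi j hj hjn t hti htj
    rcases h with ⟨hl, hr⟩ | ⟨hl, hr⟩ <;>
    · have a1 := hl i hi.le
      have a2 := hl (i + 1) hi
      have a3 := hr j hj (by omega)
      have a4 := hr (j + 1) (by omega) (by omega)
      rcases hti with hti | hti <;> rcases htj with htj | htj <;>
        linarith [hti.1, hti.2, htj.1, htj.2]
  refine ⟨h1, hn, ht, ?_, fun i hi j hj hmi hmj t hti htj => ?_⟩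
  · cases r
    · rcases h with ⟨hl, hr⟩ | ⟨hl, hr⟩
      · exact Or.inr fun v _ hv => hl v (by simpa [VertexMoves] using hv)
      · exact Or.inl fun v _ hv => hl v (by simpa [VertexMoves] using hv)
    · rcases h with ⟨hl, hr⟩ | ⟨hl, hr⟩
      · exact Or.inl fun v hvn hv => hr v (by simpa [VertexMoves] using hv) hvn
      · exact Or.inr fun v hvn hv => hr v (by simpa [VertexMoves] using hv) hvn
  · exfalso
    cases r
    · simp [SegmentMoves] at hmi hmj
      exact hfree i hmi j hmj hj t hti htj
    · simp [SegmentMoves] at hmi hmj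
      exact hfree j hmj i hmi hi t htj hti

theorem exists_dirSign {t h : ℤ} (ht : t = 1 ∨ t = -1) (hh : h = 1 ∨ h = -1) :
    ∃ up, dirSign up * h = t := by
  rcases ht with rfl | rfl <;> rcases hh with rfl | rfl
  exacts [⟨true, rfl⟩, ⟨false, rfl⟩, ⟨false, rfl⟩, ⟨true, rfl⟩]

/-- The unfolded creases of the state are `A`, and its vertices have, up to an isometry of the
line, the positions `z`. -/
structure Realizes (n : ℕ) (τ : ℕ → ℤ) (A : Finset ℕ) (z : ℕ → ℝ) (c : ℝ) (κ : ℤ)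
    (S : ChainState) : Prop where
  sign : κ = 1 ∨ κ = -1
  pos : ∀ v ≤ n + 1, S.x v = c + κ * z v
  turn : ∀ v, 1 ≤ v → v ≤ n → S.turn v = offSet A τ v

section

variable {n : ℕ} {τ lab : ℕ → ℤ} {f z : ℕ → ℝ} {A : Finset ℕ} {c : ℝ} {κ : ℤ} {S : ChainState}

theorem Realizes.separate (h : S.Realizes n τ A z c κ) (hz : Spread n τ f A z) {d : ℕ}
    (hd : d ∈ A) :
    ((∀ v ≤ d, S.x v ≤ S.x d) ∧ ∀ v, d ≤ v → v ≤ n + 1 → S.x d ≤ S.x v) ∨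
      ((∀ v ≤ d, S.x d ≤ S.x v) ∧ ∀ v, d ≤ v → v ≤ n + 1 → S.x v ≤ S.x d) := by
  have hdn := (hz.mem d hd).2
  have hp := h.pos
  rcases h.sign with rfl | rfl
  · refine Or.inl ⟨fun v hv => ?_, fun v hv hvn => ?_⟩
    · rw [hp v (by omega), hp d (by omega)]
      have := hz.left d hd v hv
      push_cast; linarith
    · rw [hp v (by omega), hp d (by omega)]
      have := hz.right d hd v hv hvn
      push_cast; linarith
  · refine Or.inr ⟨fun v hv => ?_, fun v hv hvn => ?_⟩
    · rw [hp v (by omega), hp d (by omega)]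
      have := hz.left d hd v hv
      push_cast; linarith
    · rw [hp v (by omega), hp d (by omega)]
      have := hz.right d hd v hv hvn
      push_cast; linarith

theorem Realizes.heading_eq (h : S.Realizes n τ A z c κ) (hz : Spread n τ f A z)
    (hf : ∀ v ≤ n, f v ≠ f (v + 1)) {d : ℕ} (hd : d ∈ A) : S.heading d = κ := by
  have hdn := (hz.mem d hd).2
  have h1 : z d < z (d + 1) := by
    refine lt_of_le_of_ne (hz.right d hd (d + 1) (by omega) (by omega)) fun he => ?_
    obtain ⟨ε, h3, -⟩ := hz.local_isometry
    have h4 := (h3 d hdn).2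
    rw [he] at h4
    exact hf d hdn (by linarith)
  have hp := h.pos
  rcases h.sign with rfl | rfl
  · exact heading_of_lt (by rw [hp d (by omega), hp (d + 1) (by omega)]; push_cast; linarith)
  · exact heading_of_gt (by rw [hp d (by omega), hp (d + 1) (by omega)]; push_cast; linarith)

theorem Realizes.turn_fold (h : S.Realizes n τ A z c κ) {d : ℕ} {r up : Bool}
    (hτ : dirSign up * S.heading d = τ d) :
    ∀ v, 1 ≤ v → v ≤ n → (S.fold d r up).turn v = offSet (A.erase d) τ v := by
  intro v h1 hn
  have := h.turn v h1 hn
  by_cases hv : v = d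
  · subst hv; simp [fold, offSet, hτ]
  · simp [fold, this, offSet, hv]

theorem Realizes.foldEndLeft (h : S.Realizes n τ A z c κ) (hz : Spread n τ f A z)
    (hτ : ∀ d ∈ A, (τ d = 1 ∨ τ d = -1) ∧ (lab d = 0 ∨ lab d = τ d)) {a : ℕ} (ha : a ∈ A) :
    ∃ S', Step n lab S S' ∧ S'.Realizes n τ (A.erase a) (foldEndLeft z a) c κ := by
  obtain ⟨up, hup⟩ := exists_dirSign (hτ a ha).1 (S.eq_heading a)
  obtain ⟨ha1, han⟩ := hz.mem a ha
  refine ⟨S.fold a false up, ⟨a, false, up, canFold_of_separate _ _ ha1 han ?_ (h.separate hz ha),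
    by rw [hup]; exact (hτ a ha).2, rfl⟩, h.sign, fun v hv => ?_, h.turn_fold hup⟩
  · rw [h.turn a ha1 han]; exact if_pos ha
  · rw [fold_left_eq_rot]
    rcases le_total v a with hva | hva
    · rw [foldEndLeft_le hva]
      simp only [rot, fold_right_x_of_le hva]
      rw [h.pos v hv, h.pos a (by omega)]; ring
    · rw [foldEndLeft_ge hva]
      simp only [rot, fold_right_x_of_ge hva]
      rw [h.pos v hv, h.pos a (by omega)]; ring

theorem Realizes.foldEndRight (h : S.Realizes n τ A z c κ) (hz : Spread n τ f A z)
    (hτ : ∀ d ∈ A, (τ d = 1 ∨ τ d = -1) ∧ (lab d = 0 ∨ lab d = τ d)) {a : ℕ} (ha : a ∈ A) :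
    ∃ S', Step n lab S S' ∧ S'.Realizes n τ (A.erase a) (foldEndRight z a) c κ := by
  obtain ⟨up, hup⟩ := exists_dirSign (hτ a ha).1 (S.eq_heading a)
  obtain ⟨ha1, han⟩ := hz.mem a ha
  refine ⟨S.fold a true up, ⟨a, true, up, canFold_of_separate _ _ ha1 han ?_ (h.separate hz ha),
    by rw [hup]; exact (hτ a ha).2, rfl⟩, h.sign, fun v hv => ?_, h.turn_fold hup⟩
  · rw [h.turn a ha1 han]; exact if_pos ha
  · rcases le_total v a with hva | hva
    · rw [foldEndRight_le hva, fold_right_x_of_le hva, h.pos v hv]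
    · rw [foldEndRight_ge hva, fold_right_x_of_ge hva, h.pos v hv, h.pos a (by omega)]; ring

/-- The crimp consists of two one-layer folds: the part right of `b` goes to one side, then the part
left of `a` to the other. These folds fix the middle piece, whereas `crimp` fixes the left piece;
this is the reason for the reflection `-κ` and the new offset. -/
theorem Realizes.crimp (h : S.Realizes n τ A z c κ) (hz : Spread n τ f A z)
    (hf : ∀ v ≤ n, f v ≠ f (v + 1))
    (hτ : ∀ d ∈ A, (τ d = 1 ∨ τ d = -1) ∧ (lab d = 0 ∨ lab d = τ d)) {a b : ℕ} (ha : a ∈ A)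
    (hb : b ∈ A) (hab : a < b) (hsum : τ a + τ b = 0) :
    ∃ S₁ S', Step n lab S S₁ ∧ Step n lab S₁ S' ∧
      S'.Realizes n τ ((A.erase a).erase b) (crimp z a b) (c + 2 * κ * z a) (-κ) := by
  obtain ⟨up, hup⟩ := exists_dirSign (hτ b hb).1 (S.eq_heading b)
  obtain ⟨ha1, han⟩ := hz.mem a ha
  obtain ⟨hb1, hbn⟩ := hz.mem b hb
  have hup' : dirSign (!up) * (S.fold b true up).heading a = τ a := by
    rw [heading_fold_right_of_lt hab, h.heading_eq hz hf ha, dirSign_not]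
    rw [h.heading_eq hz hf hb] at hup
    linarith
  have hsep := h.separate hz ha
  have hturn₁ := h.turn_fold (r := true) hup
  refine ⟨S.fold b true up, (S.fold b true up).fold a false (!up), ⟨b, true, up,
    canFold_of_separate _ _ hb1 hbn ?_ (h.separate hz hb), by rw [hup]; exact (hτ b hb).2, rfl⟩,
    ⟨a, false, !up, ⟨ha1, han, ?_, ?_, ?_⟩, by rw [hup']; exact (hτ a ha).2, rfl⟩, ?_,
    fun v hv => ?_, fun v hv1 hvn => ?_⟩
  · rw [h.turn b hb1 hbn]; exact if_pos hb
  · rw [hturn₁ a ha1 han]; exact if_pos (Finset.mem_erase.2 ⟨hab.ne, ha⟩)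
  · have hl : ∀ v, VertexMoves a false v → v ≤ a := fun v hv => by
      simpa [VertexMoves] using hv
    rcases hsep with ⟨hl', -⟩ | ⟨hl', -⟩
    · refine Or.inr fun v _ hv => ?_
      rw [fold_right_x_of_le ((hl v hv).trans hab.le), fold_right_x_of_le hab.le]
      exact hl' v (hl v hv)
    · refine Or.inl fun v _ hv => ?_
      rw [fold_right_x_of_le ((hl v hv).trans hab.le), fold_right_x_of_le hab.le]
      exact hl' v (hl v hv)
  · intro i hi j hj hmi hmj t hti htj hbl
    simp [SegmentMoves] at hmi hmj
    rcases lt_or_ge j b with hjb | hjb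
    · rw [fold_right_x_of_le (by omega), fold_right_x_of_le (by omega)] at hti htj
      rcases hsep with ⟨hl, hr⟩ | ⟨hl, hr⟩ <;>
      · have a1 := hl i hmi.le
        have a2 := hl (i + 1) hmi
        have a3 := hr j hmj (by omega)
        have a4 := hr (j + 1) (by omega) (by omega)
        rcases hti with hti | hti <;> rcases htj with htj | htj <;>
          linarith [hti.1, hti.2, htj.1, htj.2]
    -- The part already folded at `b` lies on side `up` of everything to its left, so it cannot
    -- block a motion in the opposite direction.
    · rw [blocks_fold_right_cross (by omega) hjb] at hbl
      cases up <;> simp at hbl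
  · rcases h.sign with rfl | rfl <;> simp
  · rw [fold_left_eq_rot]
    rcases le_total v a with hva | hva
    · rw [crimp_le hva]
      simp only [rot, fold_right_x_of_le hva, fold_right_x_of_le hab.le,
        fold_right_x_of_le (hva.trans hab.le)]
      rw [h.pos v hv, h.pos a (by omega)]; push_cast; ring
    · simp only [rot, fold_right_x_of_ge hva, fold_right_x_of_le hab.le]
      rcases le_total v b with hvb | hvb
      · rw [fold_right_x_of_le hvb, crimp_mid hva hvb, h.pos v hv, h.pos a (by omega)]
        push_cast; ring
      · rw [fold_right_x_of_ge hvb, crimp_ge hab hvb, h.pos v hv, h.pos a (by omega),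
          h.pos b (by omega)]
        push_cast; ring
  · have := hturn₁ v hv1 hvn
    by_cases hva : v = a
    · subst hva; simp [fold, offSet, ← hup']
    · rw [show ((S.fold b true up).fold a false (!up)).turn v = (S.fold b true up).turn v from
        Function.update_of_ne hva _ _, this]
      simp [offSet, hva]

/-- A spread paper that satisfies the turning criterion can be folded completely. -/
theorem Realizes.exists_folded (hf : ∀ v ≤ n, f v ≠ f (v + 1)) (hcrit : TurningCriterion n f τ)
    (hτ : ∀ d, 1 ≤ d → d ≤ n → (τ d = 1 ∨ τ d = -1) ∧ (lab d = 0 ∨ lab d = τ d)) :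
    ∀ (m : ℕ) (A : Finset ℕ) (z : ℕ → ℝ) (c : ℝ) (κ : ℤ) (S : ChainState), A.card = m →
      Spread n τ f A z → S.Realizes n τ A z c κ →
      ∃ S', Relation.ReflTransGen (Step n lab) S S' ∧ ∀ v, 1 ≤ v → v ≤ n → S'.turn v ≠ 0 := by
  intro m
  induction m using Nat.strong_induction_on with
  | _ m ih =>
    intro A z c κ S hm hz h
    rcases A.eq_empty_or_nonempty with rfl | hA
    · refine ⟨S, .refl, fun v h1 hn => ?_⟩
      rw [h.turn v h1 hn]
      rcases (hτ v h1 hn).1 with h | h <;> simp [offSet, h]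
    · have hτA : ∀ d ∈ A, (τ d = 1 ∨ τ d = -1) ∧ (lab d = 0 ∨ lab d = τ d) :=
        fun d hd => hτ d (hz.mem d hd).1 (hz.mem d hd).2
      rcases hz.exists_fold hA hf (fun d hd => (hτA d hd).1) hcrit with
        ⟨a, ha, h1, h2⟩ | ⟨a, ha, h1, h2⟩ | ⟨a, ha, b, hb, hab, h1, h2, h3, h4⟩
      · obtain ⟨S', hS', hr⟩ := h.foldEndLeft hz hτA ha
        obtain ⟨S'', hS'', ht⟩ := ih _ (by rw [← hm]; exact Finset.card_erase_lt_of_mem ha) _ _ _ _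
          S' rfl (hz.foldEndLeft ha h1 h2) hr
        exact ⟨S'', .head hS' hS'', ht⟩
      · obtain ⟨S', hS', hr⟩ := h.foldEndRight hz hτA ha
        obtain ⟨S'', hS'', ht⟩ := ih _ (by rw [← hm]; exact Finset.card_erase_lt_of_mem ha) _ _ _ _
          S' rfl (hz.foldEndRight ha h1 h2) hr
        exact ⟨S'', .head hS' hS'', ht⟩
      · obtain ⟨S₁, S', hS₁, hS', hr⟩ := h.crimp hz hf hτA ha hb hab h2
        have hcard : ((A.erase a).erase b).card < m := by
          rw [← hm]
          exact (Finset.card_le_card (Finset.erase_subset _ _)).trans_lt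
            (Finset.card_erase_lt_of_mem ha)
        obtain ⟨S'', hS'', ht⟩ := ih _ hcard _ _ _ _ S' rfl (hz.crimp ha hb hab h1 h2 h3 h4) hr
        exact ⟨S'', .head hS₁ (.head hS' hS''), ht⟩

end

end ChainState

/-! ### Equivalence of foldability with the turning criterion -/

theorem spread_unfolded {n : ℕ} (τ : ℕ → ℤ) (y : ℕ → ℝ) (hy : ∀ v ≤ n, y v < y (v + 1)) :
    Spread n τ (flatPos y) (Finset.Icc 1 n) y := by
  have hmono : ∀ i j, i ≤ j → j ≤ n + 1 → y i ≤ y j := by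
    intro i j hij
    induction j, hij using Nat.le_induction with
    | base => exact fun _ => le_rfl
    | succ j hij ih => exact fun hj => (ih (by omega)).trans (hy j (by omega)).le
  have hzero : ∀ p q, q ≤ n + 1 → ∑ v ∈ Finset.Ioo p q, offSet (Finset.Icc 1 n) τ v = 0 := by
    intro p q hq
    refine Finset.sum_eq_zero fun v hv => if_pos ?_
    rw [Finset.mem_Ioo] at hv
    rw [Finset.mem_Icc]; omega
  refine ⟨fun c hc => by simpa using hc, fun c hc v hv => hmono v c hv ?_,
    fun c hc v hv hvn => hmono c v hv hvn, ⟨fun v => (-1) ^ v, fun v hv => ⟨?_, ?_⟩, fun v hv => ?_⟩,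
    fun c hc c' hc' _ => hzero _ _ ?_, fun c hc p _ _ => hzero _ _ ?_,
    fun c hc q _ hq _ => hzero _ _ hq⟩
  · have := (Finset.mem_Icc.1 hc).2; omega
  · exact neg_one_pow_eq_or ℝ v
  · simp [flatPos]
  · simp only [if_pos (Finset.mem_Icc.2 ⟨show 1 ≤ v + 1 by omega, show v + 1 ≤ n by omega⟩), pow_succ]
    ring
  · have := (Finset.mem_Icc.1 hc').2; omega
  · have := (Finset.mem_Icc.1 hc).2; omega

/-- Some assignment that extends the given one satisfies the turning criterion. -/
def Assignable {α : Type*} [LT α] (n : ℕ) (lab : ℕ → ℤ) (f : ℕ → α) : Prop :=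
  ∃ τ : ℕ → ℤ, (∀ v, 1 ≤ v → v ≤ n → (τ v = 1 ∨ τ v = -1) ∧ (lab v = 0 ∨ lab v = τ v)) ∧
    TurningCriterion n f τ

theorem oneLayerSimpleFold_toChain {n : ℕ} {P : MixedCreasePattern n} {s s' : FoldedState n}
    (h : OneLayerSimpleFold P s s') : ChainState.Step n (atCrease P.label) s.toChain s'.toChain := by
  rw [oneLayerSimpleFold_iff] at h
  obtain ⟨k, part, dir, h1, h2, rfl⟩ := h
  exact ⟨k + 1, _, _, h1, by rw [atCrease_succ]; exact h2, toChain_rotate _ _ _ _⟩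

theorem exists_oneLayerSimpleFold {n : ℕ} {P : MixedCreasePattern n} {s : FoldedState n}
    {S' : ChainState} (h : ChainState.Step n (atCrease P.label) s.toChain S') :
    ∃ s', OneLayerSimpleFold P s s' ∧ s'.toChain = S' := by
  obtain ⟨d, r, up, h1, h2, rfl⟩ := h
  obtain ⟨k, rfl⟩ : ∃ k : Fin n, d = k + 1 := ⟨⟨d - 1, by have := h1.one_le; have := h1.le; omega⟩,
    by have := h1.one_le; simp; omega⟩
  obtain ⟨part, rfl⟩ : ∃ part : PaperPart, r = part.isRight := by
    cases r; exacts [⟨.left, rfl⟩, ⟨.right, rfl⟩]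
  obtain ⟨dir, rfl⟩ : ∃ dir : FoldDirection, up = dir.isUp := by
    cases up; exacts [⟨.down, rfl⟩, ⟨.up, rfl⟩]
  refine ⟨s.rotate k part dir, ?_, toChain_rotate _ _ _ _⟩
  rw [oneLayerSimpleFold_iff]
  exact ⟨k, part, dir, h1, by rw [← atCrease_succ]; exact h2, rfl⟩

theorem folded_ne_none_iff {n : ℕ} (s : FoldedState n) :
    (∀ k, s.folded k ≠ none) ↔ ∀ v, 1 ≤ v → v ≤ n → s.toChain.turn v ≠ 0 := by
  constructor
  · intro h v h1 hn h0
    simp only [FoldedState.toChain, atCrease, h1, hn, and_self, dif_pos, typeSign_eq_zero] at h0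
    exact h _ h0
  · intro h k h0
    refine h (k + 1) (by omega) (by omega) ?_
    simp [FoldedState.toChain, atCrease_succ, typeSign_eq_zero, h0]

/-- A crease pattern can be folded by one-layer simple folds if and only if its assignment can be
completed to one that satisfies the turning criterion. -/
theorem oneLayerFoldable_iff_assignable {n : ℕ} (P : MixedCreasePattern n) :
    P.OneLayerFoldable ↔
      Assignable n (atCrease P.label) (flatPos fun v => P.vertex (clampFin (n + 1) v)) := by
  set y : ℕ → ℝ := fun v => P.vertex (clampFin (n + 1) v) with hy
  have hmono : ∀ v ≤ n, y v < y (v + 1) := fun v hv => P.strictMono_vertex (by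
    simp only [clampFin, Fin.lt_def]; omega)
  have hx : P.unfolded.toChain.x = y := rfl
  have ht : ∀ v, P.unfolded.toChain.turn v = 0 := fun v => by
    simp [FoldedState.toChain, atCrease, MixedCreasePattern.unfolded, typeSign]
  have hℓ : ∀ k ≤ n, 0 < y (k + 1) - y k := fun k hk => sub_pos.2 (hmono k hk)
  constructor
  · rintro ⟨s, hs, hall⟩
    have key : s.toChain.Valid n (fun k => y (k + 1) - y k) ∧ ∀ v, 1 ≤ v → v ≤ n →
        s.toChain.turn v = 0 ∨ ((s.toChain.turn v = 1 ∨ s.toChain.turn v = -1) ∧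
          (atCrease P.label v = 0 ∨ atCrease P.label v = s.toChain.turn v)) := by
      clear hall
      induction hs with
      | refl =>
        exact ⟨ChainState.valid_of_strictMono (S := P.unfolded.toChain) hmono
          (fun i j => by simp [FoldedState.toChain, MixedCreasePattern.unfolded]) ht,
          fun v _ _ => Or.inl (ht v)⟩
      | @tail t _ _ hstep ih =>
        obtain ⟨d, r, up, h1, h2, h3⟩ := oneLayerSimpleFold_toChain hstep
        rw [h3]
        refine ⟨ih.1.fold hℓ h1, fun v hv hvn => ?_⟩
        by_cases hvd : v = d
        · subst hvd
          right
          simp only [ChainState.fold, Function.update_self]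
          refine ⟨?_, h2⟩
          rcases ChainState.eq_heading t.toChain v with h | h <;> cases up <;> simp [dirSign, h]
        · simp only [ChainState.fold, Function.update_of_ne hvd]
          exact ih.2 v hv hvn
    rw [folded_ne_none_iff] at hall
    refine ⟨s.toChain.turn, fun v h1 hn => (key.2 v h1 hn).resolve_left (hall v h1 hn), ?_⟩
    refine (key.1.turningCriterion hℓ).of_affine (c := s.toChain.x 0) ?_
      (key.1.x_eq_flatPos fun k hk => hall (k + 1) (by omega) hk)
    rcases s.toChain.eq_heading 0 with h | h <;> simp [h]
  · rintro ⟨τ, hτ, hcrit⟩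
    have hf : ∀ v ≤ n, flatPos y v ≠ flatPos y (v + 1) := by
      intro v hv he
      have := hℓ v hv
      simp only [flatPos] at he
      rcases neg_one_pow_eq_or ℝ v with h | h <;> rw [h] at he <;> linarith
    obtain ⟨S', hS', hall⟩ := ChainState.Realizes.exists_folded hf hcrit hτ _ (Finset.Icc 1 n) y 0 1
      P.unfolded.toChain rfl (spread_unfolded τ y hmono)
      ⟨Or.inl rfl, fun v _ => by rw [hx]; simp, fun v h1 hn => by
        rw [ht, offSet, if_pos (Finset.mem_Icc.2 ⟨h1, hn⟩)]⟩
    obtain ⟨s, hs, rfl⟩ : ∃ s, Relation.ReflTransGen (OneLayerSimpleFold P) P.unfolded s ∧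
        s.toChain = S' := by
      clear hall
      induction hS' with
      | refl => exact ⟨_, .refl, rfl⟩
      | tail _ hstep ih =>
        obtain ⟨s, hs, rfl⟩ := ih
        obtain ⟨s', hs', h⟩ := exists_oneLayerSimpleFold hstep
        exact ⟨s', hs.tail hs', h⟩
    exact ⟨s, hs, (folded_ne_none_iff s).2 hall⟩

/-! ## Verifying RAM programs -/

namespace RAM

/-- All cells hold numbers of at most `b` bits. -/
def Bounded (b : ℕ) (m : Memory) : Prop := ∀ a, |m a| ≤ 2 ^ b

/-- The values of an expression are at most `weight` times as large as the contents of the cells. -/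
def Expr.weight : Expr → ℕ
  | const c => c.natAbs
  | cell a => a.weight + 1
  | add a b => a.weight + b.weight
  | sub a b => a.weight + b.weight

def Expr.nodes : Expr → ℕ
  | const _ => 1
  | cell a => a.nodes + 1
  | add a b => a.nodes + b.nodes + 1
  | sub a b => a.nodes + b.nodes + 1

/-- The cost of an expression, in units of the number of bits of the cells. -/
def Expr.units (e : Expr) : ℕ := e.nodes * (e.weight + 1)

theorem Expr.abs_eval_le {b : ℕ} {m : Memory} (hm : Bounded b m) (e : Expr) :
    |e.eval m| ≤ e.weight * 2 ^ b := by
  have h1 : (1 : ℤ) ≤ 2 ^ b := one_le_pow₀ (by norm_num)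
  induction e with
  | const c =>
    simp only [eval, weight, Int.natCast_natAbs]
    nlinarith [abs_nonneg c]
  | cell a _ =>
    simp only [eval, weight]
    push_cast
    have := hm (a.eval m)
    have : (0 : ℤ) ≤ a.weight * 2 ^ b := by positivity
    linarith [hm (a.eval m)]
  | add x y hx hy =>
    simp only [eval, weight]
    push_cast
    linarith [abs_add_le (x.eval m) (y.eval m)]
  | sub x y hx hy =>
    simp only [eval, weight]
    push_cast
    linarith [abs_sub (x.eval m) (y.eval m)]

/-- The factor `w` is charged `w` bits because `w < 2 ^ w`. This is crude but harmless, since `w`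
will be a constant of the program. -/
theorem bitLength_le {z : ℤ} {w b : ℕ} (h : |z| ≤ w * 2 ^ b) : bitLength z ≤ (w + 1) * (b + 1) := by
  have h1 : z.natAbs ≤ w * 2 ^ b := by
    zify; exact h
  have h2 : z.natAbs.size ≤ w + b := by
    rw [Nat.size_le, pow_add]
    exact h1.trans_lt (Nat.mul_lt_mul_of_pos_right Nat.lt_two_pow_self (by positivity))
  unfold bitLength
  nlinarith

theorem Expr.cost_le {b : ℕ} {m : Memory} (hm : Bounded b m) (e : Expr) :
    e.cost m ≤ e.units * (b + 1) := by
  have key : ∀ e : Expr, bitLength (e.eval m) ≤ (e.weight + 1) * (b + 1) :=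
    fun e => bitLength_le (e.abs_eval_le hm)
  have : e.cost m ≤ e.nodes * ((e.weight + 1) * (b + 1)) := by
    induction e with
    | const c => simpa [cost, nodes, eval] using key (const c)
    | cell a ih =>
      have h1 := key (cell a)
      have h2 : a.nodes * ((a.weight + 1) * (b + 1)) ≤
          a.nodes * (((cell a).weight + 1) * (b + 1)) := by
        gcongr; simp [weight]
      simp only [cost, nodes]
      linarith
    | add x y hx hy =>
      have h1 := key (add x y)
      have h2 : x.nodes * ((x.weight + 1) * (b + 1)) ≤
          x.nodes * (((add x y).weight + 1) * (b + 1)) := by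
        gcongr; simp [weight]
      have h3 : y.nodes * ((y.weight + 1) * (b + 1)) ≤
          y.nodes * (((add x y).weight + 1) * (b + 1)) := by
        gcongr; simp [weight]
      simp only [cost, nodes]
      linarith
    | sub x y hx hy =>
      have h1 := key (sub x y)
      have h2 : x.nodes * ((x.weight + 1) * (b + 1)) ≤
          x.nodes * (((sub x y).weight + 1) * (b + 1)) := by
        gcongr; simp [weight]
      have h3 : y.nodes * ((y.weight + 1) * (b + 1)) ≤
          y.nodes * (((sub x y).weight + 1) * (b + 1)) := by
        gcongr; simp [weight]
      simp only [cost, nodes]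
      linarith
  rw [units, mul_assoc]; exact this

/-- Started on `m`, the program halts after at most `k` units of time in a memory with property
`Q`. -/
def Ends (b : ℕ) (p : Program) (m : Memory) (k : ℕ) (Q : Memory → Prop) : Prop :=
  ∃ m' t, Runs p m m' t ∧ t ≤ k * (b + 1) ∧ Q m'

/-- The running time of a program without loops. -/
def Program.units : Program → ℕ
  | skip => 1
  | assign a e => a.units + e.units
  | seq p q => p.units + q.units
  | ifPos e p q => e.units + p.units + q.units
  | whilePos e p => e.units + p.units

section

variable {b : ℕ} {m : Memory} {Q Q' : Memory → Prop}

theorem Ends.mono {p : Program} {k k' : ℕ} (h : Ends b p m k Q) (hk : k ≤ k')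
    (hQ : ∀ m, Q m → Q' m) : Ends b p m k' Q' := by
  obtain ⟨m', t, h1, h2, h3⟩ := h
  exact ⟨m', t, h1, h2.trans (Nat.mul_le_mul_right _ hk), hQ _ h3⟩

theorem Ends.imp {p : Program} {k : ℕ} (h : Ends b p m k Q) (hQ : ∀ m, Q m → Q' m) :
    Ends b p m k Q' := h.mono le_rfl hQ

theorem ends_skip (h : Q m) : Ends b .skip m Program.skip.units Q :=
  ⟨m, 1, .skip m, by simp [Program.units], h⟩

theorem ends_assign (hm : Bounded b m) {a e : Expr}
    (h : Q (Function.update m (a.eval m) (e.eval m))) :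
    Ends b (.assign a e) m (Program.assign a e).units Q :=
  ⟨_, _, .assign a e m, by
    have := a.cost_le hm
    have := e.cost_le hm
    rw [Program.units, add_mul]; omega, h⟩

theorem ends_seq {p q : Program} {k₁ k₂ : ℕ}
    (h : Ends b p m k₁ fun m' => Ends b q m' k₂ Q) : Ends b (.seq p q) m (k₁ + k₂) Q := by
  obtain ⟨m', t, h1, h2, m'', t', h3, h4, h5⟩ := h
  exact ⟨m'', t + t', .seq h1 h3, by rw [add_mul]; omega, h5⟩

theorem ends_ifPos (hm : Bounded b m) {e : Expr} {p q : Program}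
    (hp : 0 < e.eval m → Ends b p m p.units Q) (hq : e.eval m ≤ 0 → Ends b q m q.units Q) :
    Ends b (.ifPos e p q) m (Program.ifPos e p q).units Q := by
  have hc := e.cost_le hm
  simp only [Program.units]
  by_cases h : 0 < e.eval m
  · obtain ⟨m', t, h1, h2, h3⟩ := hp h
    refine ⟨m', _, .ifPos_true h h1, ?_, h3⟩
    rw [add_mul, add_mul]; omega
  · obtain ⟨m', t, h1, h2, h3⟩ := hq (not_lt.1 h)
    refine ⟨m', _, .ifPos_false h h1, ?_, h3⟩
    rw [add_mul, add_mul]; omega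

/-- The invariant is indexed by the exact number of passes still to be made, so a single induction
gives termination and the time bound; the last summand pays for the final failing test. -/
theorem ends_whilePos {e : Expr} {p : Program} {u : ℕ} (Inv : ℕ → Memory → Prop)
    (hb : ∀ k m, Inv k m → Bounded b m) (h0 : ∀ m, Inv 0 m → e.eval m ≤ 0)
    (hs : ∀ k m, Inv (k + 1) m → 0 < e.eval m ∧ Ends b p m u (Inv k)) (k : ℕ) (h : Inv k m) :
    Ends b (.whilePos e p) m (k * (e.units + u) + e.units) (Inv 0) := by
  induction k generalizing m with
  | zero =>
    refine ⟨m, e.cost m, by constructor; exact (h0 m h).not_gt, ?_, h⟩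
    simpa using e.cost_le (hb 0 m h)
  | succ k ih =>
    obtain ⟨hpos, m', t, h1, h2, h3⟩ := hs k m h
    obtain ⟨m'', t', h4, h5, h6⟩ := ih h3
    refine ⟨m'', _, .whilePos_step hpos h1 h4, ?_, h6⟩
    have hc := e.cost_le (hb _ m h)
    calc e.cost m + t + t' ≤ e.units * (b + 1) + u * (b + 1)
        + (k * (e.units + u) + e.units) * (b + 1) := by omega
      _ = ((k + 1) * (e.units + u) + e.units) * (b + 1) := by ring

end

end RAM

/-! ## Solving the turning criterion by relaxation

The unknowns are the sums `S v` of the assignment of the creases up to vertex `v`. -/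

namespace Relaxation

/-- The sums respect the label of vertex `v` (`2` for valley, `1` for mountain). -/
def LabelOK (L S : ℕ → ℤ) (v : ℕ) : Prop :=
  (L (v + 1) = 2 → S v + 1 ≤ S (v + 1)) ∧ (L (v + 1) = 1 → S (v + 1) + 1 ≤ S v)

/-- The sums satisfy the turning criterion at `p` and `q`. -/
def PairOK (F S : ℕ → ℤ) (p q : ℕ) : Prop :=
  VertexExtreme F p q p → VertexExtreme F p q q → S (q - 1) ≤ S p + 1 ∧ S p ≤ S (q - 1) + 1

/-- All constraints hold. -/
def AllOK (n : ℕ) (F L S : ℕ → ℤ) : Prop :=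
  ∀ p < n, LabelOK L S p ∧ ∀ q, p + 2 ≤ q → q ≤ n + 1 → PairOK F S p q

/-- `S` is a solution with the parity and the size of the sums of an assignment. -/
structure Solution (n : ℕ) (F L S : ℕ → ℤ) : Prop where
  parity : ∀ v ≤ n, Even (S v - v)
  lower : ∀ v ≤ n, -(v : ℤ) ≤ S v
  upper : ∀ v ≤ n, S v ≤ v
  ok : AllOK n F L S

/-- Prefix sums of a valid assignment serve as the solution: the sum strictly between `p` and `q` is
the difference of the prefix sums at `q - 1` and `p`. -/
theorem exists_solution_of_assignable {n : ℕ} {F L lab : ℕ → ℤ}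
    (hL : ∀ v, 1 ≤ v → v ≤ n → (L v = 2 → lab v = 1) ∧ (L v = 1 → lab v = -1))
    (h : Assignable n lab F) : ∃ S, Solution n F L S := by
  obtain ⟨τ, hτ, hcrit⟩ := h
  have hs : ∀ v, ∑ k ∈ Finset.Ioc 0 (v + 1), τ k = ∑ k ∈ Finset.Ioc 0 v, τ k + τ (v + 1) :=
    fun v => Finset.sum_Ioc_succ_top (by omega) _
  refine ⟨fun v => ∑ k ∈ Finset.Ioc 0 v, τ k, fun v => ?_, fun v => ?_, fun v => ?_,
    fun p hp => ⟨?_, fun q hpq hq hep heq => ?_⟩⟩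
  · induction v with
    | zero => simp
    | succ v ih =>
      intro hv
      have h1 := ih (by omega)
      simp only [hs]
      rcases (hτ (v + 1) (by omega) hv).1 with h | h <;> rw [h] <;> push_cast <;>
        rw [Int.even_iff] at h1 ⊢ <;> omega
  · induction v with
    | zero => simp
    | succ v ih =>
      intro hv
      have h1 := ih (by omega)
      simp only [hs]
      rcases (hτ (v + 1) (by omega) hv).1 with h | h <;> rw [h] <;> push_cast <;> omega
  · induction v with
    | zero => simp
    | succ v ih =>
      intro hv
      have h1 := ih (by omega)
      simp only [hs]
      rcases (hτ (v + 1) (by omega) hv).1 with h | h <;> rw [h] <;> push_cast <;> omega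
  · have h1 := hL (p + 1) (by omega) hp
    have h2 := hτ (p + 1) (by omega) hp
    simp only [LabelOK, hs]
    constructor
    · intro h; have := h1.1 h; omega
    · intro h; have := h1.2 h; omega
  · have h1 := hcrit p q (by omega) hq hep heq
    rw [ChainState.Ioo_eq_Ioc (by omega), abs_le] at h1
    have h2 := Finset.sum_Ioc_consecutive τ (Nat.zero_le p) (show p ≤ q - 1 by omega)
    simp only
    omega

/-- Only differences of the unknowns matter, so neither `S 0 = 0` nor the size bounds are needed.
Parity alone turns steps of size at most one into signs. -/
theorem assignable_of_allOK {n : ℕ} {F L lab S : ℕ → ℤ}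
    (hL : ∀ v, 1 ≤ v → v ≤ n → lab v = 0 ∨ (L v = 2 ∧ lab v = 1) ∨ (L v = 1 ∧ lab v = -1))
    (hF : ∀ v ≤ n, F v ≠ F (v + 1)) (hpar : ∀ v ≤ n, Even (S v - v)) (h : AllOK n F L S) :
    Assignable n lab F := by
  have hsum : ∀ p q, p ≤ q → ∑ v ∈ Finset.Ioc p q, (S v - S (v - 1)) = S q - S p := by
    intro p q hpq
    induction q, hpq using Nat.le_induction with
    | base => simp
    | succ q hpq ih => rw [Finset.sum_Ioc_succ_top (by omega), ih, Nat.add_sub_cancel]; ring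
  refine ⟨fun v => S v - S (v - 1), fun v h1 hn => ?_, fun p q hpq hq hep heq => ?_⟩
  · obtain ⟨p, rfl⟩ : ∃ p, v = p + 1 := ⟨v - 1, by omega⟩
    obtain ⟨h2, h3⟩ := h p (by omega)
    simp only [Nat.add_sub_cancel]
    -- Between `p` and `p + 2` there is only one vertex, so both ends are extreme and the pair
    -- constraint bounds the single step from `S p` to `S (p + 1)`.
    have h4 : ∀ r, F r ≠ F (p + 1) → VertexExtreme F p (p + 2) r := by
      intro r hr
      rcases lt_or_gt_of_ne hr with hr | hr
      · exact Or.inl fun v hv hv' => by rw [show v = p + 1 by omega]; exact hr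
      · exact Or.inr fun v hv hv' => by rw [show v = p + 1 by omega]; exact hr
    have h5 := h3 (p + 2) le_rfl (by omega) (h4 p (hF p (by omega)))
      (h4 (p + 2) (hF (p + 1) hn).symm)
    rw [show p + 2 - 1 = p + 1 by omega] at h5
    have h6 := hpar p (by omega)
    have h7 := hpar (p + 1) hn
    rw [Int.even_iff] at h6 h7
    push_cast at h7
    obtain ⟨h8, h9⟩ := h2
    refine ⟨by omega, ?_⟩
    rcases hL (p + 1) h1 hn with h10 | ⟨h10, h11⟩ | ⟨h10, h11⟩
    · exact Or.inl h10
    · have := h8 h10; right; omega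
    · have := h9 h10; right; omega
  · rw [ChainState.Ioo_eq_Ioc hpq, hsum p (q - 1) (by omega), abs_le]
    rcases (show p + 1 = q ∨ p + 2 ≤ q by omega) with rfl | hpq'
    · simp
    · have := (h p (by omega)).2 q hpq' hq hep heq
      omega

/-- Lower the sum at `x` by two, unless it is too small already. -/
def lowerAt (n : ℕ) (S : ℕ → ℤ) (x : ℕ) : ℕ → ℤ :=
  if 0 < S x + n then Function.update S x (S x - 2) else S

/-- Parity and size of the sums that occur. -/
def Good (n : ℕ) (S : ℕ → ℤ) : Prop := ∀ v ≤ n, Even (S v - v) ∧ -(n : ℤ) - 2 ≤ S v ∧ S v ≤ v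

/-- A step of two preserves parity, and the guard admits only values above `-n`, so the numbers stay
small even if there is no solution. -/
theorem Good.lowerAt {n : ℕ} {S : ℕ → ℤ} (h : Good n S) (x : ℕ) : Good n (lowerAt n S x) := by
  intro v hv
  have h1 := h v hv
  unfold Relaxation.lowerAt
  split_ifs with h2
  · by_cases hvx : v = x
    · subst hvx
      rw [Function.update_self]
      rw [Int.even_iff] at h1 ⊢
      omega
    · rwa [Function.update_of_ne hvx]
  · exact h1

/-- A constraint is violated and can be repaired only by lowering the sum at `x`. -/
structure Violated (n : ℕ) (F L S : ℕ → ℤ) (x : ℕ) : Prop where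
  le : x ≤ n
  not_ok : ¬ AllOK n F L S
  lt : ∀ sol, Solution n F L sol → (∀ v ≤ n, sol v ≤ S v) → sol x < S x

/-- The state of a round that started with `S₀` and has checked the constraints `D`. -/
def Progress (n : ℕ) (F L S₀ : ℕ → ℤ) (D : Prop) (S : ℕ → ℤ) (flag : ℤ) : Prop :=
  (flag = 0 ∧ S = S₀ ∧ D) ∨
    (flag = 1 ∧ ¬ AllOK n F L S₀ ∧ ∀ sol, Solution n F L sol → (∀ v ≤ n, sol v ≤ S₀ v) →
      (∀ v ≤ n, sol v ≤ S v) ∧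
        ∑ v ∈ Finset.range (n + 1), S v < ∑ v ∈ Finset.range (n + 1), S₀ v)

/-- The effect of one relaxation step for a constraint `ok`. -/
def Relaxes (n : ℕ) (F L : ℕ → ℤ) (ok : Prop) (S : ℕ → ℤ) (flag : ℤ) (S' : ℕ → ℤ) (flag' : ℤ) :
    Prop :=
  (ok ∧ S' = S ∧ flag' = flag) ∨ (flag' = 1 ∧ ∃ x, Violated n F L S x ∧ S' = lowerAt n S x)

theorem Relaxes.good {n : ℕ} {F L : ℕ → ℤ} {ok : Prop} {S S' : ℕ → ℤ} {flag flag' : ℤ}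
    (h : Relaxes n F L ok S flag S' flag') (hS : Good n S) : Good n S' := by
  rcases h with ⟨-, rfl, -⟩ | ⟨-, x, -, rfl⟩
  · exact hS
  · exact hS.lowerAt x

/-- A solution lying below the current sums is strictly below at the violated place, hence by at
least two because of parity. It therefore remains below after the lowering, which strictly decreases
the total. -/
theorem Progress.relax {n : ℕ} {F L S₀ : ℕ → ℤ} {D D' ok : Prop} {S S' : ℕ → ℤ} {flag flag' : ℤ}
    (h : Progress n F L S₀ D S flag) (hS : Good n S) (hr : Relaxes n F L ok S flag S' flag')
    (hD : S = S₀ → D → ok → D') : Progress n F L S₀ D' S' flag' := by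
  rcases hr with ⟨hok, rfl, rfl⟩ | ⟨rfl, x, hx, rfl⟩
  · rcases h with ⟨h1, h2, h3⟩ | h
    · exact Or.inl ⟨h1, h2, hD h2 h3 hok⟩
    · exact Or.inr h
  · right
    have key : ∀ sol, Solution n F L sol → (∀ v ≤ n, sol v ≤ S v) →
        (∀ v ≤ n, sol v ≤ lowerAt n S x v) ∧ ∑ v ∈ Finset.range (n + 1), lowerAt n S x v <
          ∑ v ∈ Finset.range (n + 1), S v := by
      intro sol hsol hle
      have h1 := hx.lt sol hsol hle
      have h2 := hsol.parity x hx.le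
      have h3 := (hS x hx.le).1
      have h4 := hsol.lower x hx.le
      have hxn := hx.le
      rw [Int.even_iff] at h2 h3
      -- The guard is open: the solution is at least `-x` here, and the current sum is strictly
      -- larger.
      have h5 : lowerAt n S x = Function.update S x (S x - 2) := if_pos (by omega)
      rw [h5]
      have h6 : ∀ v ≤ n, sol v ≤ Function.update S x (S x - 2) v := by
        intro v hv
        by_cases hvx : v = x
        · subst hvx; rw [Function.update_self]; omega
        · rw [Function.update_of_ne hvx]; exact hle v hv
      refine ⟨h6, Finset.sum_lt_sum (fun v _ => ?_) ⟨x, Finset.mem_range.2 (by omega), ?_⟩⟩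
      · by_cases hvx : v = x
        · subst hvx; rw [Function.update_self]; omega
        · rw [Function.update_of_ne hvx]
      · rw [Function.update_self]; omega
    rcases h with ⟨-, rfl, -⟩ | ⟨-, h2, h3⟩
    · exact ⟨rfl, hx.not_ok, key⟩
    · refine ⟨rfl, h2, fun sol hsol hle => ?_⟩
      obtain ⟨h4, h5⟩ := h3 sol hsol hle
      obtain ⟨h6, h7⟩ := key sol hsol h4
      exact ⟨h6, h7.trans h5⟩

/-- The state after some rounds, `k` of `(n + 1) ^ 2` remaining. -/
def Rounds (n : ℕ) (F L : ℕ → ℤ) (k : ℕ) (S : ℕ → ℤ) (flag : ℤ) : Prop :=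
  (flag = 0 ∧ AllOK n F L S) ∨
    ((flag = 1 ∨ k = (n + 1) * (n + 1)) ∧ ∀ sol, Solution n F L sol → (∀ v ≤ n, sol v ≤ S v) ∧
      ∑ v ∈ Finset.range (n + 1), S v + ((n + 1) * (n + 1) : ℤ) ≤
        ∑ v ∈ Finset.range (n + 1), (v : ℤ) + k)

theorem Rounds.init (n : ℕ) (F L : ℕ → ℤ) (flag : ℤ) {S : ℕ → ℤ} (hS : ∀ v ≤ n, S v = v) :
    Rounds n F L ((n + 1) * (n + 1)) S flag := by
  refine Or.inr ⟨Or.inr rfl, fun sol hsol => ⟨fun v hv => ?_, ?_⟩⟩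
  · rw [hS v hv]; exact hsol.upper v hv
  · rw [Finset.sum_congr rfl fun v hv => hS v (by rw [Finset.mem_range] at hv; omega)]
    push_cast; rfl

/-- A round that raises the flag began with a violated constraint, so satisfied sums are never
spoiled. Until they are reached, the total drops by at least one per round, provided that a solution
exists. -/
theorem Rounds.round {n : ℕ} {F L S₀ S : ℕ → ℤ} {k : ℕ} {flag flag' : ℤ}
    (h : Rounds n F L (k + 1) S₀ flag)
    (hp : Progress n F L S₀ (AllOK n F L S₀) S flag') : Rounds n F L k S flag' := by
  rcases hp with ⟨h1, rfl, h3⟩ | ⟨h1, h2, h3⟩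
  · exact Or.inl ⟨h1, h3⟩
  · rcases h with ⟨-, h⟩ | ⟨-, h⟩
    · exact absurd h h2
    · refine Or.inr ⟨Or.inl h1, fun sol hsol => ?_⟩
      obtain ⟨h4, h5⟩ := h sol hsol
      obtain ⟨h6, h7⟩ := h3 sol hsol h4
      push_cast at h5
      exact ⟨h6, by linarith⟩

/-- Between the starting values `v` and the lower bounds `-v` of a solution the total can drop by at
most `n * (n + 1)`, which is less than the number of rounds. A flag that is still set therefore
excludes a solution. -/
theorem Rounds.final {n : ℕ} {F L S : ℕ → ℤ} {flag : ℤ} (h : Rounds n F L 0 S flag) :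
    (flag = 0 ∧ AllOK n F L S) ∨ (flag = 1 ∧ ¬ ∃ sol, Solution n F L sol) := by
  rcases h with h | ⟨h1, h2⟩
  · exact Or.inl h
  · refine Or.inr ⟨h1.resolve_right (by positivity), ?_⟩
    rintro ⟨sol, hsol⟩
    obtain ⟨h3, h4⟩ := h2 sol hsol
    have h5 : ∑ v ∈ Finset.range (n + 1), -(v : ℤ) ≤ ∑ v ∈ Finset.range (n + 1), S v :=
      Finset.sum_le_sum fun v hv => by
        have hv' : v ≤ n := by rw [Finset.mem_range] at hv; omega
        exact (hsol.lower v hv').trans (h3 v hv')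
    rw [Finset.sum_neg_distrib] at h5
    have h6 : (∑ v ∈ Finset.range (n + 1), (v : ℤ)) * 2 = (n + 1) * n := by
      have := Finset.sum_range_id_mul_two (n + 1)
      rw [Nat.add_sub_cancel] at this
      rw [← Nat.cast_sum]; exact_mod_cast this
    push_cast at h4
    nlinarith

/-- This and the next three lemmas share one reason: each constraint bounds one sum from above in
terms of another. For a solution below `S` the bounding sum is no larger, so its value at the
bounded place is strictly smaller than that of `S`. -/
theorem violated_of_label_valley {n : ℕ} {F L S : ℕ → ℤ} {p : ℕ} (hp : p < n) (hL : L (p + 1) = 2)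
    (h : S (p + 1) < S p + 1) : Violated n F L S p := by
  refine ⟨hp.le, fun hok => ?_, fun sol hsol hle => ?_⟩
  · have := (hok p hp).1.1 hL; omega
  · have := (hsol.ok p hp).1.1 hL
    have := hle (p + 1) hp
    omega

theorem violated_of_label_mountain {n : ℕ} {F L S : ℕ → ℤ} {p : ℕ} (hp : p < n)
    (hL : L (p + 1) = 1) (h : S p < S (p + 1) + 1) : Violated n F L S (p + 1) := by
  refine ⟨hp, fun hok => ?_, fun sol hsol hle => ?_⟩
  · have := (hok p hp).1.2 hL; omega
  · have := (hsol.ok p hp).1.2 hL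
    have := hle p hp.le
    omega

theorem violated_of_pair_right {n : ℕ} {F L S : ℕ → ℤ} {p q : ℕ} (hp : p < n) (hpq : p + 2 ≤ q)
    (hq : q ≤ n + 1) (h1 : VertexExtreme F p q p) (h2 : VertexExtreme F p q q)
    (h : S p + 1 < S (q - 1)) : Violated n F L S (q - 1) := by
  refine ⟨by omega, fun hok => ?_, fun sol hsol hle => ?_⟩
  · have := (hok p hp).2 q hpq hq h1 h2; omega
  · have := (hsol.ok p hp).2 q hpq hq h1 h2
    have := hle p hp.le
    omega

theorem violated_of_pair_left {n : ℕ} {F L S : ℕ → ℤ} {p q : ℕ} (hp : p < n) (hpq : p + 2 ≤ q)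
    (hq : q ≤ n + 1) (h1 : VertexExtreme F p q p) (h2 : VertexExtreme F p q q)
    (h : S (q - 1) + 1 < S p) : Violated n F L S p := by
  refine ⟨by omega, fun hok => ?_, fun sol hsol hle => ?_⟩
  · have := (hok p hp).2 q hpq hq h1 h2; omega
  · have := (hsol.ok p hp).2 q hpq hq h1 h2
    have := hle (q - 1) (by omega)
    omega

end Relaxation

/-! ## The program -/

namespace RAM

namespace Decider

open RAM.Expr RAM.Program Relaxation

/-- The scalar variable `-a`. -/
abbrev var (a : ℤ) : Expr := cell (const (-a))

/-- The input occupies the nonnegative cells: the number of creases in `0`, the denominator in `1`,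
then the numerators and labels. The scalars are `-1` and `-2` for the vertices `p` and `q`, `-3` for
the remaining rounds, `-4` for the flag, `-5` and `-6` for the range of positions between `p` and
`q`, and `-7` for an alternating sign. Positions and sums are interleaved at the even and odd
addresses from `-20` and `-21` downwards, so that two arrays of unbounded length do not collide. -/
abbrev size : Expr := cell (const 0)
abbrev xCell (v : Expr) : Expr := cell (add v (const 2))
abbrev labelCell (v : Expr) : Expr := cell (add (add size (const 4)) v)
abbrev flatAddr (v : Expr) : Expr := sub (sub (const (-20)) v) v
abbrev sumAddr (v : Expr) : Expr := sub (sub (const (-21)) v) v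
abbrev flatCell (v : Expr) : Expr := cell (flatAddr v)
abbrev sumCell (v : Expr) : Expr := cell (sumAddr v)

/-- The contents of the memory: the input (except for the denominator), the positions `F` in the
completely folded paper and the sums `S`. -/
structure Holds (n : ℕ) (X L : ℕ → ℤ) (b : ℕ) (F S : ℕ → ℤ) (m : Memory) : Prop where
  size_eq : m 0 = n
  x_eq : ∀ v ≤ n + 1, m (v + 2) = X v
  label_eq : ∀ v < n, m (n + 4 + v) = L (v + 1)
  flat_eq : ∀ v ≤ n + 1, m (-20 - v - v) = F v
  sum_eq : ∀ v ≤ n + 1, m (-21 - v - v) = S v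
  bounded : Bounded b m
  room : ((n : ℤ) + 2) * (n + 2) ≤ 2 ^ b

variable {n : ℕ} {X L : ℕ → ℤ} {b : ℕ} {F S : ℕ → ℤ} {m : Memory}

theorem Holds.room' (h : Holds n X L b F S m) : (n : ℤ) + 4 ≤ 2 ^ b := by
  have := h.room; nlinarith

theorem Bounded.update (h : Bounded b m) {x : ℤ} (hx : |x| ≤ 2 ^ b) (a : ℤ) :
    Bounded b (Function.update m a x) := by
  intro c
  rw [Function.update_apply]
  split_ifs
  · exact hx
  · exact h c

theorem Holds.scalar (h : Holds n X L b F S m) {a x : ℤ} (ha : -10 ≤ a) (ha' : a ≤ -1)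
    (hx : |x| ≤ 2 ^ b) : Holds n X L b F S (Function.update m a x) := by
  have key : ∀ c : ℤ, c ≤ -20 ∨ 0 ≤ c → Function.update m a x c = m c := fun c hc =>
    Function.update_of_ne (by omega) _ _
  refine ⟨?_, fun v hv => ?_, fun v hv => ?_, fun v hv => ?_, fun v hv => ?_,
    Bounded.update h.bounded hx a, h.room⟩
  · rw [key _ (by omega)]; exact h.size_eq
  · rw [key _ (by omega)]; exact h.x_eq v hv
  · rw [key _ (by omega)]; exact h.label_eq v hv
  · rw [key _ (by omega)]; exact h.flat_eq v hv
  · rw [key _ (by omega)]; exact h.sum_eq v hv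

theorem Holds.setSum (h : Holds n X L b F S m) (v : ℕ) {x : ℤ} (hx : |x| ≤ 2 ^ b) :
    Holds n X L b F (Function.update S v x) (Function.update m (-21 - v - v) x) := by
  have key : ∀ c : ℤ, c ≠ -21 - v - v → Function.update m (-21 - v - v) x c = m c := fun c hc =>
    Function.update_of_ne hc _ _
  refine ⟨?_, fun w hw => ?_, fun w hw => ?_, fun w hw => ?_, fun w hw => ?_,
    Bounded.update h.bounded hx _, h.room⟩
  · rw [key _ (by omega)]; exact h.size_eq
  · rw [key _ (by omega)]; exact h.x_eq w hw
  · rw [key _ (by omega)]; exact h.label_eq w hw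
  · rw [key _ (by omega)]; exact h.flat_eq w hw
  · by_cases hvw : w = v
    · subst hvw; rw [Function.update_self, Function.update_self]
    · rw [key _ (by omega), Function.update_of_ne hvw]; exact h.sum_eq w hw

theorem Holds.setFlat (h : Holds n X L b F S m) (v : ℕ) {x : ℤ} (hx : |x| ≤ 2 ^ b) :
    Holds n X L b (Function.update F v x) S (Function.update m (-20 - v - v) x) := by
  have key : ∀ c : ℤ, c ≠ -20 - v - v → Function.update m (-20 - v - v) x c = m c := fun c hc =>
    Function.update_of_ne hc _ _
  refine ⟨?_, fun w hw => ?_, fun w hw => ?_, fun w hw => ?_, fun w hw => ?_,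
    Bounded.update h.bounded hx _, h.room⟩
  · rw [key _ (by omega)]; exact h.size_eq
  · rw [key _ (by omega)]; exact h.x_eq w hw
  · rw [key _ (by omega)]; exact h.label_eq w hw
  · by_cases hvw : w = v
    · subst hvw; rw [Function.update_self, Function.update_self]
    · rw [key _ (by omega), Function.update_of_ne hvw]; exact h.flat_eq w hw
  · rw [key _ (by omega)]; exact h.sum_eq w hw

/-- No scalar variable except the flag `-4` has changed. -/
def Frame (m m' : Memory) : Prop := ∀ a, -10 ≤ a → a ≤ -1 → a ≠ -4 → m' a = m a

/-- Set the flag, and lower the sum at `x` by two unless it is too small. -/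
def lower (x : Expr) : Program :=
  .seq (.assign (const (-4)) (const 1))
    (.ifPos (add (sumCell x) size) (.assign (sumAddr x) (sub (sumCell x) (const 2))) .skip)

theorem ends_lower (h : Holds n X L b F S m) (hS : Good n S) {x : Expr} {v : ℕ} (hv : v ≤ n)
    (hx : x.eval (Function.update m (-4) 1) = v) :
    Ends b (lower x) m (lower x).units fun m' =>
      Holds n X L b F (lowerAt n S v) m' ∧ Frame m m' ∧ m' (-4) = 1 := by
  have hroom := h.room'
  have h1 : Holds n X L b F S (Function.update m (-4) 1) :=
    h.scalar (by norm_num) (by norm_num) (by rw [abs_one]; omega)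
  have hs := h1.sum_eq v (by omega)
  have hframe : Frame m (Function.update m (-4) 1) := fun a _ _ h4 => Function.update_of_ne h4 _ _
  refine ends_seq (ends_assign h.bounded ?_)
  simp only [Expr.eval]
  refine ends_ifPos h1.bounded (fun hp => ends_assign h1.bounded ?_) (fun hp => ends_skip ?_)
  · simp only [Expr.eval, hx, hs, h1.size_eq] at hp ⊢
    have hb := hS v hv
    have := h1.setSum v (x := S v - 2) (by rw [abs_le]; omega)
    rw [lowerAt, if_pos hp]
    refine ⟨this, fun a ha ha' h4 => ?_, ?_⟩
    · rw [Function.update_of_ne (by omega), Function.update_of_ne h4]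
    · rw [Function.update_of_ne (by omega), Function.update_self]
  · simp only [Expr.eval, hx, hs, h1.size_eq] at hp
    rw [lowerAt, if_neg hp.not_gt]
    exact ⟨h1, hframe, Function.update_self _ _ _⟩

/-- The relaxation step for the label of vertex `p + 1`. -/
def labelStep : Program :=
  .ifPos (sub (labelCell (var 1)) (const 1))
    (.ifPos (sub (add (sumCell (var 1)) (const 1)) (sumCell (add (var 1) (const 1))))
      (lower (var 1)) .skip)
    (.ifPos (labelCell (var 1))
      (.ifPos (sub (add (sumCell (add (var 1) (const 1))) (const 1)) (sumCell (var 1)))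
        (lower (add (var 1) (const 1))) .skip)
      .skip)

/-- The effect on the memory of a relaxation step for a constraint `ok`. -/
def StepResult (n : ℕ) (X L : ℕ → ℤ) (b : ℕ) (F S : ℕ → ℤ) (m : Memory) (ok : Prop)
    (m' : Memory) : Prop :=
  ∃ S', Holds n X L b F S' m' ∧ Frame m m' ∧ Relaxes n F L ok S (m (-4)) S' (m' (-4))

theorem stepResult_keep {ok : Prop} (h : Holds n X L b F S m) (hok : ok) :
    StepResult n X L b F S m ok m :=
  ⟨S, h, fun _ _ _ _ => rfl, Or.inl ⟨hok, rfl, rfl⟩⟩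

theorem ends_lower_result {ok : Prop} (h : Holds n X L b F S m) (hS : Good n S) {x : Expr} {v : ℕ}
    (hx : x.eval (Function.update m (-4) 1) = v) (hviol : Violated n F L S v) :
    Ends b (lower x) m (lower x).units (StepResult n X L b F S m ok) :=
  (ends_lower h hS hviol.le hx).imp fun _ hm =>
    ⟨_, hm.1, hm.2.1, Or.inr ⟨hm.2.2, v, hviol, rfl⟩⟩

theorem ends_labelStep (h : Holds n X L b F S m) (hS : Good n S) {p : ℕ} (hp : p < n)
    (hL : L (p + 1) = 0 ∨ L (p + 1) = 1 ∨ L (p + 1) = 2) (hmp : m (-1) = p) :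
    Ends b labelStep m labelStep.units (StepResult n X L b F S m (LabelOK L S p)) := by
  have h1 := h.sum_eq p (by omega)
  have h2 := h.sum_eq (p + 1) (by omega)
  have h3 := h.label_eq p hp
  have hn := h.size_eq
  have hu : Function.update m (-4) 1 (-1) = p := by
    rw [Function.update_of_ne (by norm_num)]; exact hmp
  push_cast at h2
  refine ends_ifPos h.bounded (fun c1 => ?_) (fun c1 => ?_) <;>
    simp only [Expr.eval, hmp, hn, h3] at c1
  · have hL2 : L (p + 1) = 2 := by omega
    refine ends_ifPos h.bounded (fun c2 => ?_) (fun c2 => ends_skip ?_) <;>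
      simp only [Expr.eval, hmp, h1, h2] at c2
    · exact ends_lower_result h hS (by simpa only [Expr.eval] using hu)
        (violated_of_label_valley hp hL2 (by omega))
    · exact stepResult_keep h ⟨fun _ => by omega, fun _ => by omega⟩
  · refine ends_ifPos h.bounded (fun c3 => ?_) (fun c3 => ends_skip ?_) <;>
      simp only [Expr.eval, hmp, hn, h3] at c3
    · have hL1 : L (p + 1) = 1 := by omega
      refine ends_ifPos h.bounded (fun c2 => ?_) (fun c2 => ends_skip ?_) <;>
        simp only [Expr.eval, hmp, h1, h2] at c2
      · exact ends_lower_result h hS (v := p + 1) (by simp only [Expr.eval, hu]; push_cast; rfl)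
          (violated_of_label_mountain hp hL1 (by omega))
      · exact stepResult_keep h ⟨fun _ => by omega, fun _ => by omega⟩
    · exact stepResult_keep h ⟨fun _ => by omega, fun _ => by omega⟩

/-- The sums at `q - 1` and `p` differ by at most one after this step, or a sum is lowered. -/
def relaxPair : Program :=
  .ifPos (sub (sub (sumCell (sub (var 2) (const 1))) (sumCell (var 1))) (const 1))
    (lower (sub (var 2) (const 1)))
    (.ifPos (sub (sub (sumCell (var 1)) (sumCell (sub (var 2) (const 1)))) (const 1))
      (lower (var 1)) .skip)

theorem ends_relaxPair (h : Holds n X L b F S m) (hS : Good n S) {p q : ℕ} (hp : p < n)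
    (hpq : p + 2 ≤ q) (hq : q ≤ n + 1) (hmp : m (-1) = p) (hmq : m (-2) = q)
    (e1 : VertexExtreme F p q p) (e2 : VertexExtreme F p q q) :
    Ends b relaxPair m relaxPair.units (StepResult n X L b F S m (PairOK F S p q)) := by
  have h1 := h.sum_eq p (by omega)
  have h2 := h.sum_eq (q - 1) (by omega)
  have hq1 : ((q - 1 : ℕ) : ℤ) = q - 1 := by omega
  rw [hq1] at h2
  have hu : Function.update m (-4) 1 (-1) = p := by
    rw [Function.update_of_ne (by norm_num)]; exact hmp
  have hu' : Function.update m (-4) 1 (-2) = q := by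
    rw [Function.update_of_ne (by norm_num)]; exact hmq
  refine ends_ifPos h.bounded (fun c1 => ?_) (fun c1 => ?_) <;>
    simp only [Expr.eval, hmp, hmq, h1, h2] at c1
  · exact ends_lower_result h hS (v := q - 1) (by simp only [Expr.eval, hu', hq1])
      (violated_of_pair_right hp hpq hq e1 e2 (by omega))
  · refine ends_ifPos h.bounded (fun c2 => ?_) (fun c2 => ends_skip ?_) <;>
      simp only [Expr.eval, hmp, hmq, h1, h2] at c2
    · exact ends_lower_result h hS (by simpa only [Expr.eval] using hu)
        (violated_of_pair_left hp hpq hq e1 e2 (by omega))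
    · exact stepResult_keep h fun _ _ => by omega

/-- Relax the constraint at `p` and `q` if vertex `q` is extreme. -/
def checkRight : Program :=
  .ifPos (sub (var 5) (flatCell (var 2))) relaxPair
    (.ifPos (sub (flatCell (var 2)) (var 6)) relaxPair .skip)

/-- Relax the constraint at `p` and `q` if both vertices are extreme. -/
def pairStep : Program :=
  .ifPos (sub (var 5) (flatCell (var 1))) checkRight
    (.ifPos (sub (flatCell (var 1)) (var 6)) checkRight .skip)

/-- `lo` and `hi` are the least and the greatest position strictly between `p` and `q`. -/
def Range (F : ℕ → ℤ) (p q : ℕ) (lo hi : ℤ) : Prop :=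
  (∀ x, x < lo ↔ ∀ v, p < v → v < q → x < F v) ∧ (∀ x, hi < x ↔ ∀ v, p < v → v < q → F v < x)

theorem Range.extreme_iff {p q : ℕ} {lo hi : ℤ} (h : Range F p q lo hi) (r : ℕ) :
    VertexExtreme F p q r ↔ F r < lo ∨ hi < F r :=
  or_congr (h.1 _).symm (h.2 _).symm

theorem ends_pairStep (h : Holds n X L b F S m) (hS : Good n S) {p q : ℕ} (hp : p < n)
    (hpq : p + 2 ≤ q) (hq : q ≤ n + 1) (hmp : m (-1) = p) (hmq : m (-2) = q)
    (hr : Range F p q (m (-5)) (m (-6))) :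
    Ends b pairStep m pairStep.units (StepResult n X L b F S m (PairOK F S p q)) := by
  have h1 := h.flat_eq p (by omega)
  have h2 := h.flat_eq q (by omega)
  have key : VertexExtreme F p q p → Ends b checkRight m checkRight.units
      (StepResult n X L b F S m (PairOK F S p q)) := by
    intro e1
    refine ends_ifPos h.bounded (fun c1 => ?_) (fun c1 => ?_) <;>
      simp only [Expr.eval, hmq, h2] at c1
    · exact ends_relaxPair h hS hp hpq hq hmp hmq e1 ((hr.extreme_iff q).2 (Or.inl (by omega)))
    · refine ends_ifPos h.bounded (fun c2 => ?_) (fun c2 => ends_skip ?_) <;>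
        simp only [Expr.eval, hmq, h2] at c2
      · exact ends_relaxPair h hS hp hpq hq hmp hmq e1 ((hr.extreme_iff q).2 (Or.inr (by omega)))
      · refine stepResult_keep h fun _ e2 => ?_
        rw [hr.extreme_iff] at e2; omega
  refine ends_ifPos h.bounded (fun c1 => ?_) (fun c1 => ?_) <;>
    simp only [Expr.eval, hmp, h1] at c1
  · exact key ((hr.extreme_iff p).2 (Or.inl (by omega)))
  · refine ends_ifPos h.bounded (fun c2 => ?_) (fun c2 => ends_skip ?_) <;>
      simp only [Expr.eval, hmp, h1] at c2
    · exact key ((hr.extreme_iff p).2 (Or.inr (by omega)))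
    · refine stepResult_keep h fun e2 _ => ?_
      rw [hr.extreme_iff] at e2; omega

end Decider

end RAM

namespace RAM

section

variable {b : ℕ} {m : Memory} {Q : Memory → Prop}

/-- For a program with loops, `units` counts each loop body once, and a common factor `N` accounts
for the numbers of passes. Nested loops are thus bounded without computing the exact time of each
part. -/
theorem ends_seq_mul {p q : Program} {N : ℕ}
    (h : Ends b p m (N * p.units) fun m' => Ends b q m' (N * q.units) Q) :
    Ends b (.seq p q) m (N * (Program.seq p q).units) Q :=
  (ends_seq h).mono (by rw [Program.units, mul_add]) fun _ h => h

theorem Ends.mul {p : Program} {k : ℕ} (h : Ends b p m k Q) {N : ℕ} (hN : 1 ≤ N) :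
    Ends b p m (N * k) Q :=
  h.mono (Nat.le_mul_of_pos_left _ hN) fun _ h => h

theorem ends_whilePos_mul {e : Expr} {p : Program} {N M : ℕ} (hN : 1 ≤ N) (Inv : ℕ → Memory → Prop)
    (hb : ∀ k m, Inv k m → Bounded b m) (h0 : ∀ m, Inv 0 m → e.eval m ≤ 0)
    (hs : ∀ k m, Inv (k + 1) m → 0 < e.eval m ∧ Ends b p m (N * p.units) (Inv k))
    (k : ℕ) (hk : (k + 1) * N ≤ M) (h : Inv k m) (hQ : ∀ m, Inv 0 m → Q m) :
    Ends b (.whilePos e p) m (M * (Program.whilePos e p).units) Q := by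
  refine (ends_whilePos Inv hb h0 hs k h).mono ?_ hQ
  calc k * (e.units + N * p.units) + e.units ≤ (k + 1) * N * (e.units + p.units) := by
        have : e.units ≤ N * e.units := Nat.le_mul_of_pos_left _ hN
        nlinarith [Nat.zero_le (N * p.units), Nat.mul_le_mul_left k this]
    _ ≤ _ := Nat.mul_le_mul_right _ hk

end

/-! ### The nested loops of the program -/

namespace Decider

open RAM.Expr RAM.Program Relaxation

variable {n : ℕ} {X L : ℕ → ℤ} {b : ℕ} {F S : ℕ → ℤ} {m : Memory}

/-- Include vertex `q` into the range of positions. -/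
def extendRange : Program :=
  .seq (.ifPos (sub (var 5) (flatCell (var 2))) (.assign (const (-5)) (flatCell (var 2))) .skip)
    (.ifPos (sub (flatCell (var 2)) (var 6)) (.assign (const (-6)) (flatCell (var 2))) .skip)

theorem Range.extend {p q : ℕ} {lo hi : ℤ} (h : Range F p q lo hi) (hpq : p < q) :
    Range F p (q + 1) (min lo (F q)) (max hi (F q)) := by
  constructor
  · intro x
    rw [lt_min_iff, h.1]
    constructor
    · rintro ⟨h1, h2⟩ v hv hv'
      rcases (show v < q ∨ v = q by omega) with h3 | rfl
      · exact h1 v hv h3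
      · exact h2
    · exact fun h' => ⟨fun v hv hv' => h' v hv (by omega), h' q hpq (by omega)⟩
  · intro x
    rw [max_lt_iff, h.2]
    constructor
    · rintro ⟨h1, h2⟩ v hv hv'
      rcases (show v < q ∨ v = q by omega) with h3 | rfl
      · exact h1 v hv h3
      · exact h2
    · exact fun h' => ⟨fun v hv hv' => h' v hv (by omega), h' q hpq (by omega)⟩

theorem ends_extendRange (h : Holds n X L b F S m) {q : ℕ} (hq : q ≤ n + 1) (hmq : m (-2) = q) :
    Ends b extendRange m extendRange.units fun m' => Holds n X L b F S m' ∧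
      (∀ a, -10 ≤ a → a ≤ -1 → a ≠ -5 → a ≠ -6 → m' a = m a) ∧
      m' (-5) = min (m (-5)) (F q) ∧ m' (-6) = max (m (-6)) (F q) := by
  have hfq : ∀ m', Holds n X L b F S m' → m' (-20 - q - q) = F q := fun m' h' => h'.flat_eq q hq
  have hFb : |F q| ≤ 2 ^ b := by rw [← hfq m h]; exact h.bounded _
  refine ends_seq (Ends.imp (Q := fun m' => Holds n X L b F S m' ∧
    (∀ a, -10 ≤ a → a ≤ -1 → a ≠ -5 → m' a = m a) ∧ m' (-5) = min (m (-5)) (F q)) ?_ ?_)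
  · refine ends_ifPos h.bounded (fun c => ends_assign h.bounded ?_) (fun c => ends_skip ?_) <;>
      simp only [Expr.eval, hmq, hfq m h] at c ⊢
    · refine ⟨h.scalar (by norm_num) (by norm_num) hFb,
        fun a _ _ h5 => Function.update_of_ne h5 _ _, ?_⟩
      rw [Function.update_self, min_eq_right (by omega)]
    · exact ⟨h, fun _ _ _ _ => trivial, by rw [min_eq_left (by omega)]⟩
  · rintro m' ⟨h', hfr, h5⟩
    have hmq' : m' (-2) = q := by rw [hfr _ (by norm_num) (by norm_num) (by norm_num)]; exact hmq
    have hm6 : m' (-6) = m (-6) := hfr _ (by norm_num) (by norm_num) (by norm_num)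
    refine ends_ifPos h'.bounded (fun c => ends_assign h'.bounded ?_) (fun c => ends_skip ?_) <;>
      simp only [Expr.eval, hmq', hfq m' h', hm6] at c ⊢
    · refine ⟨h'.scalar (by norm_num) (by norm_num) hFb, fun a h1 h2 h3 h4 => ?_, ?_, ?_⟩
      · rw [Function.update_of_ne h4]; exact hfr a h1 h2 h3
      · rw [Function.update_of_ne (by norm_num)]; exact h5
      · rw [Function.update_self, max_eq_right (by omega)]
    · exact ⟨h', fun a h1 h2 h3 _ => hfr a h1 h2 h3, h5, by rw [max_eq_left (by omega)]⟩

def rightBody : Program :=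
  .seq pairStep (.seq extendRange (.assign (const (-2)) (add (var 2) (const 1))))

/-- The constraints at vertices `p' < p` hold. -/
def DoneBefore (n : ℕ) (F L S : ℕ → ℤ) (p : ℕ) : Prop :=
  ∀ p' < p, LabelOK L S p' ∧ ∀ q, p' + 2 ≤ q → q ≤ n + 1 → PairOK F S p' q

/-- The constraints at vertices `p' < p`, and at `p` and `q' < q`, hold. -/
def DoneUpTo (n : ℕ) (F L S : ℕ → ℤ) (p q : ℕ) : Prop :=
  DoneBefore n F L S p ∧ LabelOK L S p ∧ ∀ q' < q, p + 2 ≤ q' → PairOK F S p q'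

def RightInv (n : ℕ) (X L : ℕ → ℤ) (b : ℕ) (F S₀ : ℕ → ℤ) (p : ℕ) (K : ℤ) (k : ℕ) (m : Memory) :
    Prop :=
  ∃ q S, q + k = n + 2 ∧ p + 2 ≤ q ∧ Holds n X L b F S m ∧ Good n S ∧ m (-1) = p ∧ m (-2) = q ∧
    m (-3) = K ∧ Range F p q (m (-5)) (m (-6)) ∧
    Progress n F L S₀ (DoneUpTo n F L S₀ p q) S (m (-4))

theorem ends_rightBody {S₀ : ℕ → ℤ} {p : ℕ} {K : ℤ} {k : ℕ} (hp : p < n)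
    (h : RightInv n X L b F S₀ p K (k + 1) m) :
    Ends b rightBody m rightBody.units (RightInv n X L b F S₀ p K k) := by
  obtain ⟨q, S, hqk, hpq, hm, hS, hmp, hmq, hmK, hr, hprog⟩ := h
  have hq : q ≤ n + 1 := by omega
  refine ends_seq ((ends_pairStep hm hS hp hpq hq hmp hmq hr).imp ?_)
  rintro m₁ ⟨S', hm₁, hfr, hrel⟩
  have hf : ∀ a : ℤ, -10 ≤ a → a ≤ -1 → a ≠ -4 → m₁ a = m a := hfr
  have hmq₁ : m₁ (-2) = q := by rw [hf _ (by norm_num) (by norm_num) (by norm_num)]; exact hmq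
  refine ends_seq ((ends_extendRange hm₁ hq hmq₁).imp ?_)
  rintro m₂ ⟨hm₂, hf₂, h5, h6⟩
  refine ends_assign hm₂.bounded ?_
  simp only [Expr.eval]
  have hmq₂ : m₂ (-2) = q := by
    rw [hf₂ _ (by norm_num) (by norm_num) (by norm_num) (by norm_num)]; exact hmq₁
  rw [hmq₂]
  have hu : ∀ c : ℤ, c ≠ -2 → Function.update m₂ (-2) ((q : ℤ) + 1) c = m₂ c :=
    fun c hc => Function.update_of_ne hc _ _
  have hroom := hm.room'
  refine ⟨q + 1, S', by omega, by omega, hm₂.scalar (by norm_num) (by norm_num) ?_,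
    hrel.good hS, ?_, by rw [Function.update_self]; push_cast; rfl, ?_, ?_, ?_⟩
  · rw [abs_le]; omega
  · rw [hu _ (by norm_num), hf₂ _ (by norm_num) (by norm_num) (by norm_num) (by norm_num),
      hf _ (by norm_num) (by norm_num) (by norm_num)]
    exact hmp
  · rw [hu _ (by norm_num), hf₂ _ (by norm_num) (by norm_num) (by norm_num) (by norm_num),
      hf _ (by norm_num) (by norm_num) (by norm_num)]
    exact hmK
  · rw [hu _ (by norm_num), hu _ (by norm_num), h5, h6,
      hf _ (by norm_num) (by norm_num) (by norm_num),
      hf _ (by norm_num) (by norm_num) (by norm_num)]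
    exact hr.extend (by omega)
  · rw [hu _ (by norm_num), hf₂ _ (by norm_num) (by norm_num) (by norm_num) (by norm_num)]
    -- As long as the flag is down, the sums have not changed since the round began, so a check of
    -- the current sums is a check of the initial ones.
    refine hprog.relax hS hrel fun he hD hok => ?_
    subst he
    refine ⟨hD.1, hD.2.1, fun q' hq' hpq' => ?_⟩
    rcases (show q' < q ∨ q' = q by omega) with h | rfl
    · exact hD.2.2 q' h hpq'
    · exact hok

def rightLoop : Program := .whilePos (sub (add size (const 2)) (var 2)) rightBody

theorem ends_rightLoop {S₀ : ℕ → ℤ} {p : ℕ} {K : ℤ} {k : ℕ} (hp : p < n)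
    (h : RightInv n X L b F S₀ p K k m) (hk : k ≤ n) :
    Ends b rightLoop m ((n + 1) * rightLoop.units) (RightInv n X L b F S₀ p K 0) := by
  refine ends_whilePos_mul (N := 1) le_rfl (RightInv n X L b F S₀ p K) ?_ ?_ ?_ k (by omega) h
    fun _ h => h
  · rintro k m ⟨q, S, -, -, hm, -⟩; exact hm.bounded
  · rintro m ⟨q, S, hq, -, hm, -, -, hmq, -⟩
    simp only [Expr.eval, hm.size_eq, hmq]; omega
  · rintro k m h
    refine ⟨?_, (ends_rightBody hp h).mul le_rfl⟩
    obtain ⟨q, S, hq, -, hm, -, -, hmq, -⟩ := h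
    simp only [Expr.eval, hm.size_eq, hmq]; omega

def leftBody : Program :=
  .seq labelStep (.seq (.assign (const (-5)) (flatCell (add (var 1) (const 1))))
    (.seq (.assign (const (-6)) (flatCell (add (var 1) (const 1))))
      (.seq (.assign (const (-2)) (add (var 1) (const 2)))
        (.seq rightLoop (.assign (const (-1)) (add (var 1) (const 1)))))))

def LeftInv (n : ℕ) (X L : ℕ → ℤ) (b : ℕ) (F S₀ : ℕ → ℤ) (K : ℤ) (k : ℕ) (m : Memory) : Prop :=
  ∃ p S, p + k = n ∧ Holds n X L b F S m ∧ Good n S ∧ m (-1) = p ∧ m (-3) = K ∧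
    Progress n F L S₀ (DoneBefore n F L S₀ p) S (m (-4))

theorem ends_leftBody (hL : ∀ p < n, L (p + 1) = 0 ∨ L (p + 1) = 1 ∨ L (p + 1) = 2)
    {S₀ : ℕ → ℤ} {K : ℤ} {k : ℕ} (h : LeftInv n X L b F S₀ K (k + 1) m) :
    Ends b leftBody m ((n + 1) * leftBody.units) (LeftInv n X L b F S₀ K k) := by
  obtain ⟨p, S, hpk, hm, hS, hmp, hmK, hprog⟩ := h
  have hp : p < n := by omega
  have hroom := hm.room'
  have hN : 1 ≤ n + 1 := by omega
  refine ends_seq_mul (((ends_labelStep hm hS hp (hL p hp) hmp).imp ?_).mul hN)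
  rintro m₁ ⟨S', hm₁, hfr, hrel⟩
  have hf : ∀ a : ℤ, -10 ≤ a → a ≤ -1 → a ≠ -4 → m₁ a = m a := hfr
  have hmp₁ : m₁ (-1) = p := by rw [hf _ (by norm_num) (by norm_num) (by norm_num)]; exact hmp
  have hmK₁ : m₁ (-3) = K := by rw [hf _ (by norm_num) (by norm_num) (by norm_num)]; exact hmK
  have hFp : ∀ m', Holds n X L b F S' m' → m' (-20 - (p + 1) - (p + 1)) = F (p + 1) := by
    intro m' h'
    have := h'.flat_eq (p + 1) (by omega)
    push_cast at this; exact this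
  have hFb : |F (p + 1)| ≤ 2 ^ b := by rw [← hFp m₁ hm₁]; exact hm₁.bounded _
  refine ends_seq_mul ((ends_assign hm₁.bounded ?_).mul hN)
  simp only [Expr.eval, hmp₁, hFp m₁ hm₁]
  set m₂ := Function.update m₁ (-5) (F (p + 1)) with hm₂def
  have hm₂ : Holds n X L b F S' m₂ := hm₁.scalar (by norm_num) (by norm_num) hFb
  have hmp₂ : m₂ (-1) = p := by rw [hm₂def, Function.update_of_ne (by norm_num)]; exact hmp₁
  refine ends_seq_mul ((ends_assign hm₂.bounded ?_).mul hN)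
  simp only [Expr.eval, hmp₂, hFp m₂ hm₂]
  set m₃ := Function.update m₂ (-6) (F (p + 1)) with hm₃def
  have hm₃ : Holds n X L b F S' m₃ := hm₂.scalar (by norm_num) (by norm_num) hFb
  have hmp₃ : m₃ (-1) = p := by rw [hm₃def, Function.update_of_ne (by norm_num)]; exact hmp₂
  refine ends_seq_mul ((ends_assign hm₃.bounded ?_).mul hN)
  simp only [Expr.eval, hmp₃]
  set m₄ := Function.update m₃ (-2) ((p : ℤ) + 2) with hm₄def
  have hm₄ : Holds n X L b F S' m₄ :=
    hm₃.scalar (by norm_num) (by norm_num) (by rw [abs_le]; omega)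
  have hinv : RightInv n X L b F S₀ p K (n - p) m₄ := by
    refine ⟨p + 2, S', by omega, le_rfl, hm₄, hrel.good hS, ?_, ?_, ?_, ?_, ?_⟩
    · rw [hm₄def, Function.update_of_ne (by norm_num)]; exact hmp₃
    · rw [hm₄def, Function.update_self]; push_cast; rfl
    · rw [hm₄def, Function.update_of_ne (by norm_num), hm₃def, Function.update_of_ne (by norm_num),
        hm₂def, Function.update_of_ne (by norm_num)]
      exact hmK₁
    · have h5 : m₄ (-5) = F (p + 1) := by
        rw [hm₄def, Function.update_of_ne (by norm_num), hm₃def,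
          Function.update_of_ne (by norm_num), hm₂def, Function.update_self]
      have h6 : m₄ (-6) = F (p + 1) := by
        rw [hm₄def, Function.update_of_ne (by norm_num), hm₃def, Function.update_self]
      rw [h5, h6]
      constructor
      · exact fun x => ⟨fun h v hv hv' => by rwa [show v = p + 1 by omega],
          fun h => h (p + 1) (by omega) (by omega)⟩
      · exact fun x => ⟨fun h v hv hv' => by rwa [show v = p + 1 by omega],
          fun h => h (p + 1) (by omega) (by omega)⟩
    · rw [hm₄def, Function.update_of_ne (by norm_num), hm₃def, Function.update_of_ne (by norm_num),
        hm₂def, Function.update_of_ne (by norm_num)]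
      refine hprog.relax hS hrel fun he hD hok => ?_
      subst he
      exact ⟨hD, hok, fun q' h1 h2 => by omega⟩
  refine ends_seq_mul ((ends_rightLoop hp hinv (by omega)).imp ?_)
  rintro m₅ ⟨q, S'', hq, -, hm₅, hS'', hmp₅, -, hmK₅, -, hprog₅⟩
  refine (ends_assign hm₅.bounded ?_).mul hN
  simp only [Expr.eval, hmp₅]
  refine ⟨p + 1, S'', by omega, hm₅.scalar (by norm_num) (by norm_num) (by rw [abs_le]; omega),
    hS'', by rw [Function.update_self]; push_cast; rfl,
    by rw [Function.update_of_ne (by norm_num)]; exact hmK₅, ?_⟩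
  rw [Function.update_of_ne (by norm_num)]
  refine hprog₅.imp (fun h => ⟨h.1, h.2.1, ?_⟩) id
  obtain ⟨h1, h2, h3⟩ := h.2.2
  intro p' hp'
  rcases (show p' < p ∨ p' = p by omega) with h | rfl
  · exact h1 p' h
  · exact ⟨h2, fun q' hq' hq'' => h3 q' (by omega) hq'⟩

def leftLoop : Program := .whilePos (sub size (var 1)) leftBody

theorem ends_leftLoop (hL : ∀ p < n, L (p + 1) = 0 ∨ L (p + 1) = 1 ∨ L (p + 1) = 2)
    {S₀ : ℕ → ℤ} {K : ℤ} (h : LeftInv n X L b F S₀ K n m) :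
    Ends b leftLoop m ((n + 1) * (n + 1) * leftLoop.units) (LeftInv n X L b F S₀ K 0) := by
  refine ends_whilePos_mul (N := n + 1) (by omega) (LeftInv n X L b F S₀ K) ?_ ?_ ?_ n le_rfl h
    fun _ h => h
  · rintro k m ⟨q, S, -, hm, -⟩; exact hm.bounded
  · rintro m ⟨q, S, hq, hm, -, hmq, -⟩
    simp only [Expr.eval, hm.size_eq, hmq]; omega
  · rintro k m h
    refine ⟨?_, ends_leftBody hL h⟩
    obtain ⟨q, S, hq, hm, -, hmq, -⟩ := h
    simp only [Expr.eval, hm.size_eq, hmq]; omega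

/-- The flag is cleared at the beginning of every round and rounds are not cut short, so the flag
left by the last round tells whether that round found all constraints satisfied. -/
def round : Program :=
  .seq (.assign (const (-4)) (const 0)) (.seq (.assign (const (-1)) (const 0))
    (.seq leftLoop (.assign (const (-3)) (sub (var 3) (const 1)))))

def RoundInv (n : ℕ) (X L : ℕ → ℤ) (b : ℕ) (F : ℕ → ℤ) (k : ℕ) (m : Memory) : Prop :=
  ∃ S, Holds n X L b F S m ∧ Good n S ∧ m (-3) = k ∧ k ≤ (n + 1) * (n + 1) ∧
    Rounds n F L k S (m (-4))

theorem ends_round (hL : ∀ p < n, L (p + 1) = 0 ∨ L (p + 1) = 1 ∨ L (p + 1) = 2) {k : ℕ}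
    (h : RoundInv n X L b F (k + 1) m) :
    Ends b round m ((n + 1) * (n + 1) * round.units) (RoundInv n X L b F k) := by
  obtain ⟨S, hm, hS, hmK, hkn, hr⟩ := h
  have hN : 1 ≤ (n + 1) * (n + 1) := by nlinarith
  refine ends_seq_mul ((ends_assign hm.bounded ?_).mul hN)
  simp only [Expr.eval]
  have hm₁ : Holds n X L b F S (Function.update m (-4) 0) :=
    hm.scalar (by norm_num) (by norm_num) (by rw [abs_zero]; positivity)
  refine ends_seq_mul ((ends_assign hm₁.bounded ?_).mul hN)
  simp only [Expr.eval]
  have hm₂ : Holds n X L b F S (Function.update (Function.update m (-4) 0) (-1) 0) :=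
    hm₁.scalar (by norm_num) (by norm_num) (by rw [abs_zero]; positivity)
  have hinv : LeftInv n X L b F S (k + 1 : ℕ) n
      (Function.update (Function.update m (-4) 0) (-1) 0) := by
    refine ⟨0, S, by omega, hm₂, hS, by rw [Function.update_self]; rfl, ?_, ?_⟩
    · rw [Function.update_of_ne (by norm_num), Function.update_of_ne (by norm_num)]; exact hmK
    · rw [Function.update_of_ne (by norm_num), Function.update_self]
      exact Or.inl ⟨rfl, rfl, fun p' hp' => absurd hp' (Nat.not_lt_zero _)⟩
  refine ends_seq_mul ((ends_leftLoop hL hinv).imp ?_)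
  rintro m₃ ⟨p, S', hp, hm₃, hS', hmp₃, hmK₃, hprog⟩
  obtain rfl : p = n := by omega
  refine (ends_assign hm₃.bounded ?_).mul hN
  simp only [Expr.eval, hmK₃]
  have hroom := hm.room
  have hk' : ((k + 1 : ℕ) : ℤ) - 1 = k := by push_cast; ring
  have hkz : ((k : ℤ) + 1) ≤ (p + 1) * (p + 1) := by exact_mod_cast hkn
  rw [hk']
  refine ⟨S', hm₃.scalar (by norm_num) (by norm_num) ?_, hS', Function.update_self _ _ _,
    by omega, ?_⟩
  · rw [abs_le]; constructor <;> nlinarith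
  · rw [Function.update_of_ne (by norm_num)]
    exact hr.round hprog

def rounds : Program := .whilePos (var 3) round

theorem ends_rounds (hL : ∀ p < n, L (p + 1) = 0 ∨ L (p + 1) = 1 ∨ L (p + 1) = 2)
    (h : RoundInv n X L b F ((n + 1) * (n + 1)) m) :
    Ends b rounds m ((n + 2) ^ 4 * rounds.units) (RoundInv n X L b F 0) := by
  refine ends_whilePos_mul (N := (n + 1) * (n + 1)) (by nlinarith) (RoundInv n X L b F) ?_ ?_ ?_
    ((n + 1) * (n + 1)) ?_ h fun _ h => h
  · rintro k m ⟨S, hm, -⟩; exact hm.bounded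
  · rintro m ⟨S, hm, -, hmK, -⟩
    simp only [Expr.eval, hmK]; simp
  · rintro k m h
    refine ⟨?_, ends_round hL h⟩
    obtain ⟨S, hm, -, hmK, -⟩ := h
    simp only [Expr.eval, hmK]; push_cast; positivity
  · calc ((n + 1) * (n + 1) + 1) * ((n + 1) * (n + 1)) ≤ ((n + 2) * (n + 2)) * ((n + 2) * (n + 2)) := by
          gcongr
          · nlinarith
          · omega
          · omega
      _ = _ := by ring

/-- The machine cannot multiply. The power of `-1` in the flat positions is a sign in cell `-7` that
is negated in each pass, and the number of rounds `(n + 1) * (n + 1)` is accumulated by adding `n +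
1` in each of the `n + 1` passes. -/
def initBody : Program :=
  .seq (.ifPos (var 7)
      (.assign (flatAddr (add (var 1) (const 1)))
        (add (flatCell (var 1)) (sub (xCell (add (var 1) (const 1))) (xCell (var 1)))))
      (.assign (flatAddr (add (var 1) (const 1)))
        (sub (flatCell (var 1)) (sub (xCell (add (var 1) (const 1))) (xCell (var 1))))))
    (.seq (.assign (sumAddr (add (var 1) (const 1))) (add (var 1) (const 1)))
      (.seq (.assign (const (-7)) (sub (const 0) (var 7)))
        (.seq (.assign (const (-3)) (add (var 3) (add size (const 1))))
          (.assign (const (-1)) (add (var 1) (const 1))))))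

def InitInv (n : ℕ) (X L : ℕ → ℤ) (b : ℕ) (k : ℕ) (m : Memory) : Prop :=
  ∃ i F S, i + k = n + 1 ∧ Holds n X L b F S m ∧ m (-1) = (i : ℕ) ∧ m (-7) = (-1) ^ i ∧
    m (-3) = i * (n + 1) ∧ (∀ v ≤ i, F v = flatPos X v) ∧ ∀ v ≤ i, S v = v

theorem ends_initBody (hF : ∀ v ≤ n + 1, |flatPos X v| ≤ 2 ^ b) {k : ℕ}
    (h : InitInv n X L b (k + 1) m) :
    Ends b initBody m initBody.units (InitInv n X L b k) := by
  obtain ⟨i, F, S, hik, hm, hm1, hm7, hm3, hFi, hSi⟩ := h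
  have hin : i ≤ n := by omega
  have hroom := hm.room
  have hroom' := hm.room'
  have hx1 := hm.x_eq (i + 1) (by omega)
  have hx0 := hm.x_eq i (by omega)
  have hf0 := hm.flat_eq i (by omega)
  rw [hFi i le_rfl] at hf0
  push_cast at hx1
  have hfl : flatPos X (i + 1) = flatPos X i + (-1) ^ i * (X (i + 1) - X i) := rfl
  refine ends_seq (Ends.imp (Q := fun m' => m' =
    Function.update m (-20 - (i + 1 : ℕ) - (i + 1 : ℕ)) (flatPos X (i + 1))) ?_ ?_)
  · refine ends_ifPos hm.bounded (fun c => ends_assign hm.bounded ?_)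
      (fun c => ends_assign hm.bounded ?_) <;>
      simp only [Expr.eval, hm7, hm1, hx1, hx0, hf0] at c ⊢
    · have : (-1 : ℤ) ^ i = 1 := by
        rcases neg_one_pow_eq_or ℤ i with h | h
        · exact h
        · rw [h] at c; omega
      rw [hfl, this]; push_cast; ring_nf
    · have : (-1 : ℤ) ^ i = -1 := by
        rcases neg_one_pow_eq_or ℤ i with h | h
        · rw [h] at c; omega
        · exact h
      rw [hfl, this]; push_cast; ring_nf
  rintro m₁ rfl
  have hm₁ := hm.setFlat (i + 1) (hF (i + 1) (by omega))
  have e1 : Function.update m (-20 - (i + 1 : ℕ) - (i + 1 : ℕ)) (flatPos X (i + 1)) (-1) = i := by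
    rw [Function.update_of_ne (by omega)]; exact hm1
  refine ends_seq (ends_assign hm₁.bounded ?_)
  simp only [Expr.eval, e1]
  have hm₂ := hm₁.setSum (i + 1) (x := (i : ℤ) + 1) (by rw [abs_le]; omega)
  have hs : ∀ a : ℤ, -10 ≤ a → a ≤ -1 → Function.update
      (Function.update m (-20 - (i + 1 : ℕ) - (i + 1 : ℕ)) (flatPos X (i + 1)))
      (-21 - (i + 1 : ℕ) - (i + 1 : ℕ)) ((i : ℤ) + 1) a = m a := fun a h1 h2 => by
    rw [Function.update_of_ne (by omega), Function.update_of_ne (by omega)]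
  push_cast at hm₂ hs ⊢
  generalize Function.update (Function.update m (-20 - ((i : ℤ) + 1) - (i + 1)) (flatPos X (i + 1)))
      (-21 - ((i : ℤ) + 1) - (i + 1)) ((i : ℤ) + 1) = m₂ at hm₂ hs ⊢
  refine ends_seq (ends_assign hm₂.bounded ?_)
  simp only [Expr.eval, hs _ (show (-10 : ℤ) ≤ -7 by norm_num) (by norm_num), hm7]
  have hpow : ((0 : ℤ) - (-1) ^ i) = (-1) ^ (i + 1) := by rw [pow_succ]; ring
  rw [hpow]
  have hm₃ := hm₂.scalar (show (-10 : ℤ) ≤ -7 by norm_num) (by norm_num)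
    (x := (-1) ^ (i + 1)) (by rw [abs_pow, abs_neg, abs_one, one_pow]; omega)
  have e3 : Function.update m₂ (-7) ((-1) ^ (i + 1)) (-3) = i * (n + 1) := by
    rw [Function.update_of_ne (by norm_num), hs _ (by norm_num) (by norm_num)]; exact hm3
  refine ends_seq (ends_assign hm₃.bounded ?_)
  simp only [Expr.eval, e3, hm₃.size_eq]
  have hK : (i : ℤ) * (n + 1) + (n + 1) = ((i + 1 : ℕ) : ℤ) * (n + 1) := by push_cast; ring
  rw [hK]
  have hinz : (i : ℤ) ≤ n := by exact_mod_cast hin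
  have hm₄ := hm₃.scalar (show (-10 : ℤ) ≤ -3 by norm_num) (by norm_num)
    (x := ((i + 1 : ℕ) : ℤ) * (n + 1)) (by
      rw [abs_of_nonneg (by positivity)]; push_cast; nlinarith)
  have e4 : Function.update (Function.update m₂ (-7) ((-1) ^ (i + 1))) (-3)
      (((i + 1 : ℕ) : ℤ) * (n + 1)) (-1) = i := by
    rw [Function.update_of_ne (by norm_num), Function.update_of_ne (by norm_num),
      hs _ (by norm_num) (by norm_num)]
    exact hm1
  refine ends_assign hm₄.bounded ?_
  simp only [Expr.eval, e4]
  refine ⟨i + 1, _, _, by omega, hm₄.scalar (by norm_num) (by norm_num) (by rw [abs_le]; omega),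
    by rw [Function.update_self]; push_cast; rfl, ?_, ?_, fun v hv => ?_, fun v hv => ?_⟩
  · rw [Function.update_of_ne (by norm_num), Function.update_of_ne (by norm_num),
      Function.update_self]
  · rw [Function.update_of_ne (by norm_num), Function.update_self]
  · by_cases h : v = i + 1
    · rw [h, Function.update_self]
    · rw [Function.update_of_ne h]; exact hFi v (by omega)
  · by_cases h : v = i + 1
    · rw [h, Function.update_self]; push_cast; rfl
    · rw [Function.update_of_ne h]; exact hSi v (by omega)

def initLoop : Program := .whilePos (sub (add size (const 1)) (var 1)) initBody

theorem ends_initLoop (hF : ∀ v ≤ n + 1, |flatPos X v| ≤ 2 ^ b) (h : InitInv n X L b (n + 1) m) :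
    Ends b initLoop m ((n + 2) ^ 4 * initLoop.units) (InitInv n X L b 0) := by
  refine ends_whilePos_mul (N := 1) le_rfl (InitInv n X L b) ?_ ?_ ?_ (n + 1) ?_ h fun _ h => h
  · rintro k m ⟨i, F, S, -, hm, -⟩; exact hm.bounded
  · rintro m ⟨i, F, S, hi, hm, hm1, -⟩
    simp only [Expr.eval, hm.size_eq, hm1]; omega
  · rintro k m h
    refine ⟨?_, (ends_initBody hF h).mul le_rfl⟩
    obtain ⟨i, F, S, hi, hm, hm1, -⟩ := h
    simp only [Expr.eval, hm.size_eq, hm1]; omega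
  · rw [mul_one]; exact Nat.le_self_pow (by norm_num) _

/-- The remaining scalars and the two arrays need no initial assignment, because cells at negative
addresses start at `0`. The answer overwrites the size only at the very end. -/
def program : Program :=
  .seq (.assign (const (-7)) (const 1)) (.seq initLoop (.seq rounds
    (.assign (const 0) (sub (const 1) (var 4)))))

theorem ends_program (hL : ∀ p < n, L (p + 1) = 0 ∨ L (p + 1) = 1 ∨ L (p + 1) = 2)
    (hF : ∀ v ≤ n + 1, |flatPos X v| ≤ 2 ^ b) (hm : Holds n X L b 0 0 m) (hm1 : m (-1) = 0)
    (hm3 : m (-3) = 0) :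
    Ends b program m ((n + 2) ^ 4 * program.units) fun m' =>
      (m' 0 = 1 ∧ ∃ S, Good n S ∧ AllOK n (flatPos X) L S) ∨
        (m' 0 = 0 ∧ ¬ ∃ S, Solution n (flatPos X) L S) := by
  have hN : 1 ≤ (n + 2) ^ 4 := Nat.one_le_pow _ _ (by omega)
  have hroom := hm.room'
  refine ends_seq_mul ((ends_assign hm.bounded ?_).mul hN)
  simp only [Expr.eval]
  have hinv : InitInv n X L b (n + 1) (Function.update m (-7) 1) := by
    refine ⟨0, 0, 0, by omega, hm.scalar (by norm_num) (by norm_num) (by rw [abs_one]; omega),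
      ?_, ?_, ?_, fun v hv => ?_, fun v hv => ?_⟩
    · rw [Function.update_of_ne (by norm_num), hm1]; rfl
    · rw [Function.update_self, pow_zero]
    · rw [Function.update_of_ne (by norm_num), hm3]; simp
    · obtain rfl : v = 0 := by omega
      rfl
    · obtain rfl : v = 0 := by omega
      rfl
  refine ends_seq_mul ((ends_initLoop hF hinv).imp ?_)
  rintro m₁ ⟨i, F, S, hi, hm₁, -, -, hm3₁, hFi, hSi⟩
  obtain rfl : i = n + 1 := by omega
  have hm₁' : Holds n X L b (flatPos X) S m₁ :=
    { hm₁ with flat_eq := fun v hv => by rw [← hFi v hv]; exact hm₁.flat_eq v hv }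
  have hround : RoundInv n X L b (flatPos X) ((n + 1) * (n + 1)) m₁ := by
    refine ⟨S, hm₁', fun v hv => ?_, by rw [hm3₁]; push_cast; rfl, le_rfl,
      Rounds.init n _ L _ fun v hv => hSi v (by omega)⟩
    rw [hSi v (by omega)]
    exact ⟨by simp, by omega, le_rfl⟩
  refine ends_seq_mul ((ends_rounds hL hround).imp ?_)
  rintro m₂ ⟨S', hm₂, hS', -, -, hr⟩
  refine (ends_assign hm₂.bounded ?_).mul hN
  simp only [Expr.eval, Function.update_self]
  rcases hr.final with ⟨h1, h2⟩ | ⟨h1, h2⟩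
  · exact Or.inl ⟨by rw [h1]; rfl, S', hS', h2⟩
  · exact Or.inr ⟨by rw [h1]; rfl, h2⟩

end Decider

end RAM

/-! ## Rational crease patterns -/

namespace RAM

theorem bitLength_pos (z : ℤ) : 1 ≤ bitLength z := Nat.le_add_left _ _

theorem abs_le_two_pow_bitLength (z : ℤ) : |z| ≤ 2 ^ bitLength z := by
  have h : z.natAbs ≤ 2 ^ bitLength z :=
    (Nat.lt_size_self _).le.trans (Nat.pow_le_pow_right (by norm_num) (Nat.le_succ _))
  rw [Int.abs_eq_natAbs]
  exact_mod_cast h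

theorem length_le_inputSize (w : List ℤ) : w.length ≤ inputSize w := by
  induction w with
  | nil => simp [inputSize]
  | cons a w ih =>
    have := bitLength_pos a
    simp only [inputSize, List.map_cons, List.sum_cons, List.length_cons] at ih ⊢
    omega

theorem bounded_load (w : List ℤ) : Bounded (inputSize w) (load w) := by
  intro a
  have hz : |(0 : ℤ)| ≤ 2 ^ inputSize w := by rw [abs_zero]; positivity
  rw [load]
  split_ifs with ha
  · rcases lt_or_ge a.toNat w.length with h | h
    · rw [List.getD_eq_getElem _ _ h]
      refine (abs_le_two_pow_bitLength _).trans (pow_le_pow_right₀ (by norm_num) ?_)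
      exact List.single_le_sum (fun _ _ => Nat.zero_le _) _
        (List.mem_map_of_mem (List.getElem_mem h))
    · rwa [List.getD_eq_default _ _ h]
  · exact hz

end RAM

section

variable {R : Type*} [CommRing R]

/-- Flat positions are signed sums of coordinates, so they commute with every additive map; the map
needed is the division by the common denominator. -/
theorem map_flatPos {S : Type*} [CommRing S] (φ : R →+ S) (x : ℕ → R) (v : ℕ) :
    φ (flatPos x v) = flatPos (fun v => φ (x v)) v := by
  induction v with
  | zero => simp [flatPos]
  | succ v ih =>
    rw [flatPos, flatPos, map_add, ih]
    rcases neg_one_pow_eq_or R v with h | h <;> rcases Nat.even_or_odd v with hv | hv <;>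
      simp [hv.neg_one_pow]

theorem flatPos_succ_ne {x : ℕ → ℤ} {v : ℕ} (h : x v < x (v + 1)) :
    flatPos x v ≠ flatPos x (v + 1) := by
  rw [flatPos]
  rcases neg_one_pow_eq_or ℤ v with h1 | h1 <;> rw [h1] <;> omega

theorem abs_flatPos_le {x : ℕ → ℤ} (h : Monotone x) (v : ℕ) : |flatPos x v| ≤ x v - x 0 := by
  induction v with
  | zero => simp [flatPos]
  | succ v ih =>
    have : x v ≤ x (v + 1) := h (Nat.le_succ v)
    rw [flatPos]
    rw [abs_le] at ih ⊢
    rcases neg_one_pow_eq_or ℤ v with h1 | h1 <;> rw [h1] <;> constructor <;> omega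

end

theorem assignable_congr {α β : Type*} [LT α] [LT β] {n : ℕ} {lab : ℕ → ℤ} {f : ℕ → α} {g : ℕ → β}
    (h : ∀ u v, f u < f v ↔ g u < g v) : Assignable n lab f ↔ Assignable n lab g := by
  simp only [Assignable, TurningCriterion, VertexExtreme, h]

namespace RationalPattern

open RAM

variable (I : RationalPattern)

/-- The numerators, indexed by natural numbers. -/
def coord (v : ℕ) : ℤ := I.num (clampFin (I.n + 1) v)

/-- The label codes, indexed by natural numbers. -/
def code (v : ℕ) : ℤ := if h : 1 ≤ v ∧ v ≤ I.n then labelCode (I.label ⟨v - 1, by omega⟩) else 0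

theorem monotone_coord : Monotone I.coord := fun u v h => I.strictMono_num.monotone (by
  simp only [clampFin, Fin.le_def]; omega)

theorem coord_lt_succ {v : ℕ} (hv : v ≤ I.n) : I.coord v < I.coord (v + 1) :=
  I.strictMono_num (by simp only [clampFin, Fin.lt_def]; omega)

theorem code_cases (v : ℕ) (h1 : 1 ≤ v) (hn : v ≤ I.n) :
    (I.code v = 0 ∧ atCrease I.label v = 0) ∨ (I.code v = 2 ∧ atCrease I.label v = 1) ∨
      (I.code v = 1 ∧ atCrease I.label v = -1) := by
  rw [code, atCrease, dif_pos ⟨h1, hn⟩, dif_pos ⟨h1, hn⟩]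
  rcases I.label _ with _ | _ | _ <;> simp [labelCode, typeSign]

/-- The criterion depends only on the order of the flat positions, which division by a positive
denominator does not change. Hence the program can compute with the numerators and ignore the
denominator. -/
theorem oneLayerFoldable_iff : I.toPattern.OneLayerFoldable ↔
    Assignable I.n (atCrease I.label) (flatPos I.coord) := by
  rw [oneLayerFoldable_iff_assignable]
  refine assignable_congr fun u v => ?_
  have hd : (0 : ℝ) < I.den := Nat.cast_pos.mpr I.den_pos
  have h : ∀ v, flatPos (fun v => I.toPattern.vertex (clampFin (I.n + 1) v)) v =
      ((flatPos I.coord v : ℤ) : ℝ) / I.den := fun v =>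
    (map_flatPos ((AddMonoidHom.mulRight ((I.den : ℝ)⁻¹)).comp (Int.castAddHom ℝ))
      I.coord v).symm
  rw [h, h, div_lt_div_iff_of_pos_right hd, Int.cast_lt]

theorem length_encode : I.encode.length = 2 * I.n + 4 := by
  simp [encode]; omega

/-- Twice the input size leaves enough bits for the round counter, which is quadratic in `n`; the
extra bit leaves room for the difference of two coordinates, which bounds the flat positions. -/
theorem holds_load : Decider.Holds I.n I.coord I.code (2 * inputSize I.encode + 1) 0 0
    (load I.encode) := by
  have hneg : ∀ a : ℤ, a < 0 → load I.encode a = 0 := fun a ha => if_neg (by omega)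
  have hnat : ∀ k : ℕ, load I.encode k = I.encode.getD k 0 := fun k => by simp [load]
  refine ⟨by simp [load, encode], fun v hv => ?_, fun v hv => ?_, fun v _ => hneg _ (by omega),
    fun v _ => hneg _ (by omega), fun a => (bounded_load _ a).trans
      (pow_le_pow_right₀ (by norm_num) (by omega)), ?_⟩
  · rw [show (v : ℤ) + 2 = ((v + 2 : ℕ) : ℤ) by push_cast; ring, hnat]
    simp only [encode, List.getD_cons_succ]
    rw [List.getD_append _ _ _ _ (by simp; omega), List.getD_eq_getElem _ _ (by simp; omega),
      List.getElem_ofFn, coord]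
    congr 1
    ext
    simp only [clampFin]
    omega
  · rw [show (I.n : ℤ) + 4 + v = ((I.n + 2 + v + 2 : ℕ) : ℤ) by push_cast; ring, hnat]
    simp only [encode, List.getD_cons_succ]
    rw [List.getD_append_right _ _ _ _ (by simp), List.length_ofFn,
      List.getD_eq_getElem _ _ (by simp; omega), List.getElem_ofFn, code, dif_pos ⟨by omega, hv⟩]
    congr 3
    simp
  · have h1 := length_le_inputSize I.encode
    rw [length_encode] at h1
    have h2 : I.n + 2 ≤ 2 ^ inputSize I.encode := by
      have := Nat.lt_two_pow_self (n := inputSize I.encode); omega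
    have h3 : (I.n + 2) * (I.n + 2) ≤ 2 ^ (2 * inputSize I.encode + 1) := by
      calc (I.n + 2) * (I.n + 2) ≤ 2 ^ inputSize I.encode * 2 ^ inputSize I.encode :=
            Nat.mul_le_mul h2 h2
        _ ≤ _ := by rw [← pow_add]; exact Nat.pow_le_pow_right (by norm_num) (by omega)
    exact_mod_cast h3

theorem abs_flatPos_coord_le {v : ℕ} (hv : v ≤ I.n + 1) :
    |flatPos I.coord v| ≤ 2 ^ (2 * inputSize I.encode + 1) := by
  have h := I.holds_load
  have hb : ∀ u ≤ I.n + 1, |I.coord u| ≤ 2 ^ inputSize I.encode := fun u hu => by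
    rw [← h.x_eq u hu]; exact bounded_load _ _
  have h1 := hb v hv
  have h2 := hb 0 (Nat.zero_le _)
  have h3 : (2 : ℤ) ^ inputSize I.encode * 2 ≤ 2 ^ (2 * inputSize I.encode + 1) := by
    rw [← pow_succ]; exact pow_le_pow_right₀ (by norm_num) (by omega)
  have h4 := abs_flatPos_le I.monotone_coord v
  rw [abs_le] at h1 h2
  omega

end RationalPattern

open Polynomial in
theorem mainTheorem3 :
    RAM.DecidableInPolynomialTime RationalPattern.encode
      (fun I : RationalPattern => I.toPattern.OneLayerFoldable) := by
  -- The fourth power bounds `(n + 2) ^ 4`, as the input has `2 * n + 4` entries of at least one bit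
  -- each. The factor `2 * X + 2` is one more than the number of bits `2 * X + 1` allowed per cell.
  refine ⟨RAM.Decider.program, X ^ 4 * C RAM.Decider.program.units * (2 * X + 2), fun I => ?_⟩
  obtain ⟨m, t, hrun, ht, hm⟩ := RAM.Decider.ends_program
    (fun p hp => by
      rcases I.code_cases (p + 1) (by omega) hp with h | h | h
      exacts [Or.inl h.1, Or.inr (Or.inr h.1), Or.inr (Or.inl h.1)])
    (fun v hv => I.abs_flatPos_coord_le hv) I.holds_load rfl rfl
  refine ⟨m, t, hrun, ht.trans ?_, ?_⟩
  · have h1 := RAM.length_le_inputSize I.encode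
    rw [I.length_encode] at h1
    simp only [eval_mul, eval_add, eval_pow, eval_X, eval_C, eval_ofNat]
    exact Nat.mul_le_mul (Nat.mul_le_mul_right _ (Nat.pow_le_pow_left (by omega) 4)) le_rfl
  · simp only [I.oneLayerFoldable_iff]
    rcases hm with ⟨h0, S, hS, hok⟩ | ⟨h0, hno⟩
    · refine ⟨fun _ => h0, fun h => absurd (Relaxation.assignable_of_allOK
        (F := flatPos I.coord) (fun v h1 hn => ?_)
        (fun v hv => flatPos_succ_ne (I.coord_lt_succ hv)) (fun v hv => (hS v hv).1) hok) h⟩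
      exact (I.code_cases v h1 hn).imp_left And.right
    · refine ⟨fun h => absurd (Relaxation.exists_solution_of_assignable (fun v h1 hn => ?_) h) hno,
        fun _ => h0⟩
      have := I.code_cases v h1 hn
      omega
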